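/- Conventions. Let $\mathrm{ZFC}^*$ denote a fixed, sufficiently large finite fragment of ZFC; that is, there is a finite set $T_0$ of axioms of ZFC such that all of the following holds for every finite set $\mathrm{ZFC}^*$ of axioms of ZFC with $T_0\subseteq\mathrm{ZFC}^*$. Let $\kappa$ be any cardinal. A *$\kappa$-model* is a transitive set $M$ of size $\kappa$ with $\kappa\in M$, $M\models\mathrm{ZFC}^*$ and $M^{<\kappa}\subseteq M$. An *embedding* $j:M\to N$ is an elementary embedding of $\langle M,\in\rangle$ into $\langle N,\in\rangle$ with $N$ a transitive set; its critical point $\mathrm{cp}(j)$ is the least ordinal moved by $j$. For an ordinal $\alpha$, $N^\alpha\subseteq N$ means that every function from $\alpha$ to $N$ is an element of $N$, and $N^{<\alpha}\subseteq N$ means that $N^\beta\subseteq N$ for all $\beta<\alpha$. A *$\theta$-strong unfoldability embedding* for a $\kappa$-model $M$ is an embedding $j:M\to N$ with $\mathrm{cp}(j)=\kappa$, $j(\kappa)\ge\theta$ and $V_\theta\subseteq N$. The cardinal $\kappa$ is *$\theta$-strongly unfoldable* if every $\kappa$-model has a $\theta$-strong unfoldability embedding, and *strongly unfoldable* if it is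 $\theta$-strongly unfoldable for every ordinal $\theta$. (If $\kappa^{<\kappa}\neq\kappa$ there are no $\kappa$-models, and all statements below hold trivially.) (a) The following are equivalent: 1. $\kappa$ is strongly unfoldable. 2. For every $\kappa$-model $M$ and every ordinal $\theta$ there is an embedding $j:M\to N$ with $\mathrm{cp}(j)=\kappa$, $j(\kappa)>\theta$ and $V_\theta\subseteq N$. 3. For every $\kappa$-model $M$ and every ordinal $\theta$ there is an embedding $j:M\to N$ with $\mathrm{cp}(j)=\kappa$, $j(\kappa)>\theta$ and $N^\theta\subseteq N$. (b) If $\kappa$ is $(\theta+1)$-strongly unfoldable, then every $\kappa$-model $M$ has a $(\theta+1)$-strong unfoldability embedding $j:M\to N$ with $\mathrm{cp}(j)=\kappa$, $j(\kappa)>\theta$, $V_{\theta+1}\subseteq N$ and $N^{\beth_\theta}\subseteq N$, and such that, if $\theta\ge\kappa$, moreover $|N|=\beth_{\theta+1}$. (c) If $\theta$ is a limit ordinal and $\kappa$ is $\theta$-strongly unfoldable, then every $\kappa$-model $M$ has a $\theta$-strong unfoldability embedding $j:M\to N$ with $\mathrm{cp}(j)=\kappa$, $j(\kappa)>\theta$,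 $V_\theta\subseteq N$ and $N^{<\mathrm{cof}(\theta)}\subseteq N$, and such that, if $\theta\ge\kappa$, moreover $|N|=\beth_\theta$. -/

import Mathlib

open FirstOrder Cardinal Ordinal

universe u

namespace Unfoldable

/-! ### The language of set theory and the axioms of ZFC -/

/-- The only symbol of the language of set theory: a binary relation symbol. -/
inductive MemRel : ℕ → Type
  | mem : MemRel 2

/-- The first-order language `{∈}` of set theory. -/
def setLang : FirstOrder.Language := ⟨fun _ => Empty, MemRel⟩

/-- A set, viewed as the structure `⟨M, ∈⟩` whose elements are the elements of `M`. -/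
instance memStructure (M : ZFSet.{u}) : setLang.Structure M where
  funMap := fun f => f.elim
  RelMap | .mem => fun x => (x 0 : ZFSet.{u}) ∈ (x 1 : ZFSet.{u})

/-- Formulas with variables `x₀, …, xₖ₋₁`. A quantifier in front of a formula in `k + 1` variables
binds the last variable `xₖ`. -/
abbrev Fml (k : ℕ) := setLang.BoundedFormula Empty k

/-- The formula `xᵢ ∈ xⱼ`. -/
def memF {k : ℕ} (i j : Fin k) : Fml k :=
  FirstOrder.Language.Relations.boundedFormula₂ (L := setLang) MemRel.mem (&i) (&j)

/-- The formula `xᵢ = xⱼ`. -/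
def eqF {k : ℕ} (i j : Fin k) : Fml k := (&i : setLang.Term (Empty ⊕ Fin k)) =' &j

/-- Substitution of variables: the `i`-th variable of `φ` becomes `x_(v i)`. -/
def subst {m k : ℕ} (φ : setLang.Formula (Fin m)) (v : Fin m → Fin k) : Fml k :=
  FirstOrder.Language.BoundedFormula.relabel (k := 0) (fun i => Sum.inr (v i)) φ

/-- `∀ x y, (∀ z, z ∈ x ↔ z ∈ y) → x = y` -/
def extensionality : setLang.Sentence :=
  ∀' ∀' ((∀' (memF (2 : Fin 3) 0 ⇔ memF 2 1)) ⟹ eqF (0 : Fin 2) 1)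

/-- `∀ x, (∃ y, y ∈ x) → ∃ y, y ∈ x ∧ ∀ z, z ∈ y → z ∉ x` -/
def foundation : setLang.Sentence :=
  ∀' ((∃' memF (1 : Fin 2) 0) ⟹
    ∃' (memF (1 : Fin 2) 0 ⊓ ∀' (memF (2 : Fin 3) 1 ⟹ ∼(memF (2 : Fin 3) 0))))

/-- `∀ x y, ∃ z, ∀ w, w ∈ z ↔ w = x ∨ w = y` -/
def pairing : setLang.Sentence :=
  ∀' ∀' ∃' ∀' (memF (3 : Fin 4) 2 ⇔ (eqF 3 0 ⊔ eqF 3 1))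

/-- `∀ x, ∃ y, ∀ z, z ∈ y ↔ ∃ w, w ∈ x ∧ z ∈ w` -/
def union : setLang.Sentence :=
  ∀' ∃' ∀' (memF (2 : Fin 3) 1 ⇔ ∃' (memF (3 : Fin 4) 0 ⊓ memF 2 3))

/-- `∀ x, ∃ y, ∀ z, z ∈ y ↔ ∀ w, w ∈ z → w ∈ x` -/
def powerSet : setLang.Sentence :=
  ∀' ∃' ∀' (memF (2 : Fin 3) 1 ⇔ ∀' (memF (3 : Fin 4) 2 ⟹ memF 3 0))

/-- `∃ x, (∃ y, y ∈ x ∧ ∀ z, z ∉ y) ∧ ∀ y, y ∈ x → ∃ z, z ∈ x ∧ ∀ w, w ∈ z ↔ w ∈ y ∨ w = y` -/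
def infinity : setLang.Sentence :=
  ∃' ((∃' (memF (1 : Fin 2) 0 ⊓ ∀' ∼(memF (2 : Fin 3) 1))) ⊓
    ∀' (memF (1 : Fin 2) 0 ⟹
      ∃' (memF (2 : Fin 3) 0 ⊓ ∀' (memF (3 : Fin 4) 2 ⇔ (memF 3 1 ⊔ eqF 3 1)))))

/-- Every family `x` of nonempty, pairwise disjoint sets has a transversal:
`∀ x, (∀ y, y ∈ x → ∃ z, z ∈ y) ∧ (∀ y z, y ∈ x ∧ z ∈ x ∧ (∃ w, w ∈ y ∧ w ∈ z) → y = z) →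
  ∃ c, ∀ y, y ∈ x → ∃ w, ∀ v, v ∈ c ∧ v ∈ y ↔ v = w` -/
def choice : setLang.Sentence :=
  ∀' (((∀' (memF (1 : Fin 2) 0 ⟹ ∃' memF (2 : Fin 3) 1)) ⊓
      (∀' ∀' ((memF (1 : Fin 3) 0 ⊓ (memF 2 0 ⊓ ∃' (memF (3 : Fin 4) 1 ⊓ memF 3 2))) ⟹
        eqF (1 : Fin 3) 2))) ⟹
    ∃' ∀' (memF (2 : Fin 3) 0 ⟹
      ∃' ∀' ((memF (4 : Fin 5) 1 ⊓ memF 4 2) ⇔ eqF 4 3)))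

/-- The instance of separation for `φ(p₀, …, pₙ₋₁, x)`:
`∀ p₀ … pₙ₋₁ a, ∃ b, ∀ x, x ∈ b ↔ x ∈ a ∧ φ(p, x)`, where `a, b, x` are the variables
number `n`, `n + 1`, `n + 2`. -/
def separation {n : ℕ} (φ : setLang.Formula (Fin (n + 1))) : setLang.Sentence :=
  FirstOrder.Language.BoundedFormula.alls (n := n)
    (∀' ∃' ∀' (memF (k := n + 3) (Fin.natAdd n 2) (Fin.natAdd n 1) ⇔
      (memF (k := n + 3) (Fin.natAdd n 2) (Fin.natAdd n 0) ⊓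
        subst (k := n + 3) φ (Fin.append (Fin.castAdd 3) ![Fin.natAdd n 2]))))

/-- The instance of replacement for `φ(p₀, …, pₙ₋₁, x, y)`:
`∀ p₀ … pₙ₋₁ a, (∀ x y z, x ∈ a ∧ φ(p, x, y) ∧ φ(p, x, z) → y = z) →
  ∃ b, ∀ y, y ∈ b ↔ ∃ x, x ∈ a ∧ φ(p, x, y)`. -/
def replacement {n : ℕ} (φ : setLang.Formula (Fin (n + 2))) : setLang.Sentence :=
  FirstOrder.Language.BoundedFormula.alls (n := n)
    (∀' ((∀' ∀' ∀' ((memF (k := n + 4) (Fin.natAdd n 1) (Fin.natAdd n 0) ⊓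
          (subst (k := n + 4) φ (Fin.append (Fin.castAdd 4) ![Fin.natAdd n 1, Fin.natAdd n 2]) ⊓
            subst (k := n + 4) φ (Fin.append (Fin.castAdd 4) ![Fin.natAdd n 1, Fin.natAdd n 3]))) ⟹
          eqF (k := n + 4) (Fin.natAdd n 2) (Fin.natAdd n 3))) ⟹
      ∃' ∀' (memF (k := n + 3) (Fin.natAdd n 2) (Fin.natAdd n 1) ⇔
        ∃' (memF (k := n + 4) (Fin.natAdd n 3) (Fin.natAdd n 0) ⊓
          subst (k := n + 4) φ (Fin.append (Fin.castAdd 4) ![Fin.natAdd n 3, Fin.natAdd n 2])))))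

/-- The axioms of ZFC. -/
inductive IsZFCAxiom : setLang.Sentence → Prop
  | extensionality : IsZFCAxiom extensionality
  | foundation : IsZFCAxiom foundation
  | pairing : IsZFCAxiom pairing
  | union : IsZFCAxiom union
  | powerSet : IsZFCAxiom powerSet
  | infinity : IsZFCAxiom infinity
  | choice : IsZFCAxiom choice
  | separation {n : ℕ} (φ : setLang.Formula (Fin (n + 1))) : IsZFCAxiom (separation φ)
  | replacement {n : ℕ} (φ : setLang.Formula (Fin (n + 2))) : IsZFCAxiom (replacement φ)

/-- The theory ZFC. -/
def ZFC : setLang.Theory := {σ | IsZFCAxiom σ}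

/-! ### Models and embeddings -/

/-- `N^α ⊆ N`: every function from the von Neumann ordinal `α` to `N` is an element of `N`. -/
def SeqClosed (N : ZFSet.{u}) (α : Ordinal.{u}) : Prop := ZFSet.funs α.toZFSet N ⊆ N

/-- `M` is a `κ`-model of set theory, with respect to the fragment `T` of ZFC: a transitive set of
size `κ` that contains `κ`, satisfies `T`, and has `M^{<κ} ⊆ M`. -/
structure IsKappaModel (T : setLang.Theory) (κ : Cardinal.{u}) (M : ZFSet.{u}) : Prop where
  transitive : M.IsTransitive
  card_eq : M.card = κ
  kappa_mem : κ.ord.toZFSet ∈ M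
  models : (M : Type (u + 1)) ⊨ T
  closed : ∀ α < κ.ord, SeqClosed M α

section Embedding

variable {M N : ZFSet.{u}}

/-- `α ∈ M` and `j(α) = β`, for ordinals `α` and `β`. -/
def MapsOrdinal (j : M ↪ₑ[setLang] N) (α β : Ordinal.{u}) : Prop :=
  ∃ h : α.toZFSet ∈ M, (j ⟨α.toZFSet, h⟩ : ZFSet.{u}) = β.toZFSet

/-- `κ` is the critical point of `j`, that is, the least ordinal of `M` that `j` moves. -/
def IsCriticalPoint (j : M ↪ₑ[setLang] N) (κ : Ordinal.{u}) : Prop :=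
  κ.toZFSet ∈ M ∧ ¬ MapsOrdinal j κ κ ∧ ∀ α < κ, MapsOrdinal j α α

/-- `j : M → N` is a `θ`-strong unfoldability embedding: an elementary embedding into a transitive
set `N` with critical point `κ`, `j(κ) ≥ θ` and `V_θ ⊆ N`. -/
structure IsStrongUnfoldabilityEmbedding (κ : Cardinal.{u}) (θ : Ordinal.{u})
    (j : M ↪ₑ[setLang] N) : Prop where
  transitive : N.IsTransitive
  critical : IsCriticalPoint j κ.ord
  target : ∃ δ, θ ≤ δ ∧ MapsOrdinal j κ.ord δ
  strong : ZFSet.vonNeumann θ ⊆ N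

end Embedding

/-- `κ` is `θ`-strongly unfoldable (`κ`-models being those for the fragment `T` of ZFC). -/
def IsThetaStronglyUnfoldable (T : setLang.Theory) (κ : Cardinal.{u}) (θ : Ordinal.{u}) : Prop :=
  ∀ M : ZFSet.{u}, IsKappaModel T κ M →
    ∃ (N : ZFSet.{u}) (j : M ↪ₑ[setLang] N), IsStrongUnfoldabilityEmbedding κ θ j

/-- `κ` is strongly unfoldable (`κ`-models being those for the fragment `T` of ZFC). -/
def IsStronglyUnfoldable (T : setLang.Theory) (κ : Cardinal.{u}) : Prop :=
  ∀ θ : Ordinal.{u}, IsThetaStronglyUnfoldable T κ θ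

end Unfoldable

/-! ### First-order properties, uniformly over transitive classes. -/

namespace Unfoldable
open FirstOrder.Language

/-! The fragment `T₀` consists of one replacement instance, `rangeAxiom`. It turns closure under
sequences into closure under small subsets (`mem_of_seqClosed`), the form `SmallClosed` that is used
throughout.

The main device is `exists_extension`: a κ-model M, together with chosen subsets of M as new
elements, lies in a κ-model M' that is the collapse of an elementary submodel of the universe, and
the inverse collapse fixes all these sets. Hence, for an embedding j : M' → N', whatever is true of
these sets in the universe is true in N' of their images, although M itself may satisfy very little
set theory. A first consequence is that κ is inaccessible (`isInaccessible`).

Small closed targets are obtained as hulls. Elements of M are named by codes in V_κ: there is a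
function h : V_κ × V_κ → M, where h(s, c) is the value of the code c at the parameter s. Every
element of M has a code, and codes allow applying Skolem functions of M and forming the set of
values of a set of codes. The graph of h is a subset of M, so it can be put into M'. Let j : M' → N'
be θ-strong and let C ⊆ j(V_κ) include V_max(θ,κ) and be closed under pairs. Then X = {j(h)(κ, c) :
c ∈ C} is an elementary submodel of j(M) which includes j''M and V_max(θ,κ) and contains κ.
Collapsing X gives an embedding M → N with critical point κ such that |N| ≤ |C| and N inherits the
closure of C under small subsets (`CoreData.exists_embedding`).

Three choices of C are used. With C = V_κ the target N is a κ-model, which settles θ below κ. For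
(b) with θ ≥ κ, C is the set of all sets hereditarily of size at most |V_θ| = ℶ_θ. It has at most
2^ℶ_θ elements and is closed under subsets of size ℶ_θ; it is included in j(V_κ) because each such
set is obtained by collapsing a relation coded by a subset of V_θ, hence by an element of V_(θ+1)
(`CoreData.mem_U_of_isHereditarily`). For (c) with θ > κ, C = V_θ, which is closed under subsets of
size less than cof θ; here a preliminary embedding of M into a κ-model makes the inequality j(κ) > θ
strict.

In (a), 1 → 3 is (b), and 3 → 1 holds because closure under sequences of length |V_θ| puts V_θ into
N by ∈-induction. -/

/-- A class, viewed as a structure for the language of set theory. -/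
instance classStructure (S : Set ZFSet.{u}) : setLang.Structure S where
  funMap := fun f => f.elim
  RelMap | .mem => fun x => (x 0 : ZFSet.{u}) ∈ (x 1 : ZFSet.{u})

/-- A class that contains the elements of its elements. -/
def TransClass (S : Set ZFSet.{u}) : Prop := ∀ x ∈ S, ∀ y ∈ x, y ∈ S

theorem transClass_univ : TransClass (Set.univ : Set ZFSet.{u}) := fun _ _ _ _ => trivial

theorem transClass_coe {M : ZFSet.{u}} (h : M.IsTransitive) : TransClass (M : Set ZFSet.{u}) :=
  fun _ hx _ hy => h.mem_trans hy hx

/-- The property `P` of tuples in transitive classes is first-order: one formula defines it in all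
transitive classes. -/
def IsFO {α : Type} (P : Set ZFSet.{u} → (α → ZFSet.{u}) → Prop) : Prop :=
  ∃ φ : setLang.Formula α, ∀ S : Set ZFSet.{u}, TransClass S → ∀ v : α → S,
    φ.Realize v ↔ P S fun i => v i

/-- The operation `F` has a first-order graph. -/
def IsTerm {α : Type} (F : (α → ZFSet.{u}) → ZFSet.{u}) : Prop :=
  IsFO fun _ (w : Option α → ZFSet.{u}) => w none = F fun i => w (some i)

namespace IsFO

variable {α β : Type} {P Q : Set ZFSet.{u} → (α → ZFSet.{u}) → Prop}

theorem congr (hP : IsFO P)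
    (h : ∀ S, TransClass S → ∀ v : α → ZFSet.{u}, (∀ i, v i ∈ S) → (P S v ↔ Q S v)) : IsFO Q := by
  obtain ⟨φ, hφ⟩ := hP
  exact ⟨φ, fun S hS v => (hφ S hS v).trans (h S hS _ fun i => (v i).2)⟩

theorem mem_var (a b : α) : IsFO fun _ (v : α → ZFSet.{u}) => v a ∈ v b :=
  ⟨FirstOrder.Language.Relations.formula₂ (L := setLang) MemRel.mem (Term.var a) (Term.var b),
    fun _ _ _ => (Formula.realize_rel₂ (L := setLang)).trans Iff.rfl⟩

theorem eq_var (a b : α) : IsFO fun _ (v : α → ZFSet.{u}) => v a = v b :=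
  ⟨Term.equal (Term.var a) (Term.var b), fun S _ v => by
    rw [Formula.realize_equal]
    simp [Subtype.ext_iff]⟩

theorem false : IsFO fun _ (_ : α → ZFSet.{u}) => False :=
  ⟨⊥, fun S _ v => by simp⟩

theorem imp (hP : IsFO P) (hQ : IsFO Q) : IsFO fun S v => P S v → Q S v := by
  obtain ⟨φ, hφ⟩ := hP
  obtain ⟨ψ, hψ⟩ := hQ
  exact ⟨φ.imp ψ, fun S hS v => by rw [Formula.realize_imp, hφ S hS, hψ S hS]⟩

theorem not (hP : IsFO P) : IsFO fun S v => ¬ P S v := hP.imp false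

theorem and (hP : IsFO P) (hQ : IsFO Q) : IsFO fun S v => P S v ∧ Q S v :=
  ((hP.imp hQ.not).not).congr fun S _ v _ => by tauto

theorem or (hP : IsFO P) (hQ : IsFO Q) : IsFO fun S v => P S v ∨ Q S v :=
  (hP.not.imp hQ).congr fun S _ v _ => by tauto

theorem iff (hP : IsFO P) (hQ : IsFO Q) : IsFO fun S v => (P S v ↔ Q S v) :=
  ((hP.imp hQ).and (hQ.imp hP)).congr fun S _ v _ => by tauto

/-- Quantifying over a whole tuple at once is needed to express the Skolem property of a formula
with `n` parameters. -/
theorem all_fin [Finite β] {R : Set ZFSet.{u} → (α → ZFSet.{u}) → (β → ZFSet.{u}) → Prop}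
    (h : IsFO fun S (w : α ⊕ β → ZFSet.{u}) =>
      R S (fun i => w (Sum.inl i)) (fun i => w (Sum.inr i))) :
    IsFO fun S v => ∀ x : β → ZFSet.{u}, (∀ i, x i ∈ S) → R S v x := by
  obtain ⟨φ, hφ⟩ := h
  refine ⟨φ.iAlls β, fun S hS v => ?_⟩
  rw [Formula.realize_iAlls]
  constructor
  · intro h x hx
    simpa using (hφ S hS _).1 (h fun i => ⟨x i, hx i⟩)
  · intro h x
    refine (hφ S hS _).2 ?_
    simpa using h (fun i => x i) fun i => (x i).2

theorem forall_fin [Finite β] {R : β → Set ZFSet.{u} → (α → ZFSet.{u}) → Prop}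
    (h : ∀ b, IsFO (R b)) : IsFO fun S v => ∀ b, R b S v := by
  choose φ hφ using h
  refine ⟨Formula.iInf φ, fun S hS v => ?_⟩
  rw [Formula.realize_iInf]
  exact forall_congr' fun b => hφ b S hS v

theorem relabel {R : Set ZFSet.{u} → (β → ZFSet.{u}) → Prop} (h : IsFO R) (f : β → α) :
    IsFO fun S (v : α → ZFSet.{u}) => R S fun i => v (f i) := by
  obtain ⟨φ, hφ⟩ := h
  exact ⟨Formula.relabel f φ, fun S hS v => by
    rw [Formula.realize_relabel, hφ S hS]
    rfl⟩

theorem all {R : Set ZFSet.{u} → (α → ZFSet.{u}) → ZFSet.{u} → Prop}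
    (h : IsFO fun S (w : Option α → ZFSet.{u}) => R S (fun i => w (some i)) (w none)) :
    IsFO fun S v => ∀ x ∈ S, R S v x := by
  have := (all_fin (β := Unit) (R := fun S v x => R S v (x ())) <|
    h.relabel fun o : Option α => o.elim (Sum.inr ()) Sum.inl)
  exact this.congr fun _ _ _ _ =>
    ⟨fun h x hx => h (fun _ => x) fun _ => hx, fun h x hx => h _ (hx _)⟩

theorem ex {R : Set ZFSet.{u} → (α → ZFSet.{u}) → ZFSet.{u} → Prop}
    (h : IsFO fun S (w : Option α → ZFSet.{u}) => R S (fun i => w (some i)) (w none)) :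
    IsFO fun S v => ∃ x ∈ S, R S v x :=
  (all (R := fun S v x => ¬ R S v x) h.not).not.congr fun S _ v _ => by
    push Not
    rfl

theorem ball {a : α} {R : Set ZFSet.{u} → (α → ZFSet.{u}) → ZFSet.{u} → Prop}
    (h : IsFO fun S (w : Option α → ZFSet.{u}) => R S (fun i => w (some i)) (w none)) :
    IsFO fun S v => ∀ x ∈ v a, R S v x :=
  (all (R := fun S v x => x ∈ v a → R S v x) ((mem_var none (some a)).imp h)).congr
    fun _ hS _ hv => ⟨fun h x hx => h x (hS _ (hv a) _ hx) hx, fun h x _ => h x⟩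

theorem bex {a : α} {R : Set ZFSet.{u} → (α → ZFSet.{u}) → ZFSet.{u} → Prop}
    (h : IsFO fun S (w : Option α → ZFSet.{u}) => R S (fun i => w (some i)) (w none)) :
    IsFO fun S v => ∃ x ∈ v a, R S v x :=
  (ball (a := a) (R := fun S v x => ¬ R S v x) h.not).not.congr fun _ _ _ _ => by
    push Not
    rfl

theorem subset_var (a b : α) : IsFO fun _ (v : α → ZFSet.{u}) => v a ⊆ v b :=
  (ball (a := a) (R := fun _ v x => x ∈ v b) (mem_var none (some b))).congr
    fun _ _ _ _ => Iff.rfl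

/-- The quantifier is bounded by `v a`, so the class need not be closed under `F`. -/
theorem mem {F : (α → ZFSet.{u}) → ZFSet.{u}} (hF : IsTerm F) (a : α) :
    IsFO fun _ v => F v ∈ v a :=
  (bex (a := a) (R := fun _ v x => x = F v) hF).congr fun _ _ _ _ => by simp

theorem eq {F : (α → ZFSet.{u}) → ZFSet.{u}} (hF : IsTerm F) (a : α) :
    IsFO fun _ v => v a = F v :=
  hF.relabel (fun o : Option α => o.elim a id)

end IsFO

namespace IsTerm

variable {α : Type}

theorem var (a : α) : IsTerm fun v : α → ZFSet.{u} => v a := IsFO.eq_var none (some a)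

theorem empty : IsTerm fun _ : α → ZFSet.{u} => ∅ :=
  (IsFO.ball (a := none) (R := fun _ _ _ => False) IsFO.false).congr fun _ _ _ _ => by
    simp [ZFSet.eq_empty]

theorem relabel {β : Type} {F : (α → ZFSet.{u}) → ZFSet.{u}} (hF : IsTerm F) (f : α → β) :
    IsTerm fun v => F fun i => v (f i) :=
  IsFO.relabel hF (Option.map f)

theorem upair {F G : (α → ZFSet.{u}) → ZFSet.{u}} (hF : IsTerm F) (hG : IsTerm G) :
    IsTerm fun v => ({F v, G v} : ZFSet.{u}) := by
  have := (IsFO.mem (hF.relabel some) none).and ((IsFO.mem (hG.relabel some) none).and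
    (IsFO.ball (a := none) (R := fun _ v x => x = F (fun i => v (some i)) ∨
      x = G (fun i => v (some i)))
      ((IsFO.relabel hF (Option.map some)).or (IsFO.relabel hG (Option.map some)))))
  refine this.congr fun S hS v hv => ?_
  constructor
  · rintro ⟨h1, h2, h3⟩
    ext z
    rw [ZFSet.mem_pair]
    refine ⟨h3 z, ?_⟩
    rintro (rfl | rfl) <;> assumption
  · intro h
    simp [h]

theorem singleton {F : (α → ZFSet.{u}) → ZFSet.{u}} (hF : IsTerm F) :
    IsTerm fun v => ({F v} : ZFSet.{u}) := by
  simpa using hF.upair hF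

theorem pair {F G : (α → ZFSet.{u}) → ZFSet.{u}} (hF : IsTerm F) (hG : IsTerm G) :
    IsTerm fun v => ZFSet.pair (F v) (G v) :=
  hF.singleton.upair (hF.upair hG)

end IsTerm
end Unfoldable

/-! ### Satisfaction in a set is first-order. -/

namespace Unfoldable
open FirstOrder.Language

/-- `φ` holds in the set `A` at given elements of `A`. -/
def SatIn (A : ZFSet.{u}) {β : Type} {n : ℕ} (φ : setLang.BoundedFormula β n)
    (v : β → ZFSet.{u}) (xs : Fin n → ZFSet.{u}) : Prop :=
  ∃ (hv : ∀ i, v i ∈ A) (hx : ∀ i, xs i ∈ A),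
    φ.Realize (M := A) (fun i => ⟨v i, hv i⟩) (fun i => ⟨xs i, hx i⟩)

theorem satIn_iff {A : ZFSet.{u}} {β : Type} {n : ℕ} (φ : setLang.BoundedFormula β n)
    (v : β → A) (xs : Fin n → A) :
    SatIn A φ (fun i => v i) (fun i => xs i) ↔ φ.Realize v xs :=
  ⟨fun ⟨_, _, h⟩ => h, fun h => ⟨fun i => (v i).2, fun i => (xs i).2, h⟩⟩

/-- A term of the language of set theory is a variable. -/
theorem exists_var {β : Type} (t : setLang.Term β) : ∃ b, t = Term.var b := by
  cases t with
  | var b => exact ⟨b, rfl⟩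
  | func f _ => exact f.elim

/-- All quantifiers of `φ` become bounded by the set `v a`. Elementary embeddings therefore respect
satisfaction in the elements of their domain. -/
theorem IsFO.satIn {β : Type} [Finite β] {n : ℕ} (φ : setLang.BoundedFormula β n) :
    ∀ {α : Type} (a : α) (b : β → α) (c : Fin n → α),
      IsFO fun _ (v : α → ZFSet.{u}) =>
        SatIn (v a) φ (fun i => v (b i)) (fun i => v (c i)) := by
  -- `SatIn` is false unless all variables take values in the set, so every case except falsum
  -- carries this clause.
  have key : ∀ {n : ℕ} {α : Type} (a : α) (b : β → α) (c : Fin n → α),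
      IsFO fun _ (v : α → ZFSet.{u}) => (∀ i, v (b i) ∈ v a) ∧ ∀ i, v (c i) ∈ v a :=
    fun a b c => (IsFO.forall_fin fun i => IsFO.mem_var _ _).and
      (IsFO.forall_fin fun i => IsFO.mem_var _ _)
  induction φ with
  | falsum =>
    intro α a b c
    exact IsFO.false.congr fun S _ v _ => ⟨False.elim, fun ⟨_, _, h⟩ => h⟩
  | equal t₁ t₂ =>
    intro α a b c
    obtain ⟨x, rfl⟩ := exists_var t₁
    obtain ⟨y, rfl⟩ := exists_var t₂
    refine ((key a b c).and (IsFO.eq_var (Sum.elim b c x) (Sum.elim b c y))).congr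
      fun S _ v _ => ?_
    refine ⟨fun h => ⟨h.1.1, h.1.2, ?_⟩, fun ⟨h1, h2, h3⟩ => ⟨⟨h1, h2⟩, ?_⟩⟩
    · have h3 := h.2
      refine Subtype.ext ?_
      rcases x with x | x <;> rcases y with y | y <;> exact h3
    · have h3 := congrArg Subtype.val h3
      rcases x with x | x <;> rcases y with y | y <;> exact h3
  | rel R ts =>
    intro α a b c
    cases R
    obtain ⟨x, hx⟩ := exists_var (ts 0)
    obtain ⟨y, hy⟩ := exists_var (ts 1)
    refine ((key a b c).and (IsFO.mem_var (Sum.elim b c x) (Sum.elim b c y))).congr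
      fun S _ v _ => ?_
    have aux : ∀ (h1 : ∀ i, v (b i) ∈ v a) (h2 : ∀ i, v (c i) ∈ v a),
        (BoundedFormula.rel (L := setLang) MemRel.mem ts).Realize (M := v a)
        (fun i => ⟨v (b i), h1 i⟩) (fun i => ⟨v (c i), h2 i⟩) ↔
        v (Sum.elim b c x) ∈ v (Sum.elim b c y) := by
      intro h1 h2
      change (((ts 0).realize _ : v a) : ZFSet.{u}) ∈ (((ts 1).realize _ : v a) : ZFSet.{u}) ↔ _
      rw [hx, hy]
      rcases x with x | x <;> rcases y with y | y <;> exact Iff.rfl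
    exact ⟨fun h => ⟨h.1.1, h.1.2, (aux _ _).2 h.2⟩, fun ⟨h1, h2, h3⟩ => ⟨⟨h1, h2⟩, (aux _ _).1 h3⟩⟩
  | imp φ ψ ih1 ih2 =>
    intro α a b c
    refine ((key a b c).and ((ih1 a b c).imp (ih2 a b c))).congr fun S _ v _ => ?_
    exact ⟨fun h => ⟨h.1.1, h.1.2, fun h3 => (h.2 ⟨h.1.1, h.1.2, h3⟩).2.2⟩,
      fun ⟨h1, h2, h3⟩ => ⟨⟨h1, h2⟩, fun h4 => ⟨h1, h2, h3 h4.2.2⟩⟩⟩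
  | @all n φ ih =>
    intro α a b c
    have := IsFO.ball (a := a) (R := fun _ v x => SatIn (v a) φ (fun i => v (b i))
      (Fin.snoc (α := fun _ => ZFSet.{u}) (fun i => v (c i)) x))
      ((ih (some a) (fun i => some (b i))
        (Fin.snoc (α := fun _ => Option α) (fun i => some (c i)) none)).congr
        fun S _ v _ => by
          have : (fun i => v (Fin.snoc (α := fun _ => Option α) (fun i => some (c i)) none i)) =
            Fin.snoc (α := fun _ => ZFSet.{u}) (fun i => v (some (c i))) (v none) := by
            ext i : 1
            refine Fin.lastCases ?_ (fun i => ?_) i <;> simp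
          rw [this])
    refine ((key a b c).and this).congr fun S _ v _ => ?_
    have aux : ∀ (h2 : ∀ i, v (c i) ∈ v a) (x : v a)
        (h3 : ∀ i, Fin.snoc (α := fun _ => ZFSet.{u}) (fun i => v (c i)) (x : ZFSet.{u}) i ∈ v a),
        (fun i => (⟨Fin.snoc (α := fun _ => ZFSet.{u}) (fun i => v (c i)) (x : ZFSet.{u}) i, h3 i⟩ :
          v a)) = Fin.snoc (α := fun _ => v a) (fun i => ⟨v (c i), h2 i⟩) x := by
      intro h2 x h3
      ext i : 2
      refine Fin.lastCases ?_ (fun i => ?_) i <;> simp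
    constructor
    · rintro ⟨⟨h1, h2⟩, h⟩
      refine ⟨h1, h2, ?_⟩
      rw [BoundedFormula.realize_all]
      intro x
      obtain ⟨_, h3, h4⟩ := h x x.2
      rwa [aux h2] at h4
    · rintro ⟨h1, h2, h⟩
      rw [BoundedFormula.realize_all] at h
      refine ⟨⟨h1, h2⟩, fun x hx => ⟨h1, fun i => ?_, ?_⟩⟩
      · refine Fin.lastCases ?_ (fun i => ?_) i <;> simp [h2, hx]
      · have := h ⟨x, hx⟩
        rwa [← aux h2 ⟨x, hx⟩] at this

theorem IsFO.transfer {α : Type} {P : Set ZFSet.{u} → (α → ZFSet.{u}) → Prop} (hP : IsFO P)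
    {S S' : Set ZFSet.{u}} (hS : TransClass S) (hS' : TransClass S') (f : S ↪ₑ[setLang] S')
    (v : α → S) : P S (fun i => v i) ↔ P S' fun i => f (v i) := by
  obtain ⟨φ, hφ⟩ := hP
  rw [← hφ S hS, ← f.map_formula, hφ S' hS']
  rfl

/-- An elementary embedding of sets, as an elementary embedding of classes. -/
def toClassEmb {M N : ZFSet.{u}} (j : M ↪ₑ[setLang] N) :
    (M : Set ZFSet.{u}) ↪ₑ[setLang] (N : Set ZFSet.{u}) := j

theorem IsFO.transfer_set {α : Type} {P : Set ZFSet.{u} → (α → ZFSet.{u}) → Prop} (hP : IsFO P)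
    {M N : ZFSet.{u}} (hM : M.IsTransitive) (hN : N.IsTransitive) (j : M ↪ₑ[setLang] N)
    (v : α → M) : P M (fun i => v i) ↔ P N fun i => j (v i) :=
  hP.transfer (transClass_coe hM) (transClass_coe hN) (toClassEmb j) v

/-! ### The universe of sets satisfies ZFC. -/

section Axioms

variable {S : Set ZFSet.{u}} {k : ℕ}

theorem realize_memF (i j : Fin k) (v : Empty → S) (xs : Fin k → S) :
    (memF i j).Realize v xs ↔ (xs i : ZFSet.{u}) ∈ (xs j : ZFSet.{u}) := Iff.rfl

theorem realize_eqF (i j : Fin k) (v : Empty → S) (xs : Fin k → S) :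
    (eqF i j).Realize v xs ↔ (xs i : ZFSet.{u}) = (xs j : ZFSet.{u}) :=
  Subtype.ext_iff

theorem realize_subst {m : ℕ} (φ : setLang.Formula (Fin m)) (w : Fin m → Fin k) (v : Empty → S)
    (xs : Fin k → S) : (subst φ w).Realize v xs ↔ φ.Realize fun i => xs (w i) := by
  rw [subst]
  refine BoundedFormula.realize_relabel.trans ?_
  rw [Formula.Realize]
  exact iff_of_eq (congrArg₂ _ rfl (Subsingleton.elim _ _))

theorem snoc_append {A : Type*} {n m : ℕ} (p : Fin n → A) (q : Fin m → A) (a : A) :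
    (Fin.snoc (α := fun _ => A) (Fin.append p q) a : Fin (n + m + 1) → A) =
      (Fin.append p (Fin.snoc (α := fun _ => A) q a) : Fin (n + (m + 1)) → A) := by
  ext i
  refine Fin.lastCases ?_ (fun i => ?_) i
  · have : Fin.last (n + m) = (Fin.natAdd n (Fin.last m) : Fin (n + (m + 1))) := rfl
    rw [Fin.snoc_last, this, Fin.append_right, Fin.snoc_last]
  · rw [Fin.snoc_castSucc]
    refine Fin.addCases (fun i => ?_) (fun i => ?_) i
    · have : (Fin.castAdd m i).castSucc = (Fin.castAdd (m + 1) i : Fin (n + (m + 1))) := rfl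
      rw [this, Fin.append_left, Fin.append_left]
    · have : (Fin.natAdd n i).castSucc = (Fin.natAdd n i.castSucc : Fin (n + (m + 1))) := rfl
      rw [this, Fin.append_right, Fin.append_right, Fin.snoc_castSucc]

theorem snoc₃ {A : Type*} {n : ℕ} (p : Fin n → A) (a b c : A) :
    (Fin.snoc (α := fun _ => A) (Fin.snoc (α := fun _ => A) (Fin.snoc (α := fun _ => A) p a) b) c) =
      Fin.append p ![a, b, c] := by
  have h : Fin.append p ![] = p := by
    ext i
    exact Fin.append_left p ![] i
  conv_lhs => rw [← h, snoc_append, snoc_append, snoc_append]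
  congr 1
  ext i
  fin_cases i <;> rfl

theorem snoc₄ {A : Type*} {n : ℕ} (p : Fin n → A) (a b c d : A) :
    (Fin.snoc (α := fun _ => A) (Fin.append p ![a, b, c]) d : Fin (n + 3 + 1) → A) =
      Fin.append p ![a, b, c, d] := by
  rw [snoc_append]
  congr 1
  ext i
  fin_cases i <;> rfl

theorem append_append {A : Type*} {n m k : ℕ} (p : Fin n → A) (q : Fin m → A) (r : Fin k → Fin m) :
    (fun i => Fin.append p q (Fin.append (Fin.castAdd m) (fun i => Fin.natAdd n (r i)) i)) =
      Fin.append p fun i => q (r i) := by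
  ext i
  refine Fin.addCases (fun i => ?_) (fun i => ?_) i <;> simp

theorem realize_replacement {n : ℕ} (φ : setLang.Formula (Fin (n + 2))) :
    S ⊨ replacement φ ↔ ∀ (p : Fin n → S) (a : S),
      (∀ x y z : S, (x : ZFSet.{u}) ∈ (a : ZFSet.{u}) ∧
        φ.Realize (Fin.append p ![x, y]) ∧ φ.Realize (Fin.append p ![x, z]) → y = z) →
      ∃ b : S, ∀ y : S, (y : ZFSet.{u}) ∈ (b : ZFSet.{u}) ↔
        ∃ x : S, (x : ZFSet.{u}) ∈ (a : ZFSet.{u}) ∧ φ.Realize (Fin.append p ![x, y]) := by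
  rw [replacement, Sentence.Realize, BoundedFormula.realize_alls]
  simp only [BoundedFormula.realize_all, BoundedFormula.realize_imp, BoundedFormula.realize_ex,
    BoundedFormula.realize_iff, BoundedFormula.realize_inf, realize_memF, realize_eqF,
    realize_subst, snoc₃, snoc₄, Fin.append_right]
  have h1 : ∀ i j : Fin 4, (![Fin.natAdd n i, Fin.natAdd n j] : Fin 2 → Fin (n + 4)) =
      fun l => Fin.natAdd n (![i, j] l) := fun i j => by
    ext l
    fin_cases l <;> rfl
  simp only [h1, append_append]
  have h2 : ∀ (A : Type (u + 1)) (q : Fin 4 → A) (i j : Fin 4),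
      (fun l => q (![i, j] l)) = ![q i, q j] := fun A q i j => by
    ext l
    fin_cases l <;> rfl
  simp only [h2, ← Subtype.ext_iff]
  rfl

theorem realize_separation {n : ℕ} (φ : setLang.Formula (Fin (n + 1))) :
    S ⊨ separation φ ↔ ∀ (p : Fin n → S) (a : S), ∃ b : S, ∀ x : S,
      (x : ZFSet.{u}) ∈ (b : ZFSet.{u}) ↔
        (x : ZFSet.{u}) ∈ (a : ZFSet.{u}) ∧ φ.Realize (Fin.append p ![x]) := by
  rw [separation, Sentence.Realize, BoundedFormula.realize_alls]
  simp only [BoundedFormula.realize_all, BoundedFormula.realize_ex,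
    BoundedFormula.realize_iff, BoundedFormula.realize_inf, realize_memF,
    realize_subst, snoc₃, Fin.append_right]
  have h1 : ∀ i : Fin 3, (![Fin.natAdd n i] : Fin 1 → Fin (n + 3)) =
      fun l => Fin.natAdd n (![i] l) := fun i => by
    ext l
    fin_cases l; rfl
  simp only [h1, append_append]
  have h2 : ∀ (A : Type (u + 1)) (q : Fin 3 → A) (i : Fin 3),
      (fun l => q (![i] l)) = ![q i] := fun A q i => by
    ext l
    fin_cases l; rfl
  simp only [h2]
  rfl

/-- The universe is a model of ZFC. -/
theorem univ_models_ZFC : (Set.univ : Set ZFSet.{u}) ⊨ ZFC := by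
  rw [Theory.model_iff]
  intro σ hσ
  induction hσ with
  | extensionality =>
    simp [extensionality, Sentence.Realize, Formula.Realize, realize_memF, realize_eqF, Fin.snoc,
      ZFSet.ext_iff]
  | foundation =>
    simp [foundation, Sentence.Realize, Formula.Realize, realize_memF, Fin.snoc]
    intro x y hy
    obtain ⟨z, hz, h⟩ := ZFSet.regularity x (fun h => by simp [h] at hy)
    refine ⟨z, hz, fun w hw hw' => ?_⟩
    have : w ∈ x ∩ z := by simp [hw, hw']
    simp [h] at this
  | pairing =>
    simp [pairing, Sentence.Realize, Formula.Realize, realize_memF, realize_eqF, Fin.snoc]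
    exact fun x y => ⟨{x, y}, by simp⟩
  | union =>
    simp [union, Sentence.Realize, Formula.Realize, realize_memF, Fin.snoc]
    exact fun x => ⟨ZFSet.sUnion x, by simp⟩
  | powerSet =>
    simp [powerSet, Sentence.Realize, Formula.Realize, realize_memF, Fin.snoc]
    exact fun x => ⟨x.powerset, by simp [ZFSet.subset_def]⟩
  | infinity =>
    simp [infinity, Sentence.Realize, Formula.Realize, realize_memF, realize_eqF, Fin.snoc]
    refine ⟨ZFSet.omega, ⟨∅, by simp⟩, fun y hy => ⟨insert y y, ZFSet.omega_succ hy, ?_⟩⟩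
    intro w
    rw [ZFSet.mem_insert_iff, or_comm]
  | choice =>
    simp [choice, Sentence.Realize, Formula.Realize, realize_memF, realize_eqF, Fin.snoc]
    intro x h1 h2
    choose! f hf using h1
    refine ⟨(ZFSet.sUnion x).sep fun z => ∃ y ∈ x, z = f y, fun y hy => ⟨f y, fun v => ?_⟩⟩
    rw [ZFSet.mem_sep, ZFSet.mem_sUnion]
    constructor
    · rintro ⟨⟨-, z, hz, rfl⟩, h⟩
      rw [h2 z y hz hy _ (hf z hz) h]
    · rintro rfl
      exact ⟨⟨⟨y, hy, hf y hy⟩, y, hy, rfl⟩, hf y hy⟩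
  | @separation n φ =>
    rw [realize_separation]
    intro p a
    refine ⟨⟨(a : ZFSet.{u}).sep fun x => φ.Realize (Fin.append p
      ![(⟨x, trivial⟩ : (Set.univ : Set ZFSet.{u}))]), trivial⟩, fun x => ?_⟩
    rw [ZFSet.mem_sep]
  | @replacement n φ =>
    rw [realize_replacement]
    intro p a h
    classical
    -- The default value `∅` may be a spurious element of the range of `f`; the separation below
    -- removes it.
    let f : ↥(a : ZFSet.{u}) → ZFSet.{u} := fun x =>
      if hx : ∃ y, φ.Realize (Fin.append p ![(⟨x, trivial⟩ : (Set.univ : Set ZFSet.{u})), y])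
      then hx.choose else ∅
    refine ⟨⟨(ZFSet.range f).sep fun y => ∃ x : (Set.univ : Set ZFSet.{u}),
      (x : ZFSet.{u}) ∈ (a : ZFSet.{u}) ∧ φ.Realize (Fin.append p
      ![x, (⟨y, trivial⟩ : (Set.univ : Set ZFSet.{u}))]), trivial⟩, fun y => ?_⟩
    rw [ZFSet.mem_sep, and_iff_right_iff_imp]
    rintro ⟨x, hx, hy⟩
    rw [ZFSet.mem_range]
    have hex : ∃ y, φ.Realize (Fin.append p ![(⟨x, trivial⟩ : (Set.univ : Set ZFSet.{u})), y]) :=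
      ⟨y, hy⟩
    refine ⟨⟨x, hx⟩, ?_⟩
    simp only [f]
    rw [dif_pos hex]
    exact congrArg Subtype.val (h x hex.choose y ⟨hx, hex.choose_spec, hy⟩)

end Axioms
end Unfoldable

/-! ### Cardinalities, elementary submodels and their collapses. -/

namespace Unfoldable
open FirstOrder.Language

section Card

theorem exists_injOn_of_card_le {x y : ZFSet.{u}} (h : x.card ≤ y.card) :
    ∃ F : ZFSet.{u} → ZFSet.{u}, (∀ a ∈ x, F a ∈ y) ∧ ∀ a ∈ x, ∀ b ∈ x, F a = F b → a = b := by
  classical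
  obtain ⟨e⟩ : Nonempty (x ↪ y) := by
    rw [← Cardinal.le_def, ZFSet.cardinalMk_coe_sort, ZFSet.cardinalMk_coe_sort]
    exact Cardinal.lift_le.2 h
  refine ⟨fun a => if ha : a ∈ x then e ⟨a, ha⟩ else ∅, fun a ha => ?_, fun a ha b hb => ?_⟩
  · simp only [ha, dif_pos]
    exact (e ⟨a, ha⟩).2
  · simp only [ha, hb, dif_pos]
    intro h
    exact congrArg Subtype.val (e.injective (Subtype.ext h))

theorem exists_surjOn_of_card_le {x y : ZFSet.{u}} (h : x.card ≤ y.card) (hx : x.Nonempty) :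
    ∃ F : ZFSet.{u} → ZFSet.{u}, (∀ b ∈ y, F b ∈ x) ∧ ∀ a ∈ x, ∃ b ∈ y, F b = a := by
  classical
  obtain ⟨G, hG, hG'⟩ := exists_injOn_of_card_le h
  obtain ⟨x₀, hx₀⟩ := hx
  refine ⟨fun b => if hb : ∃ a ∈ x, G a = b then hb.choose else x₀, fun b _ => ?_, fun a ha => ?_⟩
  · dsimp only
    split_ifs with hb
    · exact hb.choose_spec.1
    · exact hx₀
  · have hex : ∃ a' ∈ x, G a' = G a := ⟨a, ha, rfl⟩
    refine ⟨G a, hG a ha, ?_⟩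
    dsimp only
    rw [dif_pos hex]
    exact hG' _ hex.choose_spec.1 _ ha hex.choose_spec.2

theorem card_le_of_surjOn {x y : ZFSet.{u}} (F : ZFSet.{u} → ZFSet.{u})
    (h : ∀ a ∈ x, ∃ b ∈ y, F b = a) : x.card ≤ y.card := by
  rw [← Cardinal.lift_le.{u + 1}, ← ZFSet.cardinalMk_coe_sort, ← ZFSet.cardinalMk_coe_sort]
  choose G hG hG' using h
  refine Cardinal.mk_le_of_injective (f := fun a : x => (⟨G a a.2, hG a a.2⟩ : y)) ?_
  intro a b hab
  have := congrArg (fun c : y => F c) hab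
  simp only [hG'] at this
  exact Subtype.ext this

theorem card_le_of_injOn {x y : ZFSet.{u}} (F : ZFSet.{u} → ZFSet.{u})
    (h : ∀ a ∈ x, F a ∈ y) (h' : ∀ a ∈ x, ∀ b ∈ x, F a = F b → a = b) : x.card ≤ y.card := by
  rw [← Cardinal.lift_le.{u + 1}, ← ZFSet.cardinalMk_coe_sort, ← ZFSet.cardinalMk_coe_sort]
  refine Cardinal.mk_le_of_injective (f := fun a : x => (⟨F a, h a a.2⟩ : y)) ?_
  intro a b hab
  exact Subtype.ext (h' a a.2 b b.2 (congrArg Subtype.val hab))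

/-- The image of a set under an arbitrary map. -/
noncomputable def img (F : ZFSet.{u} → ZFSet.{u}) (x : ZFSet.{u}) : ZFSet.{u} :=
  ZFSet.range fun b : x => F b

@[simp]
theorem mem_img {F : ZFSet.{u} → ZFSet.{u}} {x z : ZFSet.{u}} : z ∈ img F x ↔ ∃ b ∈ x, F b = z := by
  simp [img]

theorem card_img_le (F : ZFSet.{u} → ZFSet.{u}) (x : ZFSet.{u}) : (img F x).card ≤ x.card :=
  card_le_of_surjOn F fun a ha => by simpa using ha

/-- The graph of a map on a set. -/
noncomputable def graphOn (F : ZFSet.{u} → ZFSet.{u}) (x : ZFSet.{u}) : ZFSet.{u} :=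
  img (fun b => ZFSet.pair b (F b)) x

@[simp]
theorem pair_mem_graphOn {F : ZFSet.{u} → ZFSet.{u}} {x a b : ZFSet.{u}} :
    ZFSet.pair a b ∈ graphOn F x ↔ a ∈ x ∧ b = F a := by
  simp only [graphOn, mem_img, ZFSet.pair_inj]
  constructor
  · rintro ⟨c, hc, rfl, rfl⟩
    exact ⟨hc, rfl⟩
  · rintro ⟨h, rfl⟩
    exact ⟨a, h, rfl, rfl⟩

end Card

section Collapse

variable {S : Set ZFSet.{u}}

theorem emb_mem_iff {S' : Set ZFSet.{u}} (f : S ↪ₑ[setLang] S') (x y : S) :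
    (f x : ZFSet.{u}) ∈ (f y : ZFSet.{u}) ↔ (x : ZFSet.{u}) ∈ (y : ZFSet.{u}) :=
  f.map_rel (MemRel.mem : setLang.Relations 2) ![x, y]

theorem emb_mem_iff_set {M N : ZFSet.{u}} (f : M ↪ₑ[setLang] N) (x y : M) :
    (f x : ZFSet.{u}) ∈ (f y : ZFSet.{u}) ↔ (x : ZFSet.{u}) ∈ (y : ZFSet.{u}) :=
  emb_mem_iff (toClassEmb f) x y

/-- The Tarski–Vaught criterion for `X` to be an elementary substructure of `S`. -/
def TarskiVaught (S X : Set ZFSet.{u}) : Prop :=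
  ∀ (n : ℕ) (φ : setLang.BoundedFormula Empty (n + 1)) (x : Fin n → S) (a : S),
    (∀ i, (x i : ZFSet.{u}) ∈ X) → φ.Realize default (Fin.snoc x a : Fin (n + 1) → S) →
    ∃ b : S, (b : ZFSet.{u}) ∈ X ∧ φ.Realize default (Fin.snoc x b : Fin (n + 1) → S)

/-- A set that distinguishes `x` from `y` lies in `S` by transitivity; the criterion, applied to the
formula saying that `z` distinguishes them, yields one in `X`. -/
theorem TarskiVaught.ext {X : Set ZFSet.{u}} (h : TarskiVaught S X) (hS : TransClass S)
    (hX : X ⊆ S) {x y : ZFSet.{u}} (hx : x ∈ X) (hy : y ∈ X)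
    (hxy : ∀ z ∈ X, z ∈ x ↔ z ∈ y) : x = y := by
  by_contra hne
  obtain ⟨z, hz⟩ : ∃ z, ¬ (z ∈ x ↔ z ∈ y) := by
    by_contra hcon
    push Not at hcon
    exact hne (ZFSet.ext hcon)
  have hzS : z ∈ S := by
    by_cases h1 : z ∈ x
    · exact hS x (hX hx) z h1
    · exact hS y (hX hy) z (by tauto)
  obtain ⟨b, hb, hb'⟩ := h 2 ((memF (2 : Fin 3) 0 ⇔ memF 2 1).not)
    ![⟨x, hX hx⟩, ⟨y, hX hy⟩] ⟨z, hzS⟩ (by intro i; fin_cases i <;> assumption)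
    (by
      rw [BoundedFormula.realize_not, BoundedFormula.realize_iff]
      simpa [realize_memF, Fin.snoc] using hz)
  rw [BoundedFormula.realize_not, BoundedFormula.realize_iff] at hb'
  apply hb'
  simpa [realize_memF, Fin.snoc] using hxy b hb

/-- The Mostowski collapse of a class. -/
noncomputable def collapse (X : Set ZFSet.{u}) (x : ZFSet.{u}) : ZFSet.{u} :=
  ZFSet.range fun y : {y : x // (y : ZFSet.{u}) ∈ X} => collapse X y.1
termination_by x
decreasing_by exact y.1.2

theorem mem_collapse {X : Set ZFSet.{u}} {x z : ZFSet.{u}} :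
    z ∈ collapse X x ↔ ∃ y ∈ x, y ∈ X ∧ collapse X y = z := by
  rw [collapse]
  simp only [ZFSet.mem_range, Subtype.exists, exists_prop]

theorem TarskiVaught.collapse_inj {X : Set ZFSet.{u}} (h : TarskiVaught S X) (hS : TransClass S)
    (hX : X ⊆ S) (x : ZFSet.{u}) :
    ∀ y, x ∈ X → y ∈ X → collapse X x = collapse X y → x = y := by
  induction x using ZFSet.inductionOn with
  | h x ih =>
    intro y hx hy hxy
    refine h.ext hS hX hx hy fun z hz => ⟨fun hzx => ?_, fun hzy => ?_⟩
    · have := mem_collapse.2 ⟨z, hzx, hz, rfl⟩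
      rw [hxy] at this
      obtain ⟨w, hw, hwX, he⟩ := mem_collapse.1 this
      rwa [ih z hzx w hz hwX he.symm]
    · have := mem_collapse.2 ⟨z, hzy, hz, rfl⟩
      rw [← hxy] at this
      obtain ⟨w, hw, hwX, he⟩ := mem_collapse.1 this
      rwa [← ih w hw z hwX hz he]

theorem exists_collapse {X : Set ZFSet.{u}} [Small.{u} X] (h : TarskiVaught S X)
    (hS : TransClass S) (hX : X ⊆ S) :
    ∃ (N : ZFSet.{u}) (g : (N : Set ZFSet.{u}) ↪ₑ[setLang] S), N.IsTransitive ∧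
      ∀ x, x ∈ X ↔ ∃ n, (g n : ZFSet.{u}) = x := by
  let N : ZFSet.{u} := ZFSet.range fun x : X => collapse X x
  have hN : ∀ z, z ∈ N ↔ ∃ x ∈ X, collapse X x = z := fun z => by simp [N]
  have hN' : ∀ z : (N : Set ZFSet.{u}), ∃ x ∈ X, collapse X x = z := fun z => (hN z).1 z.2
  choose g hg hg' using hN'
  have hmem : ∀ x ∈ X, ∀ y ∈ X, (collapse X x ∈ collapse X y ↔ x ∈ y) := by
    intro x hx y hy
    rw [mem_collapse]
    refine ⟨fun ⟨z, hz, hzX, he⟩ => ?_, fun hxy => ⟨x, hxy, hx, rfl⟩⟩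
    rwa [← h.collapse_inj hS hX z x hzX hx he]
  let f : (N : Set ZFSet.{u}) ↪[setLang] S :=
    { toFun := fun n => ⟨g n, hX (hg n)⟩
      inj' := fun a b hab => by
        have : g a = g b := congrArg Subtype.val hab
        exact Subtype.ext (by rw [← hg' a, ← hg' b, this])
      map_fun' := fun F => F.elim
      map_rel' := fun R x => by
        cases R
        change g (x 0) ∈ g (x 1) ↔ (x 0 : ZFSet.{u}) ∈ (x 1 : ZFSet.{u})
        rw [← hmem _ (hg _) _ (hg _), hg', hg'] }
  have hsurj : ∀ x ∈ X, ∃ n, g n = x := fun x hx => by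
    refine ⟨⟨collapse X x, (hN _).2 ⟨x, hx, rfl⟩⟩, h.collapse_inj hS hX _ _ (hg _) hx ?_⟩
    rw [hg']
  refine ⟨N, f.toElementaryEmbedding fun n φ x a ha => ?_, fun z hz y hy => ?_, fun x => ?_⟩
  · obtain ⟨b, hb, hb'⟩ := h n φ (f ∘ x) a (fun i => hg _) ha
    obtain ⟨c, hc⟩ := hsurj b hb
    refine ⟨c, ?_⟩
    have : f c = b := Subtype.ext hc
    rwa [this]
  · obtain ⟨x, hx, rfl⟩ := (hN z).1 hz
    obtain ⟨w, _, hw, rfl⟩ := mem_collapse.1 hy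
    exact (hN _).2 ⟨w, hw, rfl⟩
  · exact ⟨hsurj x, fun ⟨n, hn⟩ => hn ▸ hg n⟩

variable {X : Set ZFSet.{u}} {N : ZFSet.{u}} {g : (N : Set ZFSet.{u}) ↪ₑ[setLang] S}

/-- The inverse of the collapse is the identity on transitive subsets of its range. -/
theorem collapse_fixes (hN : N.IsTransitive)
    (hX : ∀ x, x ∈ X ↔ ∃ n, (g n : ZFSet.{u}) = x) {t : Set ZFSet.{u}} (ht : TransClass t)
    (htX : t ⊆ X) (x : ZFSet.{u}) (hx : x ∈ t) : ∃ h : x ∈ N, (g ⟨x, h⟩ : ZFSet.{u}) = x := by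
  induction x using ZFSet.inductionOn with
  | h x ih =>
    obtain ⟨n, hn⟩ := (hX x).1 (htX hx)
    have : x = n := by
      ext y
      constructor
      · intro hy
        obtain ⟨hyN, he⟩ := ih y hy (ht x hx y hy)
        refine (emb_mem_iff g ⟨y, hyN⟩ n).1 ?_
        rwa [he, hn]
      · intro hy
        have hyN : y ∈ N := hN.mem_trans hy n.2
        have h1 := (emb_mem_iff g ⟨y, hyN⟩ n).2 hy
        rw [hn] at h1
        obtain ⟨h2, h3⟩ := ih _ h1 (ht x hx _ h1)
        have := g.injective (Subtype.ext h3)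
        have h4 := congrArg Subtype.val this
        simp only at h4
        rwa [← h4]
    exact ⟨this ▸ n.2, by
      have h5 : (⟨x, this ▸ n.2⟩ : (N : Set ZFSet.{u})) = n := Subtype.ext this
      rw [h5, hn]⟩

/-- This is how closure properties reach the collapse: it suffices that `X` has an element `A` whose
trace on `X` is the pointwise image of `B`. Other elements of `A` do not matter. -/
theorem mem_of_image_mem (hN : N.IsTransitive)
    (hX : ∀ x, x ∈ X ↔ ∃ n, (g n : ZFSet.{u}) = x) {A B : ZFSet.{u}} (hB : B ⊆ N) (hA : A ∈ X)
    (hAB : ∀ n : (N : Set ZFSet.{u}), (g n : ZFSet.{u}) ∈ A ↔ (n : ZFSet.{u}) ∈ B) : B ∈ N := by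
  obtain ⟨n, hn⟩ := (hX A).1 hA
  have : B = n := by
    ext y
    constructor
    · intro hy
      have := (hAB ⟨y, hB hy⟩).2 hy
      rw [← hn] at this
      exact (emb_mem_iff g ⟨y, hB hy⟩ n).1 this
    · intro hy
      have hyN : y ∈ N := hN.mem_trans hy n.2
      have h1 := (emb_mem_iff g ⟨y, hyN⟩ n).2 hy
      rw [hn] at h1
      exact (hAB ⟨y, hyN⟩).1 h1
  exact this ▸ n.2

end Collapse

/-- An elementary embedding of a transitive set restricts to each of its elements. -/
theorem exists_restrict {M' N' : ZFSet.{u}} (hM' : M'.IsTransitive) (hN' : N'.IsTransitive)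
    (j : M' ↪ₑ[setLang] N') {M : ZFSet.{u}} (hM : M ∈ M') :
    ∃ k : M ↪ₑ[setLang] (j ⟨M, hM⟩ : ZFSet.{u}),
      ∀ x : M, (k x : ZFSet.{u}) = j ⟨x, hM'.mem_trans x.2 hM⟩ := by
  refine ⟨⟨fun x => ⟨j ⟨x, hM'.mem_trans x.2 hM⟩, (emb_mem_iff_set j _ _).2 x.2⟩, ?_⟩,
    fun x => rfl⟩
  intro n φ x
  -- Truth of `φ` in `M` is a property of elements of `M'`, with `M` itself as the extra variable
  -- `none`.
  have := (IsFO.satIn φ (α := Option (Fin n)) none some default).transfer_set hM' hN' j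
    fun o => o.elim ⟨M, hM⟩ fun i => ⟨x i, hM'.mem_trans (x i).2 hM⟩
  have h1 := (satIn_iff φ x default).symm.trans
    ((iff_of_eq (congrArg _ (Subsingleton.elim _ _))).trans this)
  rw [Formula.Realize, Formula.Realize]
  refine Iff.trans ?_ h1.symm
  refine (satIn_iff φ _ default).symm.trans (iff_of_eq (congrArg _ (Subsingleton.elim _ _)))

end Unfoldable

/-! ### Closure under sequences and closure under small subsets. -/

namespace Unfoldable
open FirstOrder.Language

theorem isFO_pair_mem : IsFO fun _ (v : Fin 3 → ZFSet.{u}) => ZFSet.pair (v 1) (v 2) ∈ v 0 :=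
  IsFO.mem ((IsTerm.var 1).pair (IsTerm.var 2)) 0

/-- The instance of replacement that gives the range of a function. -/
noncomputable def rangeAxiom : setLang.Sentence :=
  replacement (n := 1) isFO_pair_mem.{u}.choose

/-- Every subset of `M` of size less than `μ` is an element of `M`. -/
def SmallClosed (M : ZFSet.{u}) (μ : Cardinal.{u}) : Prop :=
  ∀ B : ZFSet.{u}, B ⊆ M → B.card < μ → B ∈ M

/-- The graph of a surjection from `α` onto `B` is in `M` by sequence closure, and replacement
yields its range. There is no such surjection for `B = ∅` and `α ≠ 0`; then `∅` is found as an
∈-minimal element of `α`. -/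
theorem mem_of_seqClosed {M : ZFSet.{u}} (hM : M.IsTransitive) (hr : M ⊨ rangeAxiom.{u})
    {α : Ordinal.{u}} (hα : α.toZFSet ∈ M) (hc : SeqClosed M α) {B : ZFSet.{u}} (hB : B ⊆ M)
    (hcard : B.card ≤ α.card) : B ∈ M := by
  rcases B.eq_empty_or_nonempty with rfl | hne
  · rcases α.toZFSet.eq_empty_or_nonempty with h | h
    · exact h ▸ hα
    · obtain ⟨y, hy, he⟩ := ZFSet.regularity α.toZFSet (fun h' => by simp [h'] at h)
      have : y = ∅ := by
        rw [ZFSet.eq_empty]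
        intro z hz
        have : z ∈ α.toZFSet ∩ y := by
          simp only [ZFSet.mem_inter, hz, and_true]
          exact (ZFSet.isOrdinal_toZFSet α).mem_trans hz hy
        simp [he] at this
      exact this ▸ hM.mem_trans hy hα
  · obtain ⟨F, hF, hF'⟩ := exists_surjOn_of_card_le (y := α.toZFSet)
      (by rwa [Ordinal.card_toZFSet]) hne
    have hf : graphOn F α.toZFSet ∈ M := by
      apply hc
      rw [ZFSet.mem_funs]
      refine ⟨fun z hz => ?_, fun z hz => ⟨F z, by simp [hz], fun w hw => ?_⟩⟩
      · simp only [graphOn, mem_img] at hz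
        obtain ⟨b, hb, rfl⟩ := hz
        exact ZFSet.pair_mem_prod.2 ⟨hb, hB (hF b hb)⟩
      · exact (pair_mem_graphOn.1 hw).2
    have hr' : (M : Set ZFSet.{u}) ⊨ rangeAxiom.{u} := hr
    rw [rangeAxiom, realize_replacement] at hr'
    have key : ∀ x y : (M : Set ZFSet.{u}), (isFO_pair_mem.{u}.choose).Realize
        (Fin.append (![⟨_, hf⟩] : Fin 1 → (M : Set ZFSet.{u})) ![x, y]) ↔
        (x : ZFSet.{u}) ∈ α.toZFSet ∧ (y : ZFSet.{u}) = F x := by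
      intro x y
      rw [isFO_pair_mem.{u}.choose_spec _ (transClass_coe hM)]
      exact pair_mem_graphOn
    obtain ⟨b, hb⟩ := hr' ![⟨_, hf⟩] ⟨_, hα⟩ (by
      rintro x y z ⟨-, h1, h2⟩
      rw [key] at h1 h2
      exact Subtype.ext (h1.2.trans h2.2.symm))
    have : (b : ZFSet.{u}) = B := by
      ext y
      constructor
      · intro hy
        obtain ⟨x, -, hx⟩ := (hb ⟨y, hM.mem_trans hy b.2⟩).1 hy
        rw [key] at hx
        have h3 : y = F x := hx.2
        exact h3 ▸ hF x hx.1
      · intro hy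
        obtain ⟨x, hx, he⟩ := hF' y hy
        refine (hb ⟨y, hB hy⟩).2 ⟨⟨x, hM.mem_trans hx hα⟩, hx, ?_⟩
        rw [key]
        exact ⟨hx, he.symm⟩
    exact this ▸ b.2

namespace SmallClosed

variable {N : ZFSet.{u}} {μ : Cardinal.{u}}

theorem pair_set_mem (h : SmallClosed N μ) (hμ : ℵ₀ ≤ μ) {x y : ZFSet.{u}} (hx : x ∈ N)
    (hy : y ∈ N) : ({x, y} : ZFSet.{u}) ∈ N := by
  refine h _ (fun z hz => ?_) ?_
  · rcases ZFSet.mem_pair.1 hz with rfl | rfl <;> assumption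
  · refine lt_of_le_of_lt ZFSet.card_insert_le ?_
    rw [ZFSet.card_singleton, one_add_one_eq_two]
    exact lt_of_lt_of_le (by exact_mod_cast Cardinal.natCast_lt_aleph0 (n := 2)) hμ

theorem pair_mem (h : SmallClosed N μ) (hμ : ℵ₀ ≤ μ) {x y : ZFSet.{u}} (hx : x ∈ N)
    (hy : y ∈ N) : ZFSet.pair x y ∈ N := by
  have h1 := h.pair_set_mem hμ hx hx
  rw [ZFSet.pair_eq_singleton] at h1
  exact h.pair_set_mem hμ h1 (h.pair_set_mem hμ hx hy)

theorem toZFSet_mem (h : SmallClosed N μ) (α : Ordinal.{u}) (hα : α.card < μ) :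
    α.toZFSet ∈ N := by
  induction α using WellFoundedLT.induction with
  | ind α ih =>
    refine h _ (fun z hz => ?_) (by rwa [Ordinal.card_toZFSet])
    obtain ⟨β, hβ, rfl⟩ := Ordinal.mem_toZFSet_iff.1 hz
    exact ih β hβ ((Ordinal.card_le_card hβ.le).trans_lt hα)

theorem seqClosed (h : SmallClosed N μ) (hμ : ℵ₀ ≤ μ) {α : Ordinal.{u}} (hα : α.card < μ) :
    SeqClosed N α := by
  intro f hf
  rw [ZFSet.mem_funs] at hf
  refine h f (fun z hz => ?_) (lt_of_le_of_lt ?_ hα)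
  · obtain ⟨a, ha, b, hb, rfl⟩ := ZFSet.mem_prod.1 (hf.1 hz)
    refine h.pair_mem hμ ?_ hb
    obtain ⟨β, hβ, rfl⟩ := Ordinal.mem_toZFSet_iff.1 ha
    exact h.toZFSet_mem β ((Ordinal.card_le_card hβ.le).trans_lt hα)
  · rw [← Ordinal.card_toZFSet]
    choose! F hF hF' using hf.2
    refine card_le_of_surjOn (fun a => ZFSet.pair a (F a)) fun z hz => ?_
    obtain ⟨a, ha, b, hb, rfl⟩ := ZFSet.mem_prod.1 (hf.1 hz)
    exact ⟨a, ha, by rw [hF' a ha b hz]⟩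

end SmallClosed

/-- The set κ ∪ {κ} is included in `M`, so κ + 1 ≤ κ. -/
theorem IsKappaModel.aleph0_le {T : setLang.Theory} {κ : Cardinal.{u}} {M : ZFSet.{u}}
    (h : IsKappaModel T κ M) : ℵ₀ ≤ κ := by
  by_contra hlt
  push Not at hlt
  have h1 : insert κ.ord.toZFSet κ.ord.toZFSet ⊆ M := by
    intro z hz
    rcases ZFSet.mem_insert_iff.1 hz with rfl | hz
    · exact h.kappa_mem
    · exact h.transitive.mem_trans hz h.kappa_mem
  have h2 := ZFSet.card_mono h1
  rw [ZFSet.card_insert (ZFSet.mem_irrefl _), Ordinal.card_toZFSet, Cardinal.card_ord,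
    h.card_eq] at h2
  obtain ⟨n, rfl⟩ := Cardinal.lt_aleph0.1 hlt
  norm_cast at h2
  omega

theorem IsKappaModel.smallClosed {T : setLang.Theory} {κ : Cardinal.{u}} {M : ZFSet.{u}}
    (h : IsKappaModel T κ M) (hT : rangeAxiom.{u} ∈ T) : SmallClosed M κ := by
  intro B hB hcard
  have hlt : B.card.ord < κ.ord := Cardinal.ord_lt_ord.2 hcard
  refine mem_of_seqClosed h.transitive (h.models.realize_of_mem _ hT) (α := B.card.ord)
    (h.transitive.mem_trans (Ordinal.toZFSet_mem_toZFSet_iff.2 hlt) h.kappa_mem)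
    (h.closed _ hlt) hB ?_
  rw [Cardinal.card_ord]

/-- A criterion for being a `κ`-model. -/
theorem isKappaModel_of_smallClosed {T : setLang.Theory} {κ : Cardinal.{u}} {M : ZFSet.{u}}
    (hM : M.IsTransitive) (hκ : ℵ₀ ≤ κ) (hcard : M.card = κ) (hmem : κ.ord.toZFSet ∈ M)
    (hT : (M : Type (u + 1)) ⊨ T) (hc : SmallClosed M κ) : IsKappaModel T κ M :=
  ⟨hM, hcard, hmem, hT, fun _ hα => hc.seqClosed hκ (Cardinal.lt_ord.1 hα)⟩

end Unfoldable

/-! ### Codes for the elements of a hull. -/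

namespace Unfoldable
open FirstOrder.Language

section Codes

/-- Pairwise distinct sets used as labels. -/
def tag : ℕ → ZFSet.{u}
  | 0 => ∅
  | n + 1 => {tag n}

theorem tag_injective : Function.Injective tag.{u} := by
  intro m
  induction m with
  | zero =>
    rintro (_ | n) h
    · rfl
    · exact absurd (h ▸ ZFSet.mem_singleton.2 rfl : tag n ∈ tag 0) (ZFSet.notMem_empty _)
  | succ m ih =>
    rintro (_ | n) h
    · exact absurd (h ▸ ZFSet.mem_singleton.2 rfl : tag m ∈ tag 0) (ZFSet.notMem_empty _)
    · rw [ih (ZFSet.singleton_injective h)]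

theorem IsTerm.tag {α : Type} : ∀ n : ℕ, IsTerm fun _ : α → ZFSet.{u} => Unfoldable.tag n
  | 0 => IsTerm.empty
  | n + 1 => (IsTerm.tag n).singleton

/-- Coding of tuples. -/
noncomputable def tup : ∀ {n : ℕ}, (Fin n → ZFSet.{u}) → ZFSet.{u}
  | 0, _ => ∅
  | _ + 1, c => ZFSet.pair (c 0) (tup (Fin.tail c))

theorem tup_injective : ∀ {n : ℕ}, Function.Injective (tup.{u} (n := n))
  | 0, _, _, _ => Subsingleton.elim _ _
  | n + 1, c, d, h => by
    rw [tup, tup, ZFSet.pair_inj] at h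
    rw [← Fin.cons_self_tail c, ← Fin.cons_self_tail d, h.1, tup_injective h.2]

theorem IsTerm.tup {α : Type} : ∀ {n : ℕ} (c : Fin n → α),
    IsTerm fun v : α → ZFSet.{u} => Unfoldable.tup fun i => v (c i)
  | 0, _ => IsTerm.empty
  | _ + 1, c => (IsTerm.var (c 0)).pair (IsTerm.tup (Fin.tail c))

theorem rank_lt_pair_left (x y : ZFSet.{u}) : x.rank < (ZFSet.pair x y).rank := by
  simp [ZFSet.pair]

theorem rank_lt_pair_right (x y : ZFSet.{u}) : y.rank < (ZFSet.pair x y).rank := by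
  simp [ZFSet.pair]

theorem rank_lt_tup : ∀ {n : ℕ} (c : Fin n → ZFSet.{u}) (i : Fin n), (c i).rank < (tup c).rank
  | n + 1, c, i => by
    rw [tup]
    refine Fin.cases ?_ (fun i => ?_) i
    · exact rank_lt_pair_left _ _
    · exact (rank_lt_tup (Fin.tail c) i).trans (rank_lt_pair_right _ _)

theorem tup_mem {N : ZFSet.{u}} (h0 : ∅ ∈ N) (hp : ∀ x ∈ N, ∀ y ∈ N, ZFSet.pair x y ∈ N) :
    ∀ {n : ℕ} (c : Fin n → ZFSet.{u}), (∀ i, c i ∈ N) → tup c ∈ N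
  | 0, _, _ => h0
  | _ + 1, c, h => hp _ (h 0) _ (tup_mem h0 hp (Fin.tail c) fun i => h i.succ)

theorem tag_mem {N : ZFSet.{u}} {μ : Cardinal.{u}} (h : SmallClosed N μ) (hμ : ℵ₀ ≤ μ) :
    ∀ n, tag n ∈ N
  | 0 => h ∅ (ZFSet.empty_subset _) (by
      rw [ZFSet.card_empty]
      exact Cardinal.aleph0_pos.trans_le hμ)
  | n + 1 => by
    have := h.pair_set_mem hμ (tag_mem h hμ n) (tag_mem h hμ n)
    rwa [ZFSet.pair_eq_singleton] at this

/-- The formulas with a distinguished last variable. -/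
abbrev Fmls := Σ n, setLang.BoundedFormula Empty (n + 1)

variable (sk : ∀ φ : Fmls, (Fin φ.1 → ZFSet.{u}) → ZFSet.{u}) (num : Fmls → ZFSet.{u})
  (b : ZFSet.{u} → ZFSet.{u})

open Classical in
/-- The value of a code: codes name given sets, sets of values of codes, and values of the
operations `sk` at values of codes. -/
noncomputable def value (c : ZFSet.{u}) : ZFSet.{u} :=
  if h : ∃ a, c = ZFSet.pair (tag 0) a then h.choose
  else if h : ∃ a, c = ZFSet.pair (tag 1) a then ZFSet.range fun y : h.choose => value y
  else if h : ∃ p : Σ φ : Fmls, (Fin φ.1 → ZFSet.{u}),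
    c = ZFSet.pair (tag 2) (ZFSet.pair (num p.1) (tup p.2)) then
    sk h.choose.1 fun i => value (h.choose.2 i)
  else if h : ∃ a, c = ZFSet.pair (tag 3) a then b h.choose
  else ∅
termination_by c.rank
decreasing_by
  · have := h.choose_spec
    conv_rhs => rw [this]
    exact (ZFSet.rank_lt_of_mem y.2).trans (rank_lt_pair_right _ _)
  · have := h.choose_spec
    conv_rhs => rw [this]
    exact ((rank_lt_tup _ i).trans (rank_lt_pair_right _ _)).trans (rank_lt_pair_right _ _)

variable {sk num b}

theorem value_self (a : ZFSet.{u}) : value sk num b (ZFSet.pair (tag 0) a) = a := by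
  have h : ∃ a', ZFSet.pair (tag 0) a = ZFSet.pair (tag 0) a' := ⟨a, rfl⟩
  rw [value, dif_pos h]
  exact ((ZFSet.pair_inj.1 h.choose_spec).2).symm

theorem not_tag {m n : ℕ} (h : m ≠ n) (a : ZFSet.{u}) :
    ¬ ∃ a', ZFSet.pair (tag m) a = ZFSet.pair (tag n) a' := fun ⟨_, h'⟩ =>
  h (tag_injective (ZFSet.pair_inj.1 h').1)

theorem value_img (a : ZFSet.{u}) :
    value sk num b (ZFSet.pair (tag 1) a) = img (value sk num b) a := by
  have h : ∃ a', ZFSet.pair (tag 1) a = ZFSet.pair (tag 1) a' := ⟨a, rfl⟩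
  rw [value, dif_neg (not_tag (by decide) a), dif_pos h]
  have := (ZFSet.pair_inj.1 h.choose_spec).2
  conv_rhs => rw [this]
  rfl

theorem value_sk (hnum : Function.Injective num) (φ : Fmls) (cs : Fin φ.1 → ZFSet.{u}) :
    value sk num b (ZFSet.pair (tag 2) (ZFSet.pair (num φ) (tup cs))) =
      sk φ fun i => value sk num b (cs i) := by
  have h : ∃ p : Σ φ : Fmls, (Fin φ.1 → ZFSet.{u}),
    ZFSet.pair (tag 2) (ZFSet.pair (num φ) (tup cs)) =
      ZFSet.pair (tag 2) (ZFSet.pair (num p.1) (tup p.2)) := ⟨⟨φ, cs⟩, rfl⟩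
  rw [value, dif_neg (not_tag (by decide) _), dif_neg (not_tag (by decide) _), dif_pos h]
  generalize h.choose_spec = hs
  revert hs
  generalize h.choose = p
  obtain ⟨ψ, ds⟩ := p
  intro hs
  simp only [ZFSet.pair_inj, true_and] at hs
  obtain rfl := hnum hs.1
  rw [tup_injective hs.2]

theorem value_base (a : ZFSet.{u}) : value sk num b (ZFSet.pair (tag 3) a) = b a := by
  have h : ∃ a', ZFSet.pair (tag 3) a = ZFSet.pair (tag 3) a' := ⟨a, rfl⟩
  rw [value, dif_neg (not_tag (by decide) _), dif_neg (not_tag (by decide) _),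
    dif_neg (fun ⟨p, hp⟩ => not_tag (m := 3) (n := 2) (by decide) a ⟨_, hp⟩), dif_pos h]
  have := (ZFSet.pair_inj.1 h.choose_spec).2
  conv_rhs => rw [this]

theorem value_cases (c : ZFSet.{u}) : (∃ a, c = ZFSet.pair (tag 0) a) ∨
    (∃ a, c = ZFSet.pair (tag 1) a) ∨ (∃ (φ : Fmls) (cs : Fin φ.1 → ZFSet.{u}),
      c = ZFSet.pair (tag 2) (ZFSet.pair (num φ) (tup cs))) ∨
    (∃ a, c = ZFSet.pair (tag 3) a) ∨ value sk num b c = ∅ := by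
  by_cases h0 : ∃ a, c = ZFSet.pair (tag 0) a
  · exact Or.inl h0
  by_cases h1 : ∃ a, c = ZFSet.pair (tag 1) a
  · exact Or.inr (Or.inl h1)
  by_cases h2 : ∃ p : Σ φ : Fmls, (Fin φ.1 → ZFSet.{u}),
    c = ZFSet.pair (tag 2) (ZFSet.pair (num p.1) (tup p.2))
  · exact Or.inr (Or.inr (Or.inl ⟨h2.choose.1, h2.choose.2, h2.choose_spec⟩))
  by_cases h3 : ∃ a, c = ZFSet.pair (tag 3) a
  · exact Or.inr (Or.inr (Or.inr (Or.inl h3)))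
  rw [value, dif_neg h0, dif_neg h1, dif_neg h2, dif_neg h3]
  simp

end Codes

instance : Countable Fmls := by
  have : Countable (Σ l, setLang.Functions l) := ⟨⟨fun f => f.2.elim, fun f => f.2.elim⟩⟩
  have : Countable (Σ l, setLang.Relations l) :=
    ⟨⟨fun _ => 0, by rintro ⟨_, ⟨⟩⟩ ⟨_, ⟨⟩⟩ _; rfl⟩⟩
  have : Countable setLang.Symbols := inferInstanceAs (Countable (_ ⊕ _))
  exact Function.Injective.countable
    (f := fun φ : Fmls => (⟨φ.1 + 1, φ.2⟩ : Σ n, setLang.BoundedFormula Empty n))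
    (by rintro ⟨m, φ⟩ ⟨n, ψ⟩ h; simp at h; obtain ⟨rfl, h⟩ := h; simpa using h)

end Unfoldable

/-! ### Skolem functions and the extension of a κ-model. -/

namespace Unfoldable
open FirstOrder.Language

/-- A numbering of formulas by natural numbers. -/
noncomputable def fmlNum (φ : Fmls) : ZFSet.{u} :=
  ((Countable.exists_injective_nat Fmls).choose φ : Ordinal.{u}).toZFSet

theorem fmlNum_injective : Function.Injective fmlNum.{u} := by
  intro φ ψ h
  have := Ordinal.toZFSet_injective h
  exact (Countable.exists_injective_nat Fmls).choose_spec (by exact_mod_cast this)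

theorem fmlNum_mem {N : ZFSet.{u}} {μ : Cardinal.{u}} (h : SmallClosed N μ) (hμ : ℵ₀ ≤ μ)
    (φ : Fmls) : fmlNum φ ∈ N :=
  h.toZFSet_mem _ (lt_of_lt_of_le (by simp) hμ)

open Classical in
/-- Skolem functions for the class `S`; the default value is the empty set. -/
noncomputable def skolem (S : Set ZFSet.{u}) (φ : Fmls) (cs : Fin φ.1 → ZFSet.{u}) : ZFSet.{u} :=
  if h : ∃ (x : Fin φ.1 → S) (b : S), (∀ i, (x i : ZFSet.{u}) = cs i) ∧
    φ.2.Realize default (Fin.snoc x b : Fin (φ.1 + 1) → S) then (h.choose_spec.choose : ZFSet.{u})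
  else ∅

theorem skolem_spec {S : Set ZFSet.{u}} {n : ℕ} (φ : setLang.BoundedFormula Empty (n + 1))
    (x : Fin n → S) (a : S) (h : φ.Realize default (Fin.snoc x a : Fin (n + 1) → S)) :
    ∃ b : S, (b : ZFSet.{u}) = skolem S ⟨n, φ⟩ (fun i => x i) ∧
      φ.Realize default (Fin.snoc x b : Fin (n + 1) → S) := by
  have hex : ∃ (y : Fin n → S) (b : S), (∀ i, (y i : ZFSet.{u}) = x i) ∧
    φ.Realize default (Fin.snoc y b : Fin (n + 1) → S) := ⟨x, a, fun _ => rfl, h⟩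
  refine ⟨hex.choose_spec.choose, ?_, ?_⟩
  · rw [skolem, dif_pos hex]
  · have h1 := hex.choose_spec.choose_spec
    revert h1
    generalize hex.choose_spec.choose = b
    generalize hex.choose = y
    rintro ⟨h1, h2⟩
    rwa [← (funext fun i => Subtype.ext (h1 i) : y = x)]

theorem skolem_mem {S : Set ZFSet.{u}} (h : ∅ ∈ S) (φ : Fmls) (cs : Fin φ.1 → ZFSet.{u}) :
    skolem S φ cs ∈ S := by
  rw [skolem]
  split_ifs with h'
  · exact Subtype.mem _
  · exact h

/-- Every `κ`-model `M`, together with given subsets of `M`, is included in a `κ`-model that is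
the collapse of an elementary submodel of the universe. -/
theorem exists_extension {T : setLang.Theory} (hT : T ⊆ ZFC) {κ : Cardinal.{u}} (hκ : ℵ₀ ≤ κ)
    {M : ZFSet.{u}} (hM : M.IsTransitive) (hcard : M.card = κ) (hmem : κ.ord.toZFSet ∈ M)
    (hsc : SmallClosed M κ) (b : ZFSet.{u} → ZFSet.{u}) (hb : ∀ c ∈ M, b c ⊆ M) :
    ∃ (M' : ZFSet.{u}) (i : (M' : Set ZFSet.{u}) ↪ₑ[setLang] (Set.univ : Set ZFSet.{u})),
      IsKappaModel T κ M' ∧ SmallClosed M' κ ∧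
      (∀ x ∈ M, ∃ h : x ∈ M', (i ⟨x, h⟩ : ZFSet.{u}) = x) ∧
      ∀ c ∈ M, ∃ h : b c ∈ M', (i ⟨b c, h⟩ : ZFSet.{u}) = b c := by
  -- `X` is the set of values of all codes in `M`. Thus |X| ≤ κ, and each closure property of `M`
  -- gives one of `X`: pairs allow Skolem terms, small subsets allow set codes.
  let H := value (skolem Set.univ) fmlNum b
  let X : Set ZFSet.{u} := (img H M : Set ZFSet.{u})
  have hXmem : ∀ x, x ∈ X ↔ ∃ c ∈ M, H c = x := fun x => mem_img
  have hp : ∀ x ∈ M, ∀ y ∈ M, ZFSet.pair x y ∈ M := fun x hx y hy => hsc.pair_mem hκ hx hy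
  have hMX : ∀ x ∈ M, x ∈ X := fun x hx =>
    (hXmem x).2 ⟨_, hp _ (tag_mem hsc hκ 0) _ hx, value_self x⟩
  have hbX : ∀ c ∈ M, b c ∈ X := fun c hc =>
    (hXmem _).2 ⟨_, hp _ (tag_mem hsc hκ 3) _ hc, value_base c⟩
  have htv : TarskiVaught Set.univ X := by
    intro n φ x a hx ha
    choose c hc hc' using fun i => (hXmem _).1 (hx i)
    obtain ⟨y, hy, hy'⟩ := skolem_spec φ x a ha
    refine ⟨y, (hXmem _).2 ⟨_, hp _ (tag_mem hsc hκ 2) _ (hp _ (fmlNum_mem hsc hκ ⟨n, φ⟩) _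
      (tup_mem (tag_mem hsc hκ 0) hp c hc)), ?_⟩, hy'⟩
    refine (value_sk fmlNum_injective ⟨n, φ⟩ c).trans ?_
    rw [hy]
    exact congrArg _ (funext hc')
  have : Small.{u} X := inferInstanceAs (Small.{u} (img H M))
  obtain ⟨N, g, hN, hg⟩ := exists_collapse htv transClass_univ (Set.subset_univ X)
  have hfix : ∀ t : Set ZFSet.{u}, TransClass t → t ⊆ X → ∀ x ∈ t,
      ∃ h : x ∈ N, (g ⟨x, h⟩ : ZFSet.{u}) = x := fun t ht htX =>
    collapse_fixes hN hg ht htX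
  have hfixM := hfix M (transClass_coe hM) hMX
  have hclosed : SmallClosed N κ := by
    intro B hB hBc
    have h1 : ∀ n : (N : Set ZFSet.{u}), ∃ c ∈ M, H c = g n := fun n =>
      (hXmem _).1 ((hg _).2 ⟨n, rfl⟩)
    choose c hcM hc using h1
    classical
    -- A chosen code for each element of `B`. These form a small subset of `M`, hence an element,
    -- and tag 1 makes of it a code for the image of `B`.
    let a : ZFSet.{u} := img (fun n => if h : n ∈ N then c ⟨n, h⟩ else ∅) B
    have haM : a ∈ M := by
      refine hsc a (fun z hz => ?_) ((card_img_le _ _).trans_lt hBc)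
      obtain ⟨n, hn, rfl⟩ := mem_img.1 hz
      rw [dif_pos (hB hn)]
      exact hcM _
    refine mem_of_image_mem hN hg (A := img H a) hB
      ((hXmem _).2 ⟨_, hp _ (tag_mem hsc hκ 1) _ haM, value_img a⟩) fun n => ?_
    rw [mem_img]
    constructor
    · rintro ⟨d, hd, hd'⟩
      obtain ⟨m, hm, rfl⟩ := mem_img.1 hd
      rw [dif_pos (hB hm), hc] at hd'
      have := g.injective (Subtype.ext hd')
      rwa [← this]
    · intro hn
      refine ⟨_, mem_img.2 ⟨n, hn, rfl⟩, ?_⟩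
      rw [dif_pos (hB hn)]
      exact hc _
  refine ⟨N, g, isKappaModel_of_smallClosed hN hκ ?_ (hfixM _ hmem).1 ?_ hclosed, hclosed, hfixM,
    fun c hc => ?_⟩
  · refine le_antisymm ?_ ?_
    · rw [← hcard]
      refine le_trans ?_ (card_img_le H M)
      classical
      refine card_le_of_injOn (fun n => if h : n ∈ N then g ⟨n, h⟩ else ∅) (fun n hn => ?_)
        fun n hn m hm h => ?_
      · rw [dif_pos hn]
        exact (hg _).2 ⟨_, rfl⟩
      · rw [dif_pos hn, dif_pos hm] at h
        exact congrArg Subtype.val (g.injective (Subtype.ext h))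
    · rw [← hcard]
      exact ZFSet.card_mono fun x hx => (hfixM x hx).1
  · exact (g.theory_model_iff T).2 (univ_models_ZFC.mono hT)
  -- Since `b c ⊆ M`, adding it to `M` leaves a transitive subclass of `X`, which the collapse does
  -- not move.
  · refine hfix (M ∪ {b c} : Set ZFSet.{u}) ?_ ?_ (b c) (Or.inr rfl)
    · rintro x (hx | rfl) y hy
      · exact Or.inl (hM.mem_trans hy hx)
      · exact Or.inl (hb c hc hy)
    · rintro x (hx | rfl)
      · exact hMX x hx
      · exact hbX c hc

end Unfoldable

/-! ### Embeddings with critical point κ. -/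

namespace Unfoldable
open FirstOrder.Language

/-- `J` is elementary from the transitive class `M` to the transitive class `N`. -/
structure IsElem (M N : Set ZFSet.{u}) (J : ZFSet.{u} → ZFSet.{u}) : Prop where
  left : TransClass M
  right : TransClass N
  maps : ∀ x ∈ M, J x ∈ N
  transfer : ∀ {α : Type} {P : Set ZFSet.{u} → (α → ZFSet.{u}) → Prop}, IsFO P →
    ∀ v : α → ZFSet.{u}, (∀ i, v i ∈ M) → (P M v ↔ P N fun i => J (v i))

open Classical in
/-- An elementary embedding as a map on the universe. -/
noncomputable def ev {S S' : Set ZFSet.{u}} (j : S ↪ₑ[setLang] S') (x : ZFSet.{u}) : ZFSet.{u} :=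
  if h : x ∈ S then j ⟨x, h⟩ else ∅

theorem ev_of_mem {S S' : Set ZFSet.{u}} (j : S ↪ₑ[setLang] S') {x : ZFSet.{u}} (h : x ∈ S) :
    ev j x = j ⟨x, h⟩ :=
  dif_pos h

theorem isElem_ev {S S' : Set ZFSet.{u}} (hS : TransClass S) (hS' : TransClass S')
    (j : S ↪ₑ[setLang] S') : IsElem S S' (ev j) where
  left := hS
  right := hS'
  maps x hx := by
    rw [ev_of_mem j hx]
    exact Subtype.mem _
  transfer hP v hv := by
    refine (hP.transfer hS hS' j fun i => ⟨v i, hv i⟩).trans ?_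
    simp only [← ev_of_mem]

theorem mapsOrdinal_iff {M N : ZFSet.{u}} (j : M ↪ₑ[setLang] N) (α β : Ordinal.{u}) :
    MapsOrdinal j α β ↔ α.toZFSet ∈ M ∧ ev (toClassEmb j) α.toZFSet = β.toZFSet := by
  constructor
  · rintro ⟨h, h'⟩
    refine ⟨h, ?_⟩
    rw [ev_of_mem _ h]
    exact h'
  · rintro ⟨h, h'⟩
    refine ⟨h, ?_⟩
    rw [ev_of_mem _ h] at h'
    exact h'

namespace IsElem

variable {M N : Set ZFSet.{u}} {J : ZFSet.{u} → ZFSet.{u}}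

theorem mem_iff (h : IsElem M N J) {x y : ZFSet.{u}} (hx : x ∈ M) (hy : y ∈ M) :
    J x ∈ J y ↔ x ∈ y :=
  (h.transfer (IsFO.mem_var (0 : Fin 2) 1) ![x, y] (by intro i; fin_cases i <;> assumption)).symm

theorem map_pair (h : IsElem M N J) {x y : ZFSet.{u}} (hx : x ∈ M) (hy : y ∈ M)
    (hp : ZFSet.pair x y ∈ M) : J (ZFSet.pair x y) = ZFSet.pair (J x) (J y) :=
  (h.transfer (IsFO.eq ((IsTerm.var (0 : Fin 3)).pair (IsTerm.var 1)) 2) ![x, y, ZFSet.pair x y]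
    (by intro i; fin_cases i <;> assumption)).1 rfl

theorem map_tag (h : IsElem M N J) (n : ℕ) (hp : tag n ∈ M) : J (tag n) = tag n :=
  (h.transfer (IsFO.eq (IsTerm.tag n) (0 : Fin 1)) ![tag n]
    (by intro i; fin_cases i; assumption)).1 rfl

theorem isOrdinal (h : IsElem M N J) {x : ZFSet.{u}} (hx : x ∈ M) (ho : x.IsOrdinal) :
    (J x).IsOrdinal := by
  have hfo : IsFO fun _ (v : Fin 1 → ZFSet.{u}) =>
      (∀ y ∈ v 0, ∀ z ∈ y, z ∈ v 0) ∧ ∀ y ∈ v 0, ∀ z ∈ y, ∀ w ∈ z, w ∈ y := by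
    repeat' first
      | apply IsFO.ball
      | apply IsFO.and
      | apply IsFO.mem_var
  have := h.transfer hfo ![x] (by intro i; fin_cases i; assumption)
  rw [ZFSet.isOrdinal_iff_forall_mem_isTransitive] at ho ⊢
  exact this.1 ho

/-- The map `J` has critical point `κ`. -/
def Crit (M : Set ZFSet.{u}) (J : ZFSet.{u} → ZFSet.{u}) (κ : Ordinal.{u}) : Prop :=
  κ.toZFSet ∈ M ∧ J κ.toZFSet ≠ κ.toZFSet ∧ ∀ α < κ, J α.toZFSet = α.toZFSet

theorem _root_.Unfoldable.crit_ev {M N : ZFSet.{u}} {j : M ↪ₑ[setLang] N} {κ : Ordinal.{u}}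
    (h : IsCriticalPoint j κ) : Crit M (ev (toClassEmb j)) κ :=
  ⟨h.1, fun h' => h.2.1 ((mapsOrdinal_iff _ _ _).2 ⟨h.1, h'⟩), fun α hα =>
    ((mapsOrdinal_iff _ _ _).1 (h.2.2 α hα)).2⟩

theorem toZFSet_mem (h : IsElem M N J) {κ α : Ordinal.{u}} (hc : κ.toZFSet ∈ M) (hα : α < κ) :
    α.toZFSet ∈ M := h.left _ hc _ (Ordinal.toZFSet_mem_toZFSet_iff.2 hα)

/-- The ordinals below κ are fixed, so the ordinal `J κ` includes κ, and it differs from κ. -/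
theorem crit_mem (h : IsElem M N J) {κ : Ordinal.{u}} (hc : Crit M J κ) :
    κ.toZFSet ∈ J κ.toZFSet := by
  have h1 := h.isOrdinal hc.1 (ZFSet.isOrdinal_toZFSet κ)
  have h2 : κ.toZFSet ⊆ J κ.toZFSet := by
    intro z hz
    obtain ⟨β, hβ, rfl⟩ := Ordinal.mem_toZFSet_iff.1 hz
    have h3 := h.toZFSet_mem hc.1 hβ
    rw [← hc.2.2 β hβ]
    exact (h.mem_iff h3 hc.1).2 hz
  exact (((ZFSet.isOrdinal_toZFSet κ).subset_iff_eq_or_mem h1).1 h2).resolve_left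
    fun h' => hc.2.1 h'.symm

end IsElem

section Small

variable {M : ZFSet.{u}} {N : Set ZFSet.{u}} {J : ZFSet.{u} → ZFSet.{u}} {κ : Cardinal.{u}}

/-- An embedding with critical point `κ` maps a set with fewer than `κ` elements to its
pointwise image. -/
theorem IsElem.map_small (h : IsElem M N J) (hκ : ℵ₀ ≤ κ) (hsc : SmallClosed M κ)
    (hc : IsElem.Crit M J κ.ord) {x : ZFSet.{u}} (hx : x ∈ M) (hcard : x.card < κ)
    {z : ZFSet.{u}} (hz : z ∈ J x) : ∃ y ∈ x, J y = z := by
  have hxM : ∀ y ∈ x, y ∈ M := h.left x hx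
  have hne : x.Nonempty := by
    by_contra hne
    have hx0 : x = ∅ := x.eq_empty_or_nonempty.resolve_right hne
    have h0 := h.map_tag 0 (by rw [hx0] at hx; exact hx)
    rw [hx0] at hz
    change z ∈ J (tag 0) at hz
    rw [h0] at hz
    exact absurd hz (ZFSet.notMem_empty z)
  have hlt : x.card.ord < κ.ord := Cardinal.ord_lt_ord.2 hcard
  -- Enumerate `x` along the ordinal |x| < κ. This ordinal and its elements are fixed by `J`, so the
  -- image of the enumeration takes exactly the values `J (F a)`.
  obtain ⟨F, hF, hF'⟩ := exists_surjOn_of_card_le (x := x) (y := x.card.ord.toZFSet)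
    (by rw [Ordinal.card_toZFSet, Cardinal.card_ord]) hne
  set l := x.card.ord.toZFSet with hl
  have hlM : l ∈ M := h.toZFSet_mem hc.1 hlt
  have hpM : ∀ a ∈ l, ZFSet.pair a (F a) ∈ M := fun a ha =>
    hsc.pair_mem hκ (h.left _ hlM a ha) (hxM _ (hF a ha))
  have hg : graphOn F l ∈ M := by
    refine hsc _ (fun p hp => ?_) ((card_img_le _ _).trans_lt ?_)
    · obtain ⟨a, ha, rfl⟩ := mem_img.1 hp
      exact hpM a ha
    · rwa [Ordinal.card_toZFSet, Cardinal.card_ord]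
  have hfo : IsFO fun S (v : Fin 3 → ZFSet.{u}) =>
      (∀ z ∈ v 0, ∃ a ∈ v 1, ZFSet.pair a z ∈ v 2) ∧
      ∀ a ∈ S, ∀ z ∈ S, ∀ z' ∈ S, ZFSet.pair a z ∈ v 2 → ZFSet.pair a z' ∈ v 2 → z = z' := by
    repeat' first
      | apply IsFO.ball
      | apply IsFO.bex
      | apply IsFO.all
      | apply IsFO.and
      | apply IsFO.imp
      | apply IsFO.eq_var
      | apply IsFO.mem
      | apply IsTerm.pair
  obtain ⟨h1, h2⟩ := (h.transfer hfo ![x, l, graphOn F l]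
    (by intro i; fin_cases i <;> assumption)).1 (by
      refine ⟨fun z hz => ?_, fun a _ z _ z' _ hz hz' => ?_⟩
      · obtain ⟨b, hb, rfl⟩ := hF' z hz
        exact ⟨b, hb, pair_mem_graphOn.2 ⟨hb, rfl⟩⟩
      · exact (pair_mem_graphOn.1 hz).2.trans (pair_mem_graphOn.1 hz').2.symm)
  obtain ⟨a, ha, haz⟩ := h1 z hz
  have hJl : J l = l := hc.2.2 _ hlt
  change a ∈ J l at ha
  rw [hJl] at ha
  have hJa : J a = a := by
    obtain ⟨β, hβ, rfl⟩ := Ordinal.mem_toZFSet_iff.1 ha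
    exact hc.2.2 _ (hβ.trans hlt)
  refine ⟨F a, hF a ha, ?_⟩
  have haM := h.left _ hlM a ha
  have hFM := hxM _ (hF a ha)
  have h3 := (h.mem_iff (hpM a ha) hg).2 (pair_mem_graphOn.2 ⟨ha, rfl⟩)
  rw [h.map_pair haM hFM (hpM a ha), hJa] at h3
  have hJg := h.maps _ hg
  refine h2 a ?_ _ (h.maps _ hFM) z (h.right _ (h.maps _ hx) z hz) h3 haz
  have := h.maps a haM
  rwa [hJa] at this

/-- An embedding with critical point `κ` fixes the sets with fewer than `κ` elements that it fixes
pointwise. -/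
theorem IsElem.map_eq_of_small (h : IsElem M N J) (hκ : ℵ₀ ≤ κ) (hsc : SmallClosed M κ)
    (hc : IsElem.Crit M J κ.ord) {x : ZFSet.{u}} (hx : x ∈ M) (hcard : x.card < κ)
    (hfix : ∀ y ∈ x, J y = y) : J x = x := by
  ext z
  constructor
  · intro hz
    obtain ⟨y, hy, rfl⟩ := h.map_small hκ hsc hc hx hcard hz
    rwa [hfix y hy]
  · intro hz
    rw [← hfix z hz]
    exact (h.mem_iff (h.left x hx z hz) hx).2 hz

/-- Each nonempty element of ω has a largest element. If κ = ω, this transfers to the elements of `J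
κ`, one of which is ω. -/
theorem IsElem.aleph0_lt (h : IsElem M N J) (hκ : ℵ₀ ≤ κ) (hc : IsElem.Crit M J κ.ord) :
    ℵ₀ < κ := by
  refine lt_of_le_of_ne hκ ?_
  rintro rfl
  have hfo : IsFO fun _ (v : Fin 1 → ZFSet.{u}) =>
      ∀ y ∈ v 0, (∃ z ∈ y, True) → ∃ z ∈ y, ∀ w ∈ y, w ∈ z ∨ w = z := by
    have ht : ∀ {α : Type}, IsFO fun _ (_ : α → ZFSet.{u}) => True := fun {α} =>
      (IsFO.false.not).congr fun _ _ _ _ => not_false_iff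
    repeat' first
      | apply IsFO.ball
      | apply IsFO.bex
      | apply IsFO.imp
      | apply IsFO.or
      | apply IsFO.eq_var
      | apply IsFO.mem_var
      | apply ht
  have h1 := (h.transfer hfo ![(ℵ₀ : Cardinal.{u}).ord.toZFSet]
    (by intro i; fin_cases i; exact hc.1)).1 (by
      intro y hy hne
      obtain ⟨β, hβ, rfl⟩ := Ordinal.mem_toZFSet_iff.1 hy
      rw [Cardinal.ord_aleph0, Ordinal.lt_omega0] at hβ
      obtain ⟨n, rfl⟩ := hβ
      obtain ⟨z, hz, -⟩ := hne
      rcases n with _ | n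
      · simp at hz
      · refine ⟨(n : Ordinal.{u}).toZFSet, ?_, fun w hw => ?_⟩
        · rw [Ordinal.toZFSet_mem_toZFSet_iff]
          exact_mod_cast n.lt_succ_self
        · rw [Nat.cast_succ, Ordinal.toZFSet_add_one, ZFSet.mem_insert_iff] at hw
          exact hw.symm)
  have h2 := h1 _ (h.crit_mem hc) ⟨(0 : Ordinal.{u}).toZFSet, by
    rw [Ordinal.toZFSet_mem_toZFSet_iff, Cardinal.ord_aleph0]
    exact Ordinal.omega0_pos, trivial⟩
  obtain ⟨z, hz, h3⟩ := h2
  obtain ⟨β, hβ, rfl⟩ := Ordinal.mem_toZFSet_iff.1 hz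
  have h4 : β + 1 < (ℵ₀ : Cardinal.{u}).ord := by
    rw [Cardinal.ord_aleph0] at hβ ⊢
    exact Ordinal.isSuccLimit_omega0.add_one_lt hβ
  rcases h3 _ (Ordinal.toZFSet_mem_toZFSet_iff.2 h4) with h5 | h5
  · rw [Ordinal.toZFSet_mem_toZFSet_iff] at h5
    exact absurd h5 (not_lt.2 (le_of_lt (lt_add_one β)))
  · exact absurd (Ordinal.toZFSet_injective h5) (lt_add_one β).ne'

/-- A cofinal subset `B` of κ with fewer than κ elements is in `M` and fixed by `J`. It would be
cofinal in `J κ`, which has κ as an element. -/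
theorem IsElem.isRegular (h : IsElem M N J) (hκ : ℵ₀ ≤ κ) (hsc : SmallClosed M κ)
    (hc : IsElem.Crit M J κ.ord) : κ ≤ κ.ord.cof := by
  by_contra hlt
  push Not at hlt
  obtain ⟨s, hs, hs'⟩ := Order.exists_cof_eq (α := κ.ord.ToType)
  rw [Ordinal.cof_toType] at hs'
  let o : κ.ord.ToType → Set.Iio κ.ord := Ordinal.ToType.mk.symm
  let B : ZFSet.{u} := ZFSet.range fun a : s => (o a : Ordinal.{u}).toZFSet
  have hBκ : ∀ z ∈ B, ∃ β < κ.ord, β.toZFSet = z := by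
    intro z hz
    obtain ⟨a, rfl⟩ := ZFSet.mem_range.1 hz
    exact ⟨_, (o a).2, rfl⟩
  have hBc : B.card < κ := by
    refine lt_of_le_of_lt ?_ hlt
    rw [← hs']
    simpa using ZFSet.lift_card_range_le (f := fun a : s => (o a : Ordinal.{u}).toZFSet)
  have hBM : B ∈ M := hsc B (fun z hz => by
    obtain ⟨β, hβ, rfl⟩ := hBκ z hz
    exact h.toZFSet_mem hc.1 hβ) hBc
  have hJB : J B = B := h.map_eq_of_small hκ hsc hc hBM hBc fun z hz => by
    obtain ⟨β, hβ, rfl⟩ := hBκ z hz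
    exact hc.2.2 β hβ
  have hfo : IsFO fun _ (v : Fin 2 → ZFSet.{u}) => ∀ y ∈ v 0, ∃ z ∈ v 1, y ∈ z ∨ y = z := by
    repeat' first
      | apply IsFO.ball
      | apply IsFO.bex
      | apply IsFO.or
      | apply IsFO.eq_var
      | apply IsFO.mem_var
  have h1 := (h.transfer hfo ![κ.ord.toZFSet, B]
    (by intro i; fin_cases i; exacts [hc.1, hBM])).1 (by
      intro y hy
      obtain ⟨β, hβ, rfl⟩ := Ordinal.mem_toZFSet_iff.1 hy
      obtain ⟨a, ha, hle⟩ := hs (Ordinal.ToType.mk ⟨β, hβ⟩)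
      refine ⟨(o a : Ordinal.{u}).toZFSet, ZFSet.mem_range.2 ⟨⟨a, ha⟩, rfl⟩, ?_⟩
      have : β ≤ o a := by
        have := Ordinal.ToType.mk.symm.monotone hle
        rw [OrderIso.symm_apply_apply] at this
        exact this
      rcases this.lt_or_eq with h' | h'
      · exact Or.inl (Ordinal.toZFSet_mem_toZFSet_iff.2 h')
      · exact Or.inr (congrArg _ h'))
  obtain ⟨z, hz, hz'⟩ := h1 _ (h.crit_mem hc)
  change z ∈ J B at hz
  rw [hJB] at hz
  obtain ⟨β, hβ, rfl⟩ := hBκ z hz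
  rcases hz' with h5 | h5
  · rw [Ordinal.toZFSet_mem_toZFSet_iff] at h5
    exact absurd h5 hβ.le.not_gt
  · exact hβ.ne' (Ordinal.toZFSet_injective h5)

/-- There is no injection from `κ` to the power set of a smaller cardinal in the domain of an
embedding with critical point `κ`. -/
theorem IsElem.not_injOn (h : IsElem M N J) (hκ : ℵ₀ ≤ κ) (hsc : SmallClosed M κ)
    (hc : IsElem.Crit M J κ.ord) {l : Cardinal.{u}} (hl : l < κ) {e : ZFSet.{u} → ZFSet.{u}}
    (he : graphOn e κ.ord.toZFSet ∈ M) (hsub : ∀ a ∈ κ.ord.toZFSet, e a ⊆ l.ord.toZFSet)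
    (hinj : ∀ a ∈ κ.ord.toZFSet, ∀ b ∈ κ.ord.toZFSet, e a = e b → a = b)
    (hsurj : ∀ A, A ⊆ l.ord.toZFSet → ∃ a ∈ κ.ord.toZFSet, e a = A) : False := by
  have hfo : IsFO fun S (v : Fin 3 → ZFSet.{u}) =>
      (∀ a ∈ v 0, ∃ A ∈ S, A ⊆ v 1 ∧ ZFSet.pair a A ∈ v 2) ∧
      ∀ a ∈ S, ∀ a' ∈ S, ∀ A ∈ S, ZFSet.pair a A ∈ v 2 → ZFSet.pair a' A ∈ v 2 → a = a' := by
    repeat' first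
      | apply IsFO.ball
      | apply IsFO.ex
      | apply IsFO.all
      | apply IsFO.and
      | apply IsFO.imp
      | apply IsFO.eq_var
      | apply IsFO.subset_var
      | apply IsFO.mem
      | exact (IsTerm.var _).pair (IsTerm.var _)
  have hlt : l.ord < κ.ord := Cardinal.ord_lt_ord.2 hl
  have hlM : l.ord.toZFSet ∈ M := h.toZFSet_mem hc.1 hlt
  have hsmall : ∀ A, A ⊆ l.ord.toZFSet → A.card < κ := fun A hA =>
    (ZFSet.card_mono hA).trans_lt (by rwa [Ordinal.card_toZFSet, Cardinal.card_ord])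
  have hAM : ∀ A, A ⊆ l.ord.toZFSet → A ∈ M := fun A hA =>
    hsc A (fun z hz => h.left _ hlM z (hA hz)) (hsmall A hA)
  obtain ⟨h1, h2⟩ := (h.transfer hfo ![κ.ord.toZFSet, l.ord.toZFSet, graphOn e κ.ord.toZFSet]
    (by intro i; fin_cases i; exacts [hc.1, hlM, he])).1 (by
      refine ⟨fun a ha => ⟨e a, hAM _ (hsub a ha), hsub a ha, pair_mem_graphOn.2 ⟨ha, rfl⟩⟩, ?_⟩
      intro a _ a' _ A _ hA hA'
      obtain ⟨h3, h4⟩ := pair_mem_graphOn.1 hA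
      obtain ⟨h5, h6⟩ := pair_mem_graphOn.1 hA'
      exact hinj a h3 a' h5 (h4.symm.trans h6))
  -- The value `A` of `J e` at κ is a subset of `l`, so it is `e a` for some a < κ. But `J e` has
  -- the value `J (e a) = e a` at `a` too, against injectivity.
  have hκJ := h.crit_mem hc
  obtain ⟨A, -, hA, hA'⟩ := h1 _ hκJ
  change A ⊆ J l.ord.toZFSet at hA
  rw [hc.2.2 _ hlt] at hA
  obtain ⟨a, ha, rfl⟩ := hsurj A hA
  have hJe : J (e a) = e a :=
    h.map_eq_of_small hκ hsc hc (hAM _ hA) (hsmall _ hA) fun y hy => by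
      obtain ⟨β, hβ, rfl⟩ := Ordinal.mem_toZFSet_iff.1 (hA hy)
      exact hc.2.2 _ (hβ.trans hlt)
  obtain ⟨β, hβ, rfl⟩ := Ordinal.mem_toZFSet_iff.1 ha
  have hβM := h.toZFSet_mem hc.1 hβ
  have hp := hsc.pair_mem hκ hβM (hAM _ hA)
  have h7 := (h.mem_iff hp he).2 (pair_mem_graphOn.2 ⟨ha, rfl⟩)
  rw [h.map_pair hβM (hAM _ hA) hp, hJe, hc.2.2 _ hβ] at h7
  have hβN := h.maps _ hβM
  rw [hc.2.2 _ hβ] at hβN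
  have hAN := h.maps _ (hAM _ hA)
  rw [hJe] at hAN
  have := h2 _ (h.right _ (h.maps _ hc.1) _ hκJ) _ hβN _ hAN hA' h7
  exact hβ.ne' (Ordinal.toZFSet_injective this)

end Small

end Unfoldable

/-! ### Inaccessibility of κ. -/

namespace Unfoldable
open FirstOrder.Language

theorem exists_bijOn_of_card_eq {x y : ZFSet.{u}} (h : x.card = y.card) :
    ∃ F : ZFSet.{u} → ZFSet.{u}, (∀ a ∈ x, F a ∈ y) ∧ (∀ a ∈ x, ∀ b ∈ x, F a = F b → a = b) ∧
      ∀ b ∈ y, ∃ a ∈ x, F a = b := by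
  classical
  obtain ⟨e⟩ : Nonempty (x ≃ y) := by
    rw [← Cardinal.eq, ZFSet.cardinalMk_coe_sort, ZFSet.cardinalMk_coe_sort, h]
  refine ⟨fun a => if ha : a ∈ x then e ⟨a, ha⟩ else ∅, fun a ha => ?_, fun a ha b hb => ?_,
    fun b hb => ⟨e.symm ⟨b, hb⟩, (e.symm ⟨b, hb⟩).2, ?_⟩⟩
  · simp only [ha, dif_pos]
    exact (e ⟨a, ha⟩).2
  · simp only [ha, hb, dif_pos]
    intro h
    exact congrArg Subtype.val (e.injective (Subtype.ext h))
  · simp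

/-- If some `κ`-model exists and `κ`-models have embeddings with critical point `κ`, then `κ` is
inaccessible. -/
theorem isInaccessible {T : setLang.Theory} (hT : T ⊆ ZFC) (hr : rangeAxiom.{u} ∈ T)
    {κ : Cardinal.{u}} {θ : Ordinal.{u}} (hu : IsThetaStronglyUnfoldable T κ θ) {M : ZFSet.{u}}
    (hM : IsKappaModel T κ M) : κ.IsInaccessible := by
  have hκ := hM.aleph0_le
  have hsc := hM.smallClosed hr
  obtain ⟨N, j, hj⟩ := hu M hM
  have hE := isElem_ev (transClass_coe hM.transitive) (transClass_coe hj.transitive)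
    (toClassEmb j)
  have hc := crit_ev hj.critical
  refine ⟨hE.aleph0_lt hκ hc, hE.isRegular hκ hsc hc, fun l hl => ?_⟩
  by_contra hle
  push Not at hle
  have hlt : l.ord < κ.ord := Cardinal.ord_lt_ord.2 hl
  -- All subsets of `l` are in `M` by closure, so 2^l ≤ |M| = κ; with κ ≤ 2^l there is a bijection
  -- from κ onto the power set of `l`.
  have hpM : l.ord.toZFSet.powerset ⊆ M := by
    intro A hA
    rw [ZFSet.mem_powerset] at hA
    refine hsc A (fun z hz => ?_) ((ZFSet.card_mono hA).trans_lt
      (by rwa [Ordinal.card_toZFSet, Cardinal.card_ord]))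
    exact hM.transitive.mem_trans (hA hz) (hE.toZFSet_mem hc.1 hlt)
  have hle' := ZFSet.card_mono hpM
  obtain ⟨e, he1, he2, he3⟩ := exists_bijOn_of_card_eq
    (x := κ.ord.toZFSet) (y := l.ord.toZFSet.powerset) (by
      rw [ZFSet.card_powerset, Ordinal.card_toZFSet, Ordinal.card_toZFSet, Cardinal.card_ord,
        Cardinal.card_ord]
      rw [ZFSet.card_powerset, Ordinal.card_toZFSet, Cardinal.card_ord, hM.card_eq] at hle'
      exact le_antisymm hle hle')
  have heM : graphOn e κ.ord.toZFSet ⊆ M := by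
    intro p hp
    obtain ⟨a, ha, rfl⟩ := mem_img.1 hp
    exact hsc.pair_mem hκ (hM.transitive.mem_trans ha hM.kappa_mem) (hpM (he1 a ha))
  -- The bijection need not be in `M`, hence the passage to a larger κ-model.
  obtain ⟨M', i, hM', hsc', -, he'⟩ := exists_extension hT hκ hM.transitive hM.card_eq
    hM.kappa_mem hsc (fun _ => graphOn e κ.ord.toZFSet) fun _ _ => heM
  obtain ⟨N', j', hj'⟩ := hu M' hM'
  exact (isElem_ev (transClass_coe hM'.transitive) (transClass_coe hj'.transitive)
    (toClassEmb j')).not_injOn hκ hsc' (crit_ev hj'.critical) hl (he' _ hM.kappa_mem).1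
    (fun a ha => ZFSet.mem_powerset.1 (he1 a ha)) he2
    fun A hA => he3 A (ZFSet.mem_powerset.2 hA)

section Inaccessible

open ZFSet

variable {κ : Cardinal.{u}}

theorem card_lt_of_mem_vonNeumann (hκ : κ.IsInaccessible) {x : ZFSet.{u}}
    (hx : x ∈ V_ κ.ord) : x.card < κ := by
  refine (card_mono (subset_vonNeumann_self x)).trans_lt ?_
  rw [card_vonNeumann]
  conv_rhs => rw [← hκ.preBeth_ord]
  exact Cardinal.preBeth_strictMono (mem_vonNeumann.1 hx)

theorem card_vonNeumann_ord (hκ : κ.IsInaccessible) : (V_ κ.ord).card = κ := by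
  rw [card_vonNeumann, hκ.preBeth_ord]

/-- `V_θ` contains its subsets of size less than the cofinality of `θ`. -/
theorem smallClosed_vonNeumann (θ : Ordinal.{u}) :
    SmallClosed (V_ θ) θ.cof := by
  intro B hB hcard
  rw [mem_vonNeumann]
  have : B.rank ≤ ⨆ x : Shrink.{u} B, ((equivShrink B).symm x : ZFSet.{u}).rank + 1 := by
    rw [rank_le_iff]
    intro y hy
    have := Ordinal.le_iSup (fun x : Shrink.{u} B => ((equivShrink B).symm x : ZFSet.{u}).rank + 1)
      (equivShrink B ⟨y, hy⟩)
    simp only [Equiv.symm_apply_apply] at this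
    exact (lt_add_one _).trans_le this
  refine this.trans_lt (Ordinal.iSup_add_one_lt_of_lt_cof ?_ ?_)
  · exact hcard
  · intro x
    exact mem_vonNeumann.1 (hB ((equivShrink B).symm x).2)

theorem smallClosed_vonNeumann_ord (hκ : κ.IsInaccessible) : SmallClosed (V_ κ.ord) κ := by
  have := smallClosed_vonNeumann κ.ord
  rwa [hκ.isRegular.cof_ord] at this

theorem vonNeumann_ord_subset (hκ : κ.IsInaccessible) {M : ZFSet.{u}} (hsc : SmallClosed M κ) :
    V_ κ.ord ⊆ M := by
  intro x
  induction x using ZFSet.inductionOn with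
  | h x ih =>
    intro hx
    exact hsc x (fun y hy => ih y hy ((isTransitive_vonNeumann _).mem_trans hy hx))
      (card_lt_of_mem_vonNeumann hκ hx)

theorem IsElem.map_vonNeumann {M : ZFSet.{u}} {N : Set ZFSet.{u}} {J : ZFSet.{u} → ZFSet.{u}}
    (h : IsElem M N J) (hκ : κ.IsInaccessible) (hsc : SmallClosed M κ)
    (hc : IsElem.Crit M J κ.ord) (x : ZFSet.{u}) (hx : x ∈ V_ κ.ord) : J x = x := by
  induction x using ZFSet.inductionOn with
  | h x ih =>
    exact h.map_eq_of_small hκ.aleph0_lt.le hsc hc (vonNeumann_ord_subset hκ hsc hx)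
      (card_lt_of_mem_vonNeumann hκ hx)
      fun y hy => ih y hy ((isTransitive_vonNeumann _).mem_trans hy hx)

end Inaccessible

end Unfoldable

/-! ### The hull function on V_κ. -/

namespace Unfoldable
open FirstOrder.Language ZFSet

open Classical in
/-- The base operation: `∅` names the parameter `s`, and `{a}` names `e a`. -/
noncomputable def baseOp (e : ZFSet.{u} → ZFSet.{u}) (s c : ZFSet.{u}) : ZFSet.{u} :=
  if c = ∅ then s else e (ZFSet.sUnion c)

theorem baseOp_empty (e : ZFSet.{u} → ZFSet.{u}) (s : ZFSet.{u}) : baseOp e s ∅ = s := if_pos rfl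

theorem baseOp_singleton (e : ZFSet.{u} → ZFSet.{u}) (s a : ZFSet.{u}) :
    baseOp e s {a} = e a := by
  rw [baseOp, if_neg, sUnion_singleton]
  intro h
  exact notMem_empty a (h ▸ mem_singleton.2 rfl)

/-- The value of the code `c` in the structure `M`, with parameter `s`. -/
noncomputable def hullFun (M : ZFSet.{u}) (e : ZFSet.{u} → ZFSet.{u}) (s : ZFSet.{u}) :
    ZFSet.{u} → ZFSet.{u} :=
  value (skolem M) fmlNum (baseOp e s)

/-- The graph of `hullFun` on `U`. -/
noncomputable def hullGraph (M U : ZFSet.{u}) (e : ZFSet.{u} → ZFSet.{u}) : ZFSet.{u} :=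
  ZFSet.range fun p : U × U => pair (pair p.1 p.2) (hullFun M e p.1 p.2)

theorem pair_mem_hullGraph {M U : ZFSet.{u}} {e : ZFSet.{u} → ZFSet.{u}} {s c y : ZFSet.{u}} :
    pair (pair s c) y ∈ hullGraph M U e ↔ s ∈ U ∧ c ∈ U ∧ y = hullFun M e s c := by
  simp only [hullGraph, ZFSet.mem_range, Prod.exists, pair_inj, Subtype.exists]
  constructor
  · rintro ⟨s', hs, c', hc, ⟨rfl, rfl⟩, rfl⟩
    exact ⟨hs, hc, rfl⟩
  · rintro ⟨hs, hc, rfl⟩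
    exact ⟨s, hs, c, hc, ⟨rfl, rfl⟩, rfl⟩

/-- The graph of `α ↦ V_ α` on the ordinal `κ`. -/
noncomputable def rankGraph (κ : Ordinal.{u}) : ZFSet.{u} := graphOn (fun a => V_ a.rank) κ.toZFSet

theorem pair_mem_rankGraph {κ : Ordinal.{u}} {a w : ZFSet.{u}} :
    pair a w ∈ rankGraph κ ↔ ∃ α < κ, a = α.toZFSet ∧ w = V_ α := by
  rw [rankGraph, pair_mem_graphOn, Ordinal.mem_toZFSet_iff]
  constructor
  · rintro ⟨⟨α, hα, rfl⟩, rfl⟩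
    exact ⟨α, hα, rfl, by rw [Ordinal.rank_toZFSet]⟩
  · rintro ⟨α, hα, rfl, rfl⟩
    exact ⟨⟨α, hα, rfl⟩, by rw [Ordinal.rank_toZFSet]⟩

section

variable {κ : Cardinal.{u}} {M : ZFSet.{u}} {e : ZFSet.{u} → ZFSet.{u}}

/-- Induction on the rank of the code. A set code in V_κ has fewer than κ elements, so the set of
its values is in `M` by closure. -/
theorem hullFun_mem (hκ : κ.IsInaccessible) (hsc : SmallClosed M κ)
    (he : ∀ a ∈ V_ κ.ord, e a ∈ M) {s : ZFSet.{u}} (hs : s ∈ V_ κ.ord) :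
    ∀ c ∈ V_ κ.ord, hullFun M e s c ∈ M := by
  have hUM := vonNeumann_ord_subset hκ hsc
  have hp : ∀ {a b : ZFSet.{u}}, pair a b ∈ V_ κ.ord → b ∈ V_ κ.ord := fun {a b} h => by
    rw [mem_vonNeumann] at h ⊢
    exact (rank_lt_pair_right a b).trans h
  have h0 : ∅ ∈ M := tag_mem hsc hκ.aleph0_lt.le 0
  suffices h : ∀ o : Ordinal.{u}, ∀ c ∈ V_ κ.ord, c.rank = o → hullFun M e s c ∈ M from
    fun c hc => h _ c hc rfl
  intro o
  induction o using WellFoundedLT.induction with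
  | ind o ih =>
    rintro c hc rfl
    rcases value_cases (sk := skolem (M : Set ZFSet.{u})) (num := fmlNum) (b := baseOp e s) c with
      ⟨a, rfl⟩ | ⟨a, rfl⟩ | ⟨φ, cs, rfl⟩ | ⟨a, rfl⟩ | h
    · rw [hullFun, value_self]
      exact hUM (hp hc)
    · rw [hullFun, value_img]
      refine hsc _ (fun z hz => ?_)
        ((card_img_le _ _).trans_lt (card_lt_of_mem_vonNeumann hκ (hp hc)))
      obtain ⟨y, hy, rfl⟩ := mem_img.1 hz
      exact ih _ ((rank_lt_of_mem hy).trans (rank_lt_pair_right _ _)) y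
        ((isTransitive_vonNeumann _).mem_trans hy (hp hc)) rfl
    · rw [hullFun, value_sk fmlNum_injective]
      exact skolem_mem (S := (M : Set ZFSet.{u})) h0 φ _
    · rw [hullFun, value_base, baseOp]
      split_ifs
      · exact hUM hs
      -- A nonempty base code that is not a singleton still names `e` of its union, whose rank is no
      -- larger.
      · refine he _ ?_
        rw [mem_vonNeumann]
        exact (rank_sUnion_le _).trans_lt (mem_vonNeumann.1 (hp hc))
    · rw [hullFun, h]
      exact h0

theorem pair_mem_vonNeumann_ord (hκ : κ.IsInaccessible) {x y : ZFSet.{u}} (hx : x ∈ V_ κ.ord)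
    (hy : y ∈ V_ κ.ord) : pair x y ∈ V_ κ.ord :=
  (smallClosed_vonNeumann_ord hκ).pair_mem hκ.aleph0_lt.le hx hy

theorem hullGraph_subset (hκ : κ.IsInaccessible) (hsc : SmallClosed M κ)
    (he : ∀ a ∈ V_ κ.ord, e a ∈ M) : hullGraph M (V_ κ.ord) e ⊆ M := by
  intro z hz
  obtain ⟨⟨⟨s, hs⟩, ⟨c, hc⟩⟩, rfl⟩ := ZFSet.mem_range.1 hz
  exact hsc.pair_mem hκ.aleph0_lt.le (vonNeumann_ord_subset hκ hsc
    (pair_mem_vonNeumann_ord hκ hs hc)) (hullFun_mem hκ hsc he hs c hc)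

theorem toZFSet_mem_vonNeumann {α β : Ordinal.{u}} (h : α < β) : α.toZFSet ∈ V_ β := by
  rwa [mem_vonNeumann, Ordinal.rank_toZFSet]

theorem rankGraph_subset (hκ : κ.IsInaccessible) (hsc : SmallClosed M κ) :
    rankGraph κ.ord ⊆ M := by
  intro z hz
  rw [rankGraph, graphOn] at hz
  obtain ⟨a, ha, rfl⟩ := mem_img.1 hz
  obtain ⟨α, hα, rfl⟩ := Ordinal.mem_toZFSet_iff.1 ha
  refine hsc.pair_mem hκ.aleph0_lt.le
    (vonNeumann_ord_subset hκ hsc (toZFSet_mem_vonNeumann hα)) ?_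
  rw [Ordinal.rank_toZFSet]
  exact vonNeumann_ord_subset hκ hsc (vonNeumann_mem_of_lt hα)

/-- The hull function satisfies the Skolem property for `φ`. -/
theorem hullFun_skolem {n : ℕ} (φ : setLang.BoundedFormula Empty (n + 1)) (s : ZFSet.{u})
    (cs : Fin n → ZFSet.{u}) (a : ZFSet.{u})
    (h : SatIn M φ default (Fin.snoc (α := fun _ => ZFSet.{u}) (fun i => hullFun M e s (cs i)) a)) :
    SatIn M φ default (Fin.snoc (α := fun _ => ZFSet.{u}) (fun i => hullFun M e s (cs i))
      (hullFun M e s (pair (tag 2) (pair (fmlNum ⟨n, φ⟩) (tup cs))))) := by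
  have hs : hullFun M e s (pair (tag 2) (pair (fmlNum ⟨n, φ⟩) (tup cs))) =
      skolem M ⟨n, φ⟩ fun i => hullFun M e s (cs i) := value_sk fmlNum_injective ⟨n, φ⟩ cs
  rw [hs]
  generalize hullFun M e s = F at *
  obtain ⟨h1, h2, h3⟩ := h
  have hmem : ∀ i, F (cs i) ∈ M := fun i => by simpa using h2 i.castSucc
  have ha : a ∈ M := by simpa using h2 (Fin.last n)
  have key : ∀ b : M, (fun i => (Fin.snoc (α := fun _ => ZFSet.{u}) (fun i => F (cs i)) b i :
      ZFSet.{u})) = fun i => ((Fin.snoc (α := fun _ => M) (fun i => ⟨F (cs i), hmem i⟩) b i : M) :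
      ZFSet.{u}) := by
    intro b
    ext i : 1
    refine Fin.lastCases ?_ (fun i => ?_) i <;> simp
  have hv : (default : Empty → ZFSet.{u}) = fun i => ((default : Empty → M) i : ZFSet.{u}) :=
    Subsingleton.elim _ _
  have h4 : SatIn M φ default (Fin.snoc (α := fun _ => ZFSet.{u}) (fun i => F (cs i)) a) :=
    ⟨h1, h2, h3⟩
  have h5 := key ⟨a, ha⟩
  change Fin.snoc _ _ = _ at h5
  rw [h5, hv, satIn_iff] at h4
  obtain ⟨b, hb, hb'⟩ := skolem_spec (S := (M : Set ZFSet.{u})) φ (fun i => ⟨F (cs i), hmem i⟩)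
    ⟨a, ha⟩ h4
  rw [← hb]
  have h6 := key b
  change Fin.snoc _ _ = _ at h6
  rw [h6, hv]
  exact (satIn_iff φ _ _).2 hb'

end

end Unfoldable

/-! ### Reflection from the universe to the target of an embedding. -/

namespace Unfoldable
open FirstOrder.Language ZFSet

/-- `J` is the action, on a `κ`-model `M` and the objects attached to it, of a `θ`-strong
unfoldability embedding of an elementary submodel of the universe into `N'`. -/
structure CoreData (κ : Cardinal.{u}) (θ : Ordinal.{u}) (M N' : ZFSet.{u})
    (e J : ZFSet.{u} → ZFSet.{u}) : Prop where
  inaccessible : κ.IsInaccessible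
  transM : M.IsTransitive
  closed : SmallClosed M κ
  mem_e : ∀ a ∈ V_ κ.ord, e a ∈ M
  surj_e : ∀ m ∈ M, ∃ a ∈ V_ κ.ord, e a = m
  kappa_mem : κ.ord.toZFSet ∈ M
  transN : N'.IsTransitive
  -- Replacing θ by the maximum with κ costs nothing: V_κ is fixed pointwise and κ < j(κ).
  strong : V_ (max θ κ.ord) ⊆ N'
  target : (max θ κ.ord).toZFSet ⊆ J κ.ord.toZFSet
  ordinal : (J κ.ord.toZFSet).IsOrdinal
  crit : κ.ord.toZFSet ∈ J κ.ord.toZFSet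
  fix : ∀ x ∈ V_ κ.ord, J x = x
  restrict : ∃ k : (M : Set ZFSet.{u}) ↪ₑ[setLang] (J M : Set ZFSet.{u}),
    ∀ x, (k x : ZFSet.{u}) = J x
  reflect : ∀ {α : Type} {P : Set ZFSet.{u} → (α → ZFSet.{u}) → Prop}, IsFO P →
    ∀ v : α → ZFSet.{u}, (∀ i, v i ∈ M ∨ v i = M ∨ v i = V_ κ.ord ∨
      v i = hullGraph M (V_ κ.ord) e ∨ v i = rankGraph κ.ord) →
    P Set.univ v → P N' fun i => J (v i)

theorem exists_coreData {T : setLang.Theory} (hT : T ⊆ ZFC) (hr : rangeAxiom.{u} ∈ T)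
    {κ : Cardinal.{u}} {θ : Ordinal.{u}} (hu : IsThetaStronglyUnfoldable T κ θ) {M : ZFSet.{u}}
    (hM : IsKappaModel T κ M) : ∃ N' e J, CoreData κ θ M N' e J := by
  have hκ := isInaccessible hT hr hu hM
  have hκ0 := hM.aleph0_le
  have hsc := hM.smallClosed hr
  obtain ⟨e, he1, -, he3⟩ := exists_bijOn_of_card_eq (x := V_ κ.ord) (y := M) (by
    rw [card_vonNeumann_ord hκ, hM.card_eq])
  classical
  have hUM := vonNeumann_ord_subset hκ hsc
  let b : ZFSet.{u} → ZFSet.{u} := fun c => if c = tag 0 then M else if c = tag 1 then V_ κ.ord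
    else if c = tag 2 then hullGraph M (V_ κ.ord) e else rankGraph κ.ord
  have hb : ∀ c, b c ⊆ M := by
    intro c
    simp only [b]
    split_ifs
    · exact fun _ h => h
    · exact hUM
    · exact hullGraph_subset hκ hsc he1
    · exact rankGraph_subset hκ hsc
  obtain ⟨M', i, hM', hsc', hMM', hbM'⟩ := exists_extension hT hκ0 hM.transitive hM.card_eq
    hM.kappa_mem hsc b fun c _ => hb c
  have hne : ∀ {m n : ℕ}, m ≠ n → tag.{u} m ≠ tag n := fun h h' => h (tag_injective h')
  have b0 : b (tag 0) = M := if_pos rfl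
  have b1 : b (tag 1) = V_ κ.ord := by simp [b, hne]
  have b2 : b (tag 2) = hullGraph M (V_ κ.ord) e := by simp [b, hne]
  have b3 : b (tag 3) = rankGraph κ.ord := by simp [b, hne]
  have f0 := hbM' _ (tag_mem hsc hκ0 0)
  have f1 := hbM' _ (tag_mem hsc hκ0 1)
  have f2 := hbM' _ (tag_mem hsc hκ0 2)
  have f3 := hbM' _ (tag_mem hsc hκ0 3)
  rw [b0] at f0
  rw [b1] at f1
  rw [b2] at f2
  rw [b3] at f3
  obtain ⟨N', j, hj⟩ := hu M' hM'
  have hE := isElem_ev (transClass_coe hM'.transitive) (transClass_coe hj.transitive)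
    (toClassEmb j)
  have hI := isElem_ev (transClass_coe hM'.transitive) transClass_univ i
  have hc := crit_ev hj.critical
  have hfix := hE.map_vonNeumann hκ hsc' hc
  have hord := hE.isOrdinal hc.1 (isOrdinal_toZFSet κ.ord)
  have hcm := hE.crit_mem hc
  refine ⟨N', e, ev (toClassEmb j), ⟨hκ, hM.transitive, hsc, he1, he3, hM.kappa_mem,
    hj.transitive, ?_, ?_, hord, hcm, hfix, ?_, ?_⟩⟩
  · rcases le_total θ κ.ord with h | h
    · rw [max_eq_right h]
      intro x hx
      rw [← hfix x hx]
      exact hE.maps x (vonNeumann_ord_subset hκ hsc' hx)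
    · rw [max_eq_left h]
      exact hj.strong
  · obtain ⟨δ, hδ, hδ'⟩ := hj.target
    rw [((mapsOrdinal_iff _ _ _).1 hδ').2] at hcm ⊢
    rw [toZFSet_subset_toZFSet_iff]
    exact max_le hδ (toZFSet_mem_toZFSet_iff.1 hcm).le
  · obtain ⟨k, hk⟩ := exists_restrict hM'.transitive hj.transitive j f0.1
    rw [ev_of_mem (toClassEmb j) f0.1]
    refine ⟨toClassEmb k, fun x => ?_⟩
    rw [ev_of_mem (toClassEmb j) (hM'.transitive.mem_trans x.2 f0.1)]
    exact hk x
  · intro α P hP v hv h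
    have hv' : ∀ l, ∃ h : v l ∈ M', (i ⟨v l, h⟩ : ZFSet.{u}) = v l := by
      intro l
      rcases hv l with h | h | h | h | h
      · exact hMM' _ h
      all_goals simp only [h]; assumption
    have hvM : ∀ l, v l ∈ (M' : Set ZFSet.{u}) := fun l => (hv' l).1
    -- Truth goes from the universe down to `M'` along `i`, which fixes the parameters, and then to
    -- `N'` along `j`.
    refine (hE.transfer hP v hvM).1 ((hI.transfer hP v hvM).2 ?_)
    have : (fun l => ev i (v l)) = v := funext fun l => by
      rw [ev_of_mem i (hvM l)]
      exact (hv' l).2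
    rwa [this]

namespace CoreData

variable {κ : Cardinal.{u}} {θ : Ordinal.{u}} {M N' : ZFSet.{u}} {e J : ZFSet.{u} → ZFSet.{u}}

theorem vonNeumann_subset (D : CoreData κ θ M N' e J) : V_ κ.ord ⊆ M :=
  vonNeumann_ord_subset D.inaccessible D.closed

/-- Belonging to the structure is itself a first-order property and reflects like any other. -/
theorem J_mem (D : CoreData κ θ M N' e J) (x : ZFSet.{u}) (hx : x ∈ M ∨ x = M ∨ x = V_ κ.ord ∨
      x = hullGraph M (V_ κ.ord) e ∨ x = rankGraph κ.ord) : J x ∈ N' := by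
  have hfo : IsFO fun S (v : Fin 1 → ZFSet.{u}) => ∃ y ∈ S, v 0 = y := by
    repeat' first
      | apply IsFO.ex
      | apply IsFO.eq_var
  obtain ⟨y, hy, hy'⟩ := D.reflect hfo ![x] (by intro i; fin_cases i; exact hx) ⟨x, trivial, rfl⟩
  exact (show J x = y from hy') ▸ hy

theorem U_of_subset (D : CoreData κ θ M N' e J) : ∀ x ∈ J (V_ κ.ord), ∀ y ∈ N', y ⊆ x →
    y ∈ J (V_ κ.ord) := by
  have hfo : IsFO fun S (v : Fin 1 → ZFSet.{u}) => ∀ x ∈ v 0, ∀ y ∈ S, y ⊆ x → y ∈ v 0 := by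
    repeat' first
      | apply IsFO.ball
      | apply IsFO.all
      | apply IsFO.imp
      | apply IsFO.mem_var
  exact D.reflect hfo ![V_ κ.ord] (by simp) fun x hx y _ hy => mem_vonNeumann_of_subset hy hx

/-- The recursion behind the cumulative hierarchy: `x` is in V_a exactly when `x ⊆ V_b` for some `b
∈ a`. -/
theorem isFO_rank : IsFO fun S (v : Fin 3 → ZFSet.{u}) =>
    (∀ a ∈ v 0, ∃ w ∈ v 1, pair a w ∈ v 2) ∧
    ∀ a ∈ v 0, ∀ w ∈ S, pair a w ∈ v 2 →
      ∀ x ∈ S, x ∈ w ↔ ∃ b ∈ a, ∃ w' ∈ S, pair b w' ∈ v 2 ∧ x ⊆ w' := by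
  repeat' first
    | apply IsFO.ball
    | apply IsFO.bex
    | apply IsFO.all
    | apply IsFO.ex
    | apply IsFO.and
    | apply IsFO.iff
    | apply IsFO.imp
    | apply IsFO.subset_var
    | apply IsFO.mem_var
    | exact IsFO.mem ((IsTerm.var _).pair (IsTerm.var _)) _

theorem rank_reflect (D : CoreData κ θ M N' e J) :
    (∀ a ∈ J κ.ord.toZFSet, ∃ w ∈ J (V_ κ.ord), pair a w ∈ J (rankGraph κ.ord)) ∧
    ∀ a ∈ J κ.ord.toZFSet, ∀ w ∈ N', pair a w ∈ J (rankGraph κ.ord) →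
      ∀ x ∈ N', x ∈ w ↔ ∃ b ∈ a, ∃ w' ∈ N', pair b w' ∈ J (rankGraph κ.ord) ∧ x ⊆ w' := by
  refine D.reflect isFO_rank ![κ.ord.toZFSet, V_ κ.ord, rankGraph κ.ord]
    (by intro i; fin_cases i <;> simp [D.kappa_mem]) ⟨fun a ha => ?_, fun a ha w _ haw x _ => ?_⟩
  · obtain ⟨α, hα, rfl⟩ := Ordinal.mem_toZFSet_iff.1 ha
    exact ⟨V_ α, vonNeumann_mem_of_lt hα, pair_mem_rankGraph.2 ⟨α, hα, rfl, rfl⟩⟩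
  · obtain ⟨α, hα, rfl, rfl⟩ := pair_mem_rankGraph.1 haw
    rw [mem_vonNeumann']
    constructor
    · rintro ⟨β, hβ, hx⟩
      exact ⟨_, toZFSet_mem_toZFSet_iff.2 hβ, _, trivial,
        pair_mem_rankGraph.2 ⟨β, hβ.trans hα, rfl, rfl⟩, hx⟩
    · rintro ⟨b, hb, w', -, hw', hx⟩
      obtain ⟨β, hβ, rfl, rfl⟩ := pair_mem_rankGraph.1 hw'
      exact ⟨β, toZFSet_mem_toZFSet_iff.1 hb, hx⟩

/-- The image of the rank function obeys the same recursion inside `N'`. Up to max θ κ it computes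
the true V_α, since all elements of V_α are in `N'`. -/
theorem vonNeumann_mem_U (D : CoreData κ θ M N' e J) (α : Ordinal.{u})
    (hα : α.toZFSet ∈ J κ.ord.toZFSet) (hle : α ≤ max θ κ.ord) : V_ α ∈ J (V_ κ.ord) := by
  obtain ⟨h1, h2⟩ := D.rank_reflect
  have hUN : ∀ x ∈ J (V_ κ.ord), x ∈ N' := fun x hx => D.transN.mem_trans hx (D.J_mem _ (by simp))
  have hVN : ∀ β ≤ α, V_ β ⊆ N' := fun β hβ x hx =>
    D.strong (vonNeumann_subset_of_le (hβ.trans hle) hx)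
  have hmem : ∀ β ≤ α, β.toZFSet ∈ J κ.ord.toZFSet := fun β hβ =>
    hβ.lt_or_eq.elim (fun h => D.ordinal.mem_trans (toZFSet_mem_toZFSet_iff.2 h) hα) (· ▸ hα)
  have key : ∀ β ≤ α, ∀ w ∈ N', pair β.toZFSet w ∈ J (rankGraph κ.ord) → w = V_ β := by
    intro β
    induction β using WellFoundedLT.induction with
    | ind β ih =>
      intro hβ w hw hp
      ext x
      constructor
      · intro hx
        obtain ⟨b, hb, w', hw', hp', hx'⟩ := (h2 _ (hmem β hβ) w hw hp x
          (D.transN.mem_trans hx hw)).1 hx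
        obtain ⟨γ, hγ, rfl⟩ := Ordinal.mem_toZFSet_iff.1 hb
        rw [ih γ hγ (hγ.le.trans hβ) w' hw' hp'] at hx'
        exact mem_vonNeumann'.2 ⟨γ, hγ, hx'⟩
      · intro hx
        have hxN := hVN β hβ hx
        obtain ⟨γ, hγ, hx'⟩ := mem_vonNeumann'.1 hx
        refine (h2 _ (hmem β hβ) w hw hp x hxN).2 ?_
        obtain ⟨w', hw', hp'⟩ := h1 _ (hmem γ (hγ.le.trans hβ))
        refine ⟨_, toZFSet_mem_toZFSet_iff.2 hγ, w', hUN _ hw', hp', ?_⟩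
        rwa [ih γ hγ (hγ.le.trans hβ) w' (hUN _ hw') hp']
  obtain ⟨w, hw, hp⟩ := h1 _ hα
  rwa [← key α le_rfl w (hUN _ hw) hp]

theorem vonNeumann_subset_U (D : CoreData κ θ M N' e J) : V_ (max θ κ.ord) ⊆ J (V_ κ.ord) := by
  intro x hx
  have hlt := mem_vonNeumann.1 hx
  exact D.U_of_subset _ (D.vonNeumann_mem_U x.rank
    (D.target (toZFSet_mem_toZFSet_iff.2 hlt)) hlt.le) x (D.strong hx) (subset_vonNeumann_self x)

theorem kappa_mem_U (D : CoreData κ θ M N' e J) : κ.ord.toZFSet ∈ J (V_ κ.ord) := by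
  refine D.U_of_subset _ (D.vonNeumann_mem_U κ.ord D.crit (le_max_right _ _)) _ ?_
    (toZFSet_subset_vonNeumann _)
  exact D.transN.mem_trans D.crit (D.J_mem _ (Or.inl D.kappa_mem))

end CoreData

end Unfoldable

/-! ### The image of the hull function under the embedding. -/

namespace Unfoldable
open FirstOrder.Language ZFSet

namespace CoreData

variable {κ : Cardinal.{u}} {θ : Ordinal.{u}} {M N' : ZFSet.{u}} {e J : ZFSet.{u} → ZFSet.{u}}

/-- The code `c` names `y` in the structure `J M`, with parameter `s`. -/
def Names (_ : CoreData κ θ M N' e J) (s c y : ZFSet.{u}) : Prop :=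
  pair (pair s c) y ∈ J (hullGraph M (V_ κ.ord) e)

theorem of_pair_mem (D : CoreData κ θ M N' e J) {x y : ZFSet.{u}} (h : pair x y ∈ N') :
    x ∈ N' ∧ y ∈ N' := by
  have h1 : ({x, y} : ZFSet.{u}) ∈ N' := D.transN.mem_trans (by simp [pair]) h
  exact ⟨D.transN.mem_trans (by simp) h1, D.transN.mem_trans (by simp) h1⟩

theorem graph_mem (D : CoreData κ θ M N' e J) {s c y : ZFSet.{u}} (h : D.Names s c y) :
    (s ∈ N' ∧ c ∈ N') ∧ y ∈ N' := by
  have h0 := D.transN.mem_trans h (D.J_mem _ (by simp))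
  exact ⟨D.of_pair_mem (D.of_pair_mem h0).1, (D.of_pair_mem h0).2⟩

theorem names_fun (D : CoreData κ θ M N' e J) :
    (∀ s ∈ J (V_ κ.ord), ∀ c ∈ J (V_ κ.ord), ∃ y ∈ J M, D.Names s c y) ∧
    ∀ s c y y', D.Names s c y → D.Names s c y' → (y = y' ∧ y ∈ J M) ∧ c ∈ J (V_ κ.ord) := by
  have hfo : IsFO fun S (v : Fin 3 → ZFSet.{u}) =>
      (∀ s ∈ v 1, ∀ c ∈ v 1, ∃ y ∈ v 0, pair (pair s c) y ∈ v 2) ∧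
      ∀ s ∈ S, ∀ c ∈ S, ∀ y ∈ S, ∀ y' ∈ S, pair (pair s c) y ∈ v 2 → pair (pair s c) y' ∈ v 2 →
        (y = y' ∧ y ∈ v 0) ∧ c ∈ v 1 := by
    repeat' first
      | apply IsFO.ball
      | apply IsFO.bex
      | apply IsFO.all
      | apply IsFO.and
      | apply IsFO.imp
      | apply IsFO.eq_var
      | apply IsFO.mem_var
      | exact IsFO.mem (((IsTerm.var _).pair (IsTerm.var _)).pair (IsTerm.var _)) _
  obtain ⟨h1, h2⟩ := D.reflect hfo ![M, V_ κ.ord, hullGraph M (V_ κ.ord) e]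
    (by intro i; fin_cases i <;> simp) (by
      refine ⟨fun s hs c hc => ⟨_, hullFun_mem D.inaccessible D.closed D.mem_e hs c hc,
        pair_mem_hullGraph.2 ⟨hs, hc, rfl⟩⟩, fun s _ c _ y _ y' _ h h' => ?_⟩
      obtain ⟨hs, hc, rfl⟩ := pair_mem_hullGraph.1 h
      obtain ⟨-, -, rfl⟩ := pair_mem_hullGraph.1 h'
      exact ⟨⟨rfl, hullFun_mem D.inaccessible D.closed D.mem_e hs c hc⟩, hc⟩)
  refine ⟨h1, fun s c y y' h h' => ?_⟩
  obtain ⟨⟨hs, hc⟩, hy⟩ := D.graph_mem h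
  exact h2 s hs c hc y hy y' (D.graph_mem h').2 h h'

theorem names_mem (D : CoreData κ θ M N' e J) {s c y : ZFSet.{u}} (h : D.Names s c y) :
    y ∈ J M := (D.names_fun.2 s c y y h h).1.2

theorem names_unique (D : CoreData κ θ M N' e J) {s c y y' : ZFSet.{u}} (h : D.Names s c y)
    (h' : D.Names s c y') : y = y' := (D.names_fun.2 s c y y' h h').1.1

theorem names_base (D : CoreData κ θ M N' e J) (s c y : ZFSet.{u}) :
    (D.Names s (pair (tag 0) c) y → y = c) ∧
    (D.Names s (pair (tag 3) (tag 0)) y → y = s) := by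
  have hfo : IsFO fun S (v : Fin 1 → ZFSet.{u}) => ∀ s ∈ S, ∀ c ∈ S, ∀ y ∈ S,
      (pair (pair s (pair (tag 0) c)) y ∈ v 0 → y = c) ∧
      (pair (pair s (pair (tag 3) (tag 0))) y ∈ v 0 → y = s) := by
    apply IsFO.all
    apply IsFO.all
    apply IsFO.all
    refine IsFO.and (IsFO.imp (IsFO.mem ?_ _) (IsFO.eq_var _ _))
      (IsFO.imp (IsFO.mem ?_ _) (IsFO.eq_var _ _))
    · exact ((IsTerm.var _).pair ((IsTerm.tag 0).pair (IsTerm.var _))).pair (IsTerm.var _)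
    · exact ((IsTerm.var _).pair ((IsTerm.tag 3).pair (IsTerm.tag 0))).pair (IsTerm.var _)
  have := D.reflect hfo ![hullGraph M (V_ κ.ord) e] (by simp) fun s _ c _ y _ => by
    constructor
    · intro h
      obtain ⟨-, -, rfl⟩ := pair_mem_hullGraph.1 h
      exact value_self c
    · intro h
      obtain ⟨-, -, rfl⟩ := pair_mem_hullGraph.1 h
      exact (value_base _).trans (baseOp_empty e s)
  refine ⟨fun h => ?_, fun h => ?_⟩
  · obtain ⟨⟨hs, hc⟩, hy⟩ := D.graph_mem h
    exact (this s hs c (D.of_pair_mem hc).2 y hy).1 h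
  · obtain ⟨⟨hs, -⟩, hy⟩ := D.graph_mem h
    exact (this s hs s hs y hy).2 h

theorem names_img (D : CoreData κ θ M N' e J) {s a b : ZFSet.{u}} (ha : a ∈ J (V_ κ.ord))
    (h : D.Names s (pair (tag 1) a) b) (z : ZFSet.{u}) :
    z ∈ b ↔ ∃ y ∈ a, D.Names s y z := by
  have hfo : IsFO fun S (v : Fin 2 → ZFSet.{u}) => ∀ s ∈ S, ∀ a ∈ v 0, ∀ b ∈ S,
      pair (pair s (pair (tag 1) a)) b ∈ v 1 →
        ∀ z ∈ S, z ∈ b ↔ ∃ y ∈ a, pair (pair s y) z ∈ v 1 := by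
    apply IsFO.all
    apply IsFO.ball
    apply IsFO.all
    refine IsFO.imp (IsFO.mem (((IsTerm.var _).pair ((IsTerm.tag 1).pair (IsTerm.var _))).pair
      (IsTerm.var _)) _) ?_
    apply IsFO.all
    refine IsFO.iff (IsFO.mem_var _ _) ?_
    apply IsFO.bex
    exact IsFO.mem (((IsTerm.var _).pair (IsTerm.var _)).pair (IsTerm.var _)) _
  have := D.reflect hfo ![V_ κ.ord, hullGraph M (V_ κ.ord) e]
    (by intro i; fin_cases i <;> simp) fun s _ a ha b _ h z _ => by
      obtain ⟨hs, -, rfl⟩ := pair_mem_hullGraph.1 h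
      change z ∈ value _ _ _ _ ↔ _
      rw [value_img, mem_img]
      refine exists_congr fun y => and_congr_right fun hy => ?_
      change _ ↔ pair (pair s y) z ∈ hullGraph M (V_ κ.ord) e
      rw [pair_mem_hullGraph]
      exact ⟨fun h => ⟨hs, (isTransitive_vonNeumann _).mem_trans hy ha, h.symm⟩,
        fun h => h.2.2.symm⟩
  obtain ⟨⟨hs, -⟩, hb⟩ := D.graph_mem h
  have h1 := this s hs a ha b hb h
  constructor
  · intro hz
    exact (h1 z (D.transN.mem_trans hz hb)).1 hz
  · rintro ⟨y, hy, hyz⟩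
    exact (h1 z (D.graph_mem hyz).2).2 ⟨y, hy, hyz⟩

/-- A code of `m` of the form `pair (tag 3) {a}` lies in V_κ and is fixed by `J`. Its value does not
depend on the parameter. -/
theorem names_J (D : CoreData κ θ M N' e J) {m : ZFSet.{u}} (hm : m ∈ M) :
    ∃ c ∈ V_ κ.ord, ∀ s ∈ J (V_ κ.ord), D.Names s c (J m) := by
  obtain ⟨a, ha, rfl⟩ := D.surj_e m hm
  have hω := D.inaccessible.aleph0_lt.le
  have hV := smallClosed_vonNeumann_ord D.inaccessible
  have hc : pair (tag 3) {a} ∈ V_ κ.ord := by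
    refine pair_mem_vonNeumann_ord D.inaccessible (tag_mem hV hω 3) ?_
    have := hV.pair_set_mem hω ha ha
    rwa [pair_eq_singleton] at this
  refine ⟨_, hc, fun s hs => ?_⟩
  have hfo : IsFO fun S (v : Fin 4 → ZFSet.{u}) => ∀ s ∈ v 1, pair (pair s (v 0)) (v 2) ∈ v 3 := by
    repeat' first
      | apply IsFO.ball
      | exact IsFO.mem (((IsTerm.var _).pair (IsTerm.var _)).pair (IsTerm.var _)) _
  have h1 := D.reflect hfo ![pair (tag 3) {a}, V_ κ.ord, e a, hullGraph M (V_ κ.ord) e]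
    (by intro i; fin_cases i <;> simp [D.vonNeumann_subset hc, D.mem_e a ha]) (fun s hs =>
      pair_mem_hullGraph.2 ⟨hs, hc, ((value_base _).trans (baseOp_singleton e s a)).symm⟩)
  have h2 := h1 s hs
  simp only [Matrix.cons_val_zero] at h2
  rw [D.fix _ hc] at h2
  exact h2

theorem comp_snoc {A B : Type*} {n : ℕ} (v : A → B) (x : Fin n → A) (a : A) :
    (fun i => v (Fin.snoc (α := fun _ => A) x a i)) =
      Fin.snoc (α := fun _ => B) (fun i => v (x i)) (v a) := by
  ext i : 1
  refine Fin.lastCases ?_ (fun i => ?_) i <;> simp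

/-- `hullFun_skolem`, reflected for one formula at a time; only the number of `φ`, which `J` fixes,
enters as a parameter. -/
theorem names_skolem (D : CoreData κ θ M N' e J) {n : ℕ}
    (φ : setLang.BoundedFormula Empty (n + 1)) {s a y : ZFSet.{u}} (cs ms : Fin n → ZFSet.{u})
    (hms : ∀ i, D.Names s (cs i) (ms i))
    (hy : D.Names s (pair (tag 2) (pair (fmlNum ⟨n, φ⟩) (tup cs))) y)
    (h : SatIn (J M) φ default (Fin.snoc (α := fun _ => ZFSet.{u}) ms a)) :
    SatIn (J M) φ default (Fin.snoc (α := fun _ => ZFSet.{u}) ms y) := by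
  have hsat : ∀ {α : Type} (m : α) (x : Fin n → α) (b : α), IsFO fun _ (v : α → ZFSet.{u}) =>
      SatIn (v m) φ default (Fin.snoc (α := fun _ => ZFSet.{u}) (fun i => v (x i)) (v b)) :=
    fun m x b => (IsFO.satIn φ m default (Fin.snoc x b)).congr fun S _ v _ => by
      rw [comp_snoc, Subsingleton.elim (fun i => v _) default]
  have hfo : IsFO fun S (v : Fin 3 → ZFSet.{u}) => ∀ s ∈ S, ∀ a ∈ S, ∀ y ∈ S,
      ∀ cs : Fin n → ZFSet.{u}, (∀ i, cs i ∈ S) → ∀ ms : Fin n → ZFSet.{u}, (∀ i, ms i ∈ S) →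
      (∀ i, pair (pair s (cs i)) (ms i) ∈ v 2) →
      pair (pair s (pair (tag 2) (pair (v 0) (tup cs)))) y ∈ v 2 →
      SatIn (v 1) φ default (Fin.snoc (α := fun _ => ZFSet.{u}) ms a) →
      SatIn (v 1) φ default (Fin.snoc (α := fun _ => ZFSet.{u}) ms y) := by
    apply IsFO.all
    apply IsFO.all
    apply IsFO.all
    apply IsFO.all_fin
    apply IsFO.all_fin
    refine IsFO.imp (IsFO.forall_fin fun i => ?_) (IsFO.imp ?_ (IsFO.imp ?_ ?_))
    · exact IsFO.mem (((IsTerm.var _).pair (IsTerm.var _)).pair (IsTerm.var _)) _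
    · exact IsFO.mem (((IsTerm.var _).pair ((IsTerm.tag _).pair ((IsTerm.var _).pair
        (IsTerm.tup fun i => Sum.inl (Sum.inr i))))).pair (IsTerm.var _)) _
    · exact hsat _ _ _
    · exact hsat _ _ _
  have hω := D.inaccessible.aleph0_lt.le
  have hV := smallClosed_vonNeumann_ord D.inaccessible
  have hk := fmlNum_mem hV hω ⟨n, φ⟩
  have h1 := D.reflect hfo ![fmlNum ⟨n, φ⟩, M, hullGraph M (V_ κ.ord) e]
    (by intro i; fin_cases i <;> simp [D.vonNeumann_subset hk])
    (fun s _ a _ y _ cs _ ms _ hms hy h => by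
      obtain rfl : ms = fun i => hullFun M e s (cs i) :=
        funext fun i => (pair_mem_hullGraph.1 (hms i)).2.2
      obtain ⟨-, -, rfl⟩ := pair_mem_hullGraph.1 hy
      exact hullFun_skolem φ s cs a h)
  obtain ⟨⟨hs, -⟩, hyN⟩ := D.graph_mem hy
  have ha : a ∈ N' := D.transN.mem_trans (by simpa using h.2.1 (Fin.last n)) (D.J_mem M (by simp))
  have h2 := h1 s hs a ha y hyN cs (fun i => (D.graph_mem (hms i)).1.2) ms
    (fun i => (D.graph_mem (hms i)).2) hms
  simp only [Matrix.cons_val_zero] at h2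
  rw [D.fix _ hk] at h2
  exact h2 hy h

end CoreData

end Unfoldable

/-! ### The embedding into a collapsed hull. -/

namespace Unfoldable
open FirstOrder.Language ZFSet

namespace CoreData

variable {κ : Cardinal.{u}} {θ : Ordinal.{u}} {M N' : ZFSet.{u}} {e J : ZFSet.{u} → ZFSet.{u}}

/-- The collapse of the set of values of codes in `C` is the target of an embedding of `M`. -/
theorem exists_embedding (D : CoreData κ θ M N' e J) {C : ZFSet.{u}} (hCU : C ⊆ J (V_ κ.ord))
    (hVC : V_ (max θ κ.ord) ⊆ C) (hp : ∀ x ∈ C, ∀ y ∈ C, pair x y ∈ C) :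
    ∃ (N : ZFSet.{u}) (j : M ↪ₑ[setLang] N), N.IsTransitive ∧ IsCriticalPoint j κ.ord ∧
      (∃ δ, max θ κ.ord ≤ δ ∧ κ.ord < δ ∧ MapsOrdinal j κ.ord δ) ∧ V_ (max θ κ.ord) ⊆ N ∧
      N.card ≤ C.card ∧ ∀ μ, SmallClosed C μ → SmallClosed N μ := by
  set K := κ.ord.toZFSet with hK
  have hKU : K ∈ J (V_ κ.ord) := D.kappa_mem_U
  have hω := D.inaccessible.aleph0_lt.le
  have hV := smallClosed_vonNeumann_ord D.inaccessible
  have hVκC : ∀ x ∈ V_ κ.ord, x ∈ C := fun x hx =>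
    hVC (vonNeumann_subset_of_le (le_max_right _ _) hx)
  have htag : ∀ n, tag n ∈ C := fun n => hVκC _ (tag_mem hV hω n)
  -- The parameter is κ itself, so κ gets a code in `C` even when V_max(θ,κ) is only V_κ.
  let X : Set ZFSet.{u} := {y | ∃ c ∈ C, D.Names K c y}
  have hXM : X ⊆ J M := fun y ⟨c, _, h⟩ => D.names_mem h
  have hMt : TransClass (J M : Set ZFSet.{u}) := by
    have hfo : IsFO fun _ (v : Fin 1 → ZFSet.{u}) => ∀ x ∈ v 0, ∀ y ∈ x, y ∈ v 0 :=
      IsFO.ball (IsFO.ball (IsFO.mem_var _ _))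
    exact D.reflect hfo ![M] (by simp) fun x hx y hy => D.transM.mem_trans hy hx
  have htv : TarskiVaught (J M : Set ZFSet.{u}) X := by
    intro n φ x a hx ha
    choose c hc hc' using hx
    have hcode : pair (tag 2) (pair (fmlNum ⟨n, φ⟩) (tup c)) ∈ C :=
      hp _ (htag 2) _ (hp _ (hVκC _ (fmlNum_mem hV hω ⟨n, φ⟩)) _ (tup_mem (htag 0) hp c hc))
    obtain ⟨y, hyM, hy⟩ := D.names_fun.1 K hKU _ (hCU hcode)
    have key : ∀ b : (J M : Set ZFSet.{u}), SatIn (J M) φ default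
        (Fin.snoc (α := fun _ => ZFSet.{u}) (fun i => (x i : ZFSet.{u})) b) ↔
        φ.Realize default (Fin.snoc x b : Fin (n + 1) → (J M : Set ZFSet.{u})) := fun b => by
      refine Iff.trans (iff_of_eq ?_) (satIn_iff φ (default : Empty → J M)
        (Fin.snoc x b : Fin (n + 1) → J M))
      congr 1
      · exact Subsingleton.elim _ _
      · exact (comp_snoc (fun z : (J M : Set ZFSet.{u}) => (z : ZFSet.{u})) x b).symm
    exact ⟨⟨y, hyM⟩, ⟨_, hcode, hy⟩,
      (key ⟨y, hyM⟩).1 (D.names_skolem φ c _ hc' hy ((key a).2 ha))⟩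
  have : Small.{u} (J M : Set ZFSet.{u}) := inferInstanceAs (Small.{u} (J M))
  have : Small.{u} X := small_subset hXM
  obtain ⟨N, g, hN, hg⟩ := exists_collapse htv hMt hXM
  -- This transitive class lies in `X`, so the collapse does not move it. Including κ is what later
  -- shows κ < j(κ).
  have hfix : ∀ x ∈ (V_ (max θ κ.ord) ∪ {K} : Set ZFSet.{u}),
      ∃ h : x ∈ N, (g ⟨x, h⟩ : ZFSet.{u}) = x := by
    refine collapse_fixes hN hg ?_ ?_
    · rintro x (hx | rfl) y hy
      · exact Or.inl ((isTransitive_vonNeumann _).mem_trans hy hx)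
      · obtain ⟨α, hα, rfl⟩ := Ordinal.mem_toZFSet_iff.1 hy
        exact Or.inl (toZFSet_mem_vonNeumann (hα.trans_le (le_max_right _ _)))
    · rintro x (hx | rfl)
      · have hc := hp _ (htag 0) _ (hVC hx)
        obtain ⟨y, -, hy⟩ := D.names_fun.1 K hKU _ (hCU hc)
        obtain rfl := (D.names_base _ _ _).1 hy
        exact ⟨_, hc, hy⟩
      · have hc := hp _ (htag 3) _ (htag 0)
        obtain ⟨y, -, hy⟩ := D.names_fun.1 K hKU _ (hCU hc)
        have := (D.names_base _ ∅ _).2 hy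
        exact ⟨_, hc, this ▸ hy⟩
  obtain ⟨k, hk⟩ := D.restrict
  have hkX : ∀ x : (M : Set ZFSet.{u}), ∃ n, g n = k x := fun x => by
    obtain ⟨c, hc, hc'⟩ := D.names_J x.2
    obtain ⟨n, hn⟩ := (hg (J x)).1 ⟨c, hVκC c hc, hc' K hKU⟩
    exact ⟨n, Subtype.ext (hn.trans (hk x).symm)⟩
  choose j0 hj0 using hkX
  -- `j` is `k` followed by the collapse; it is elementary because `k` and the inverse collapse `g`
  -- are.
  let j : (M : Set ZFSet.{u}) ↪ₑ[setLang] (N : Set ZFSet.{u}) := ⟨j0, fun n φ x => by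
    rw [← g.map_formula, ← k.map_formula]
    exact iff_of_eq (congrArg _ (funext fun i => hj0 (x i)))⟩
  have hj : ∀ x, (g (j x) : ZFSet.{u}) = J x := fun x => (congrArg _ (hj0 x)).trans (hk x)
  have hE := isElem_ev (transClass_coe D.transM) (transClass_coe hN) j
  obtain ⟨o, ho⟩ : ∃ o : Ordinal.{u}, (j ⟨K, D.kappa_mem⟩ : ZFSet.{u}) = o.toZFSet := by
    have := hE.isOrdinal D.kappa_mem (isOrdinal_toZFSet κ.ord)
    rw [ev_of_mem j D.kappa_mem] at this
    exact ⟨_, this.toZFSet_rank_eq.symm⟩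
  have hlt : ∀ α : Ordinal.{u}, α.toZFSet ∈ (V_ (max θ κ.ord) ∪ {K} : Set ZFSet.{u}) →
      α.toZFSet ∈ J K → α < o := fun α hα hαJ => by
    obtain ⟨h1, h2⟩ := hfix _ hα
    rw [← toZFSet_mem_toZFSet_iff, ← ho]
    refine (emb_mem_iff g ⟨_, h1⟩ _).1 ?_
    rwa [h2, hj]
  have hκo : κ.ord < o := hlt _ (Or.inr rfl) D.crit
  refine ⟨N, j, hN, ⟨D.kappa_mem, ?_, fun α hα => ?_⟩, ⟨o, ?_, hκo, D.kappa_mem, ho⟩,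
    fun x hx => (hfix x (Or.inl hx)).1, ?_, fun μ hμ => ?_⟩
  · rintro ⟨h, h'⟩
    have := toZFSet_injective (ho.symm.trans h')
    exact hκo.ne' this
  · have hαV : α.toZFSet ∈ V_ κ.ord := toZFSet_mem_vonNeumann hα
    obtain ⟨h1, h2⟩ := hfix _ (Or.inl (vonNeumann_subset_of_le (le_max_right _ _) hαV))
    refine ⟨D.vonNeumann_subset hαV, ?_⟩
    have : j ⟨_, D.vonNeumann_subset hαV⟩ = ⟨_, h1⟩ :=
      g.injective (Subtype.ext (((hj _).trans (D.fix _ hαV)).trans h2.symm))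
    exact congrArg Subtype.val this
  · refine le_of_forall_lt fun α hα => hlt α (Or.inl (toZFSet_mem_vonNeumann hα)) ?_
    exact D.target (toZFSet_mem_toZFSet_iff.2 hα)
  · classical
    refine card_le_of_surjOn (fun c => if h : ∃ n : (N : Set ZFSet.{u}), D.Names K c (g n)
      then h.choose else ∅) fun n hn => ?_
    obtain ⟨c, hc, hc'⟩ := (hg _).2 ⟨⟨n, hn⟩, rfl⟩
    have hex : ∃ n : (N : Set ZFSet.{u}), D.Names K c (g n) := ⟨_, hc'⟩
    refine ⟨c, hc, ?_⟩
    rw [dif_pos hex]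
    exact congrArg Subtype.val (g.injective (Subtype.ext (D.names_unique hex.choose_spec hc')))
  · intro B hB hBc
    have h1 : ∀ n : (N : Set ZFSet.{u}), ∃ c ∈ C, D.Names K c (g n) := fun n =>
      (hg _).2 ⟨n, rfl⟩
    choose c hcC hc using h1
    classical
    -- Codes for the elements of `B` form a small subset of `C`, hence an element of `C`, and the
    -- set code built from it names the image of `B`.
    let a : ZFSet.{u} := img (fun n => if h : n ∈ N then c ⟨n, h⟩ else ∅) B
    have haC : a ∈ C := by
      refine hμ a (fun z hz => ?_) ((card_img_le _ _).trans_lt hBc)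
      obtain ⟨n, hn, rfl⟩ := mem_img.1 hz
      rw [dif_pos (hB hn)]
      exact hcC _
    have hcode := hp _ (htag 1) _ haC
    obtain ⟨A, -, hA⟩ := D.names_fun.1 K hKU _ (hCU hcode)
    refine mem_of_image_mem hN hg (A := A) hB ⟨_, hcode, hA⟩ fun n => ?_
    rw [D.names_img (hCU haC) hA]
    constructor
    · rintro ⟨d, hd, hd'⟩
      obtain ⟨m, hm, rfl⟩ := mem_img.1 hd
      rw [dif_pos (hB hm)] at hd'
      have := g.injective (Subtype.ext (D.names_unique hd' (hc _)))
      rwa [this]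
    · intro hn
      refine ⟨_, mem_img.2 ⟨n, hn, rfl⟩, ?_⟩
      rw [dif_pos (hB hn)]
      exact hc _

end CoreData

end Unfoldable

/-! ### Sets of hereditarily bounded size, and collapses inside V_κ. -/

namespace Unfoldable
open FirstOrder.Language ZFSet

theorem card_prod_le (x y : ZFSet.{u}) : (x.prod y).card ≤ x.card * y.card := by
  rw [← Cardinal.lift_le.{u + 1}, Cardinal.lift_mul, ← cardinalMk_coe_sort,
    ← cardinalMk_coe_sort, ← cardinalMk_coe_sort, Cardinal.mul_def]
  refine Cardinal.mk_le_of_surjective (f := fun p : x × y =>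
    (⟨pair p.1 p.2, pair_mem_prod.2 ⟨p.1.2, p.2.2⟩⟩ : x.prod y)) ?_
  rintro ⟨z, hz⟩
  obtain ⟨a, ha, b, hb, rfl⟩ := mem_prod.1 hz
  exact ⟨⟨⟨a, ha⟩, ⟨b, hb⟩⟩, rfl⟩

theorem card_prod_self_le {x : ZFSet.{u}} (h : ℵ₀ ≤ x.card) : (x.prod x).card ≤ x.card :=
  (card_prod_le x x).trans_eq (Cardinal.mul_eq_self h)

/-- `x` belongs to a transitive set of size at most `μ`. -/
def IsHereditarily (μ : Cardinal.{u}) (x : ZFSet.{u}) : Prop :=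
  ∃ t : ZFSet.{u}, t.IsTransitive ∧ x ∈ t ∧ t.card ≤ μ

theorem isHereditarily_of_subset {μ : Cardinal.{u}} (hμ : ℵ₀ ≤ μ) {B : ZFSet.{u}}
    (hB : ∀ b ∈ B, IsHereditarily μ b) (hcard : B.card ≤ μ) : IsHereditarily μ B := by
  have h : ∀ b : B, IsHereditarily μ b := fun b => hB b b.2
  choose t ht hbt htc using h
  refine ⟨insert B (iUnion t), ?_, mem_insert _ _, ?_⟩
  · intro x hx y hy
    rw [mem_insert_iff] at hx
    refine mem_insert_of_mem _ ?_
    rcases hx with rfl | hx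
    · exact mem_iUnion.2 ⟨⟨y, hy⟩, hbt _⟩
    · obtain ⟨b, hb⟩ := mem_iUnion.1 hx
      exact mem_iUnion.2 ⟨b, (ht b).mem_trans hy hb⟩
  · refine card_insert_le.trans ?_
    have h1 : (iUnion t).card ≤ μ := by
      rw [← Cardinal.lift_le.{u + 1}]
      refine lift_card_iUnion_le_sum_card.{u + 1, u}.trans
        ((Cardinal.sum_le_sum _ (fun _ => μ) htc).trans ?_)
      have h2 : Cardinal.lift.{u + 1} B.card ≤ Cardinal.lift.{u + 1} μ := Cardinal.lift_le.2 hcard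
      rw [Cardinal.sum_const, cardinalMk_coe_sort, Cardinal.lift_id'.{u, u + 1}]
      refine (mul_le_mul_left h2 _).trans_eq ?_
      rw [← Cardinal.lift_mul, Cardinal.mul_eq_self hμ]
    exact (add_le_add_left h1 1).trans_eq (Cardinal.add_one_eq hμ)

/-- There are at most `2 ^ Z.card` sets that are hereditarily of size at most `Z.card`. -/
theorem card_le_of_isHereditarily {Z C : ZFSet.{u}} (hZ : ℵ₀ ≤ Z.card)
    (hC : ∀ x ∈ C, IsHereditarily Z.card x) : C.card ≤ 2 ^ Z.card := by
  obtain ⟨P, hP, hPi⟩ := exists_injOn_of_card_le (card_prod_self_le hZ)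
  have h : ∀ x : C, IsHereditarily Z.card x := fun x => hC x x.2
  choose t ht hxt htc using h
  choose i hi hii using fun x => exists_injOn_of_card_le (htc x)
  -- Membership on `t x`, carried to `Z` by `i x` and coded as a subset of `Z`. Together with the
  -- point `i x x` it determines `x`, which leaves at most 2^|Z| · |Z| possibilities.
  let a : C → ZFSet.{u} := fun x => Z.sep fun w => ∃ v ∈ t x, ∃ u ∈ v, P (pair (i x u) (i x v)) = w
  have sub : ∀ x y, a x = a y → ∀ v ∈ t x, ∀ v' ∈ t y, i x v = i y v' →
      ∀ u ∈ v, ∃ u' ∈ v', i x u = i y u' := by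
    intro x y hxy v hv v' hv' he u hu
    have hut := (ht x).mem_trans hu hv
    have hw : P (pair (i x u) (i x v)) ∈ a x := mem_sep.2
      ⟨hP _ (pair_mem_prod.2 ⟨hi x u hut, hi x v hv⟩), v, hv, u, hu, rfl⟩
    rw [hxy] at hw
    obtain ⟨-, v₁, hv₁, u₁, hu₁, h1⟩ := mem_sep.1 hw
    have hut₁ := (ht y).mem_trans hu₁ hv₁
    have h2 := hPi _ (pair_mem_prod.2 ⟨hi y u₁ hut₁, hi y v₁ hv₁⟩) _
      (pair_mem_prod.2 ⟨hi x u hut, hi x v hv⟩) h1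
    rw [pair_inj] at h2
    obtain rfl := hii y v₁ hv₁ v' hv' (h2.2.trans he)
    exact ⟨u₁, hu₁, h2.1.symm⟩
  have key : ∀ x y, a x = a y → ∀ v ∈ t x, ∀ v' ∈ t y, i x v = i y v' → v = v' := by
    intro x y hxy v
    induction v using ZFSet.inductionOn with
    | h v ih =>
      intro hv v' hv' he
      ext u
      constructor
      · intro hu
        obtain ⟨u', hu', h1⟩ := sub x y hxy v hv v' hv' he u hu
        rwa [ih u hu ((ht x).mem_trans hu hv) u' ((ht y).mem_trans hu' hv') h1]
      · intro hu
        obtain ⟨u', hu', h1⟩ := sub y x hxy.symm v' hv' v hv he.symm u hu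
        rwa [← ih u' hu' ((ht x).mem_trans hu' hv) u ((ht y).mem_trans hu hv') h1.symm]
  have hle : C.card ≤ (Z.powerset.prod Z).card := by
    rw [← Cardinal.lift_le.{u + 1}, ← cardinalMk_coe_sort, ← cardinalMk_coe_sort]
    refine Cardinal.mk_le_of_injective (f := fun x : C => (⟨pair (a x) (i x x), pair_mem_prod.2
      ⟨mem_powerset.2 (sep_subset), hi x x (hxt x)⟩⟩ : Z.powerset.prod Z)) ?_
    intro x y hxy
    have h1 := pair_inj.1 (congrArg Subtype.val hxy)
    exact Subtype.ext (key x y h1.1 x (hxt x) y (hxt y) h1.2)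
  refine hle.trans ((card_prod_le _ _).trans_eq ?_)
  rw [card_powerset]
  exact Cardinal.mul_eq_left (hZ.trans (Cardinal.cantor _).le) (Cardinal.cantor _).le
    (Cardinal.aleph0_pos.trans_le hZ).ne'

/-- The collapse of a well-founded relation on an element of `V_κ` is an element of `V_κ`. -/
theorem exists_collapse_graph {κ : Cardinal.{u}} (hκ : κ.IsInaccessible) {Z : ZFSet.{u}}
    (hZ : Z ∈ V_ κ.ord) {R : ZFSet.{u} → ZFSet.{u} → Prop}
    (hR : ∀ s ⊆ Z, s.Nonempty → ∃ y ∈ s, ∀ z ∈ s, ¬ R z y) :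
    ∃ g ∈ V_ κ.ord, (∀ y ∈ Z, ∃ b ∈ V_ κ.ord, pair y b ∈ g) ∧ ∀ y ∈ Z, ∀ b, pair y b ∈ g →
      ∀ c, c ∈ b ↔ ∃ z ∈ Z, R z y ∧ pair z c ∈ g := by
  have hwf : WellFounded fun z y => z ∈ Z ∧ y ∈ Z ∧ R z y := by
    rw [WellFounded.wellFounded_iff_has_min]
    rintro s ⟨x, hx⟩
    by_cases h : (Z.sep fun y => y ∈ s).Nonempty
    · obtain ⟨y, hy, hy'⟩ := hR (Z.sep fun y => y ∈ s) sep_subset h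
      exact ⟨y, (mem_sep.1 hy).2, fun z hz hzy => hy' z (mem_sep.2 ⟨hzy.1, hz⟩) hzy.2.2⟩
    · refine ⟨x, hx, fun z hz hzy => h ⟨z, mem_sep.2 ⟨hzy.1, hz⟩⟩⟩
  have hsc := smallClosed_vonNeumann_ord hκ
  have hZc := card_lt_of_mem_vonNeumann hκ hZ
  obtain ⟨G, hG⟩ : ∃ G : ZFSet.{u} → ZFSet.{u}, ∀ y ∈ Z, G y = img G (Z.sep fun z => R z y) := by
    classical
    let G : ZFSet.{u} → ZFSet.{u} := hwf.fix fun y ih =>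
      img (fun z => if h : z ∈ Z ∧ y ∈ Z ∧ R z y then ih z h else ∅) (Z.sep fun z => R z y)
    refine ⟨G, fun y hy => ?_⟩
    have h1 : G y = _ := hwf.fix_eq _ y
    rw [h1]
    ext c
    rw [mem_img, mem_img]
    refine exists_congr fun z => and_congr_right fun hz => ?_
    rw [mem_sep] at hz
    rw [dif_pos ⟨hz.1, hy, hz.2⟩]
  have hGV : ∀ y ∈ Z, G y ∈ V_ κ.ord := by
    intro y
    induction y using hwf.induction with
    | h y ih =>
      intro hy
      rw [hG y hy]
      refine hsc _ (fun c hc => ?_) ((card_img_le _ _).trans_lt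
        ((card_mono sep_subset).trans_lt hZc))
      obtain ⟨z, hz, rfl⟩ := mem_img.1 hc
      rw [mem_sep] at hz
      exact ih z ⟨hz.1, hy, hz.2⟩ hz.1
  refine ⟨graphOn G Z, ?_, fun y hy => ⟨G y, hGV y hy, pair_mem_graphOn.2 ⟨hy, rfl⟩⟩,
    fun y hy b hb c => ?_⟩
  · refine hsc _ (fun p hp => ?_) ((card_img_le _ _).trans_lt hZc)
    obtain ⟨y, hy, rfl⟩ := mem_img.1 hp
    exact pair_mem_vonNeumann_ord hκ ((isTransitive_vonNeumann _).mem_trans hy hZ) (hGV y hy)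
  · obtain ⟨-, rfl⟩ := pair_mem_graphOn.1 hb
    rw [hG y hy, mem_img]
    refine exists_congr fun z => ?_
    rw [mem_sep, pair_mem_graphOn]
    constructor
    · rintro ⟨⟨h1, h2⟩, rfl⟩
      exact ⟨h1, h2, h1, rfl⟩
    · rintro ⟨h1, h2, -, rfl⟩
      exact ⟨⟨h1, h2⟩, rfl⟩

/-- Pairs of elements of `Z` may fall outside `Z`. An injection Z × Z → Z lets relations on `Z` be
coded by subsets of `Z`. -/
theorem exists_pairing {κ : Cardinal.{u}} (hκ : κ.IsInaccessible) {Z : ZFSet.{u}}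
    (hZ : Z ∈ V_ κ.ord) (hω : (ω : Ordinal.{u}).toZFSet ⊆ Z) :
    ∃ p ∈ V_ κ.ord, (∀ x ∈ Z, ∀ y ∈ Z, ∃ w ∈ Z, pair (pair x y) w ∈ p) ∧
      ∀ x y w x' y', pair (pair x y) w ∈ p → pair (pair x' y') w ∈ p → x = x' ∧ y = y' := by
  have hZω : ℵ₀ ≤ Z.card := by
    have := card_mono hω
    simpa using this
  have hle := card_prod_self_le hZω
  obtain ⟨F, hF, hFi⟩ := exists_injOn_of_card_le hle
  refine ⟨graphOn F (Z.prod Z), ?_, fun x hx y hy => ?_, fun x y w x' y' h h' => ?_⟩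
  · refine smallClosed_vonNeumann_ord hκ _ (fun p hp => ?_) ((card_img_le _ _).trans_lt
      (hle.trans_lt (card_lt_of_mem_vonNeumann hκ hZ)))
    obtain ⟨a, ha, rfl⟩ := mem_img.1 hp
    have ht := fun {x} (hx : x ∈ Z) => (isTransitive_vonNeumann _).mem_trans hx hZ
    refine pair_mem_vonNeumann_ord hκ ?_ (ht (hF a ha))
    obtain ⟨x, hx, y, hy, rfl⟩ := mem_prod.1 ha
    exact pair_mem_vonNeumann_ord hκ (ht hx) (ht hy)
  · have hxy := pair_mem_prod.2 ⟨hx, hy⟩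
    exact ⟨_, hF _ hxy, pair_mem_graphOn.2 ⟨hxy, rfl⟩⟩
  · obtain ⟨h1, rfl⟩ := pair_mem_graphOn.1 h
    obtain ⟨h2, h3⟩ := pair_mem_graphOn.1 h'
    exact pair_inj.1 (hFi _ h1 _ h2 h3)

end Unfoldable

/-! ### The hull with codes hereditarily of size at most |V_θ|. -/

namespace Unfoldable
open FirstOrder.Language ZFSet

namespace CoreData

variable {κ : Cardinal.{u}} {θ : Ordinal.{u}} {M N' : ZFSet.{u}} {e J : ZFSet.{u} → ZFSet.{u}}

theorem omega_mem (D : CoreData κ θ M N' e J) : (ω : Ordinal.{u}).toZFSet ∈ V_ κ.ord :=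
  toZFSet_mem_vonNeumann (by
    rw [← Cardinal.ord_aleph0]
    exact Cardinal.ord_lt_ord.2 D.inaccessible.aleph0_lt)

theorem pairing_reflect (D : CoreData κ θ M N' e J) {Z : ZFSet.{u}} (hZ : Z ∈ J (V_ κ.ord))
    (hω : (ω : Ordinal.{u}).toZFSet ⊆ Z) :
    ∃ p ∈ J (V_ κ.ord), (∀ x ∈ Z, ∀ y ∈ Z, ∃ w ∈ Z, pair (pair x y) w ∈ p) ∧
      ∀ x ∈ Z, ∀ y ∈ Z, ∀ w ∈ Z, ∀ x' ∈ Z, ∀ y' ∈ Z, pair (pair x y) w ∈ p →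
        pair (pair x' y') w ∈ p → x = x' ∧ y = y' := by
  have hfo : IsFO fun _ (v : Fin 2 → ZFSet.{u}) => ∀ Z ∈ v 0, v 1 ⊆ Z →
    ∃ p ∈ v 0, (∀ x ∈ Z, ∀ y ∈ Z, ∃ w ∈ Z, pair (pair x y) w ∈ p) ∧
      ∀ x ∈ Z, ∀ y ∈ Z, ∀ w ∈ Z, ∀ x' ∈ Z, ∀ y' ∈ Z, pair (pair x y) w ∈ p →
        pair (pair x' y') w ∈ p → x = x' ∧ y = y' := by
    apply IsFO.ball
    refine IsFO.imp (IsFO.subset_var _ _) ?_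
    apply IsFO.bex
    apply IsFO.and
    · repeat' first
        | apply IsFO.ball
        | apply IsFO.bex
        | exact IsFO.mem (((IsTerm.var _).pair (IsTerm.var _)).pair (IsTerm.var _)) _
    · apply IsFO.ball
      apply IsFO.ball
      apply IsFO.ball
      apply IsFO.ball
      apply IsFO.ball
      refine IsFO.imp ?_ (IsFO.imp ?_ (IsFO.and (IsFO.eq_var _ _) (IsFO.eq_var _ _)))
      · exact IsFO.mem (((IsTerm.var _).pair (IsTerm.var _)).pair (IsTerm.var _)) _
      · exact IsFO.mem (((IsTerm.var _).pair (IsTerm.var _)).pair (IsTerm.var _)) _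
  have h1 := D.reflect hfo ![V_ κ.ord, (ω : Ordinal.{u}).toZFSet]
    (by intro i; fin_cases i <;> simp [D.vonNeumann_subset D.omega_mem]) (fun Z hZ hω => by
      obtain ⟨p, hp, h1, h2⟩ := exists_pairing D.inaccessible hZ hω
      exact ⟨p, hp, h1, fun x _ y _ w _ x' _ y' _ => h2 x y w x' y'⟩)
  have h2 := h1 Z hZ
  simp only [Matrix.cons_val_one, Matrix.cons_val_zero] at h2
  rw [D.fix _ D.omega_mem] at h2
  exact h2 hω

/-- `exists_collapse_graph` as `N'` sees it. Well-foundedness is tested only on sets in `N'`; the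
clause `∃ y ∈ s, y = y` says that `s` is nonempty. -/
theorem collapse_reflect (D : CoreData κ θ M N' e J) : ∀ Z ∈ J (V_ κ.ord), ∀ p ∈ J (V_ κ.ord),
    ∀ a ∈ J (V_ κ.ord),
    (∀ s ∈ N', s ⊆ Z → (∃ y ∈ s, y = y) → ∃ y ∈ s, ∀ z ∈ s, ¬ ∃ w ∈ a, pair (pair z y) w ∈ p) →
    ∃ g ∈ J (V_ κ.ord), (∀ y ∈ Z, ∃ b ∈ J (V_ κ.ord), pair y b ∈ g) ∧ ∀ y ∈ Z, ∀ b ∈ N',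
      pair y b ∈ g → ∀ c ∈ N', c ∈ b ↔ ∃ z ∈ Z, (∃ w ∈ a, pair (pair z y) w ∈ p) ∧
        pair z c ∈ g := by
  have hfo : IsFO fun S (v : Fin 1 → ZFSet.{u}) => ∀ Z ∈ v 0, ∀ p ∈ v 0, ∀ a ∈ v 0,
    (∀ s ∈ S, s ⊆ Z → (∃ y ∈ s, y = y) → ∃ y ∈ s, ∀ z ∈ s, ¬ ∃ w ∈ a, pair (pair z y) w ∈ p) →
    ∃ g ∈ v 0, (∀ y ∈ Z, ∃ b ∈ v 0, pair y b ∈ g) ∧ ∀ y ∈ Z, ∀ b ∈ S,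
      pair y b ∈ g → ∀ c ∈ S, c ∈ b ↔ ∃ z ∈ Z, (∃ w ∈ a, pair (pair z y) w ∈ p) ∧
        pair z c ∈ g := by
    apply IsFO.ball
    apply IsFO.ball
    apply IsFO.ball
    apply IsFO.imp
    · apply IsFO.all
      apply IsFO.imp (IsFO.subset_var _ _)
      apply IsFO.imp
      · apply IsFO.bex
        apply IsFO.eq_var
      · apply IsFO.bex
        apply IsFO.ball
        apply IsFO.not
        apply IsFO.bex
        exact IsFO.mem (((IsTerm.var _).pair (IsTerm.var _)).pair (IsTerm.var _)) _
    · apply IsFO.bex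
      apply IsFO.and
      · apply IsFO.ball
        apply IsFO.bex
        exact IsFO.mem ((IsTerm.var _).pair (IsTerm.var _)) _
      · apply IsFO.ball
        apply IsFO.all
        apply IsFO.imp
        · exact IsFO.mem ((IsTerm.var _).pair (IsTerm.var _)) _
        · apply IsFO.all
          refine IsFO.iff (IsFO.mem_var _ _) ?_
          apply IsFO.bex
          apply IsFO.and
          · apply IsFO.bex
            exact IsFO.mem (((IsTerm.var _).pair (IsTerm.var _)).pair (IsTerm.var _)) _
          · exact IsFO.mem ((IsTerm.var _).pair (IsTerm.var _)) _
  exact D.reflect hfo ![V_ κ.ord] (by simp) (fun Z hZ p _ a _ hwf => by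
      obtain ⟨g, hg, h1, h2⟩ := exists_collapse_graph D.inaccessible hZ
        (R := fun z y => ∃ w ∈ a, pair (pair z y) w ∈ p)
        fun s hs ⟨y, hy⟩ => hwf s trivial hs ⟨y, hy, rfl⟩
      exact ⟨g, hg, h1, fun y hy b _ hb c _ => h2 y hy b hb c⟩)

/-- If all subsets of `Z` belong to `J (V_κ)`, then so do all sets that are hereditarily of
size at most `Z.card`. -/
theorem mem_U_of_isHereditarily (D : CoreData κ θ M N' e J) {Z : ZFSet.{u}}
    (hZ : ∀ a, a ⊆ Z → a ∈ J (V_ κ.ord)) (hω : (ω : Ordinal.{u}).toZFSet ⊆ Z) {x : ZFSet.{u}}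
    (hx : IsHereditarily Z.card x) : x ∈ J (V_ κ.ord) := by
  obtain ⟨t, ht, hxt, htc⟩ := hx
  obtain ⟨i, hi, hii⟩ := exists_injOn_of_card_le htc
  have hZU := hZ Z fun _ h => h
  obtain ⟨p, hp, hp1, hp2⟩ := D.pairing_reflect hZU hω
  have hUN : ∀ x ∈ J (V_ κ.ord), x ∈ N' := fun x hx => D.transN.mem_trans hx (D.J_mem _ (by simp))
  -- Membership on `t`, coded as a subset of `Z` and therefore in `J (V_κ)`, although nothing is
  -- known yet about `t`.
  let a : ZFSet.{u} := Z.sep fun w => ∃ v ∈ t, ∃ u ∈ v, pair (pair (i u) (i v)) w ∈ p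
  have hR : ∀ z ∈ Z, ∀ y ∈ Z, (∃ w ∈ a, pair (pair z y) w ∈ p) ↔
      ∃ v ∈ t, ∃ u ∈ v, z = i u ∧ y = i v := by
    intro z hz y hy
    constructor
    · rintro ⟨w, hw, hw'⟩
      obtain ⟨hwZ, v, hv, u, hu, h⟩ := mem_sep.1 hw
      exact ⟨v, hv, u, hu, hp2 z hz y hy w hwZ _ (hi _ (ht.mem_trans hu hv)) _ (hi _ hv) hw' h⟩
    · rintro ⟨v, hv, u, hu, rfl, rfl⟩
      obtain ⟨w, hw, h⟩ := hp1 _ hz _ hy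
      exact ⟨w, mem_sep.2 ⟨hw, v, hv, u, hu, h⟩, h⟩
  obtain ⟨g, -, hg1, hg2⟩ := D.collapse_reflect Z hZU p hp a (hZ a sep_subset) (by
    rintro s - hs ⟨y, hy, -⟩
    -- Points outside the image of `t` have no predecessors. If `s` meets the image, an ∈-minimal
    -- element of the preimage gives a minimal point.
    by_cases h : (t.sep fun v => i v ∈ s) = ∅
    · refine ⟨y, hy, fun z hz hR' => ?_⟩
      obtain ⟨v, hv, u, hu, rfl, rfl⟩ := (hR z (hs hz) y (hs hy)).1 hR'
      exact notMem_empty v (h ▸ mem_sep.2 ⟨hv, hy⟩)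
    · obtain ⟨v, hv, hv'⟩ := ZFSet.regularity _ h
      obtain ⟨hvt, hvs⟩ := mem_sep.1 hv
      refine ⟨i v, hvs, fun z hz hR' => ?_⟩
      obtain ⟨v', hv', u, hu, rfl, h'⟩ := (hR z (hs hz) _ (hs hvs)).1 hR'
      obtain rfl := hii _ hvt _ hv' h'
      refine notMem_empty u ?_
      rw [← ‹_ ∩ v = ∅›]
      exact mem_inter.2 ⟨mem_sep.2 ⟨ht.mem_trans hu hvt, hz⟩, hu⟩)
  -- The collapse computed in `N'` sends `i y` back to `y`.
  have key : ∀ y ∈ t, ∀ b ∈ N', pair (i y) b ∈ g → b = y := by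
    intro y
    induction y using ZFSet.inductionOn with
    | h y ih =>
      intro hy b hb hyb
      have h1 := hg2 _ (hi y hy) b hb hyb
      ext c
      constructor
      · intro hc
        have hcN := D.transN.mem_trans hc hb
        obtain ⟨z, hz, hzR, hzc⟩ := (h1 c hcN).1 hc
        obtain ⟨v, hv, u, hu, rfl, hv'⟩ := (hR z hz _ (hi y hy)).1 hzR
        obtain rfl := hii _ hy _ hv hv'
        rwa [ih u hu (ht.mem_trans hu hy) c hcN hzc]
      · intro hc
        have hct := ht.mem_trans hc hy
        obtain ⟨b', hb', hcb'⟩ := hg1 _ (hi c hct)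
        obtain rfl := ih c hc hct b' (hUN _ hb') hcb'
        exact (h1 _ (hUN _ hb')).2 ⟨_, hi _ hct, (hR _ (hi _ hct) _ (hi y hy)).2
          ⟨y, hy, _, hc, rfl, rfl⟩, hcb'⟩
  obtain ⟨b, hb, hxb⟩ := hg1 _ (hi x hxt)
  rwa [← key x hxt b (hUN _ hb) hxb]

/-- The target of a `θ`-strong unfoldability embedding can be taken closed under sequences of
length the size of `V_θ`, if `κ` is `(θ + 1)`-strongly unfoldable. -/
theorem exists_embedding_add_one (D : CoreData κ (θ + 1) M N' e J) (hκθ : κ.ord ≤ θ) :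
    ∃ (N : ZFSet.{u}) (j : M ↪ₑ[setLang] N), N.IsTransitive ∧ IsCriticalPoint j κ.ord ∧
      (∃ δ, θ + 1 ≤ δ ∧ MapsOrdinal j κ.ord δ) ∧ V_ (θ + 1) ⊆ N ∧
      N.card ≤ 2 ^ (V_ θ).card ∧ SmallClosed N (Order.succ (V_ θ).card) := by
  have hmax : max (θ + 1) κ.ord = θ + 1 := max_eq_left (hκθ.trans (Order.le_succ θ))
  have hVU := D.vonNeumann_subset_U
  rw [hmax] at hVU
  have hωκ : (ω : Ordinal.{u}) ≤ κ.ord := by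
    rw [← Cardinal.ord_aleph0]
    exact Cardinal.ord_le_ord.2 D.inaccessible.aleph0_lt.le
  have hω : (ω : Ordinal.{u}).toZFSet ⊆ V_ θ := fun x hx =>
    vonNeumann_subset_of_le (hωκ.trans hκθ) (toZFSet_subset_vonNeumann _ hx)
  have hZω : ℵ₀ ≤ (V_ θ).card := by
    have := card_mono hω
    simpa using this
  have hsub : ∀ a, a ⊆ V_ θ → a ∈ V_ (θ + 1) := fun a ha => by
    rwa [vonNeumann_add_one, mem_powerset]
  let C : ZFSet.{u} := (J (V_ κ.ord)).sep (IsHereditarily (V_ θ).card)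
  -- Separating from `J (V_κ)` loses nothing, because every subset of V_θ is in V_(θ+1) and hence in
  -- `J (V_κ)`.
  have hC : ∀ x, x ∈ C ↔ IsHereditarily (V_ θ).card x := fun x => by
    rw [mem_sep, and_iff_right_iff_imp]
    exact D.mem_U_of_isHereditarily (fun a ha => hVU (hsub a ha)) hω
  have hCs : SmallClosed C (Order.succ (V_ θ).card) := fun B hB hBc =>
    (hC B).2 (isHereditarily_of_subset hZω (fun b hb => (hC b).1 (hB hb)) (Order.lt_succ_iff.1 hBc))
  obtain ⟨N, j, h1, h2, ⟨δ, hδ, -, hδ'⟩, h3, h4, h5⟩ := D.exists_embedding (C := C) sep_subset (by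
    rw [hmax]
    intro x hx
    rw [vonNeumann_add_one, mem_powerset] at hx
    exact hCs x (fun y hy => (hC y).2 ⟨_, isTransitive_vonNeumann θ, hx hy, le_rfl⟩)
      (Order.lt_succ_iff.2 (card_mono hx)))
    (fun x hx y hy => hCs.pair_mem (hZω.trans (Order.le_succ _)) hx hy)
  rw [hmax] at hδ h3
  exact ⟨N, j, h1, h2, ⟨δ, hδ, hδ'⟩, h3,
    h4.trans (card_le_of_isHereditarily hZω fun x hx => (hC x).1 hx), h5 _ hCs⟩

end CoreData

end Unfoldable

/-! ### The three kinds of embeddings. -/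

namespace Unfoldable
open FirstOrder.Language ZFSet

variable {T : setLang.Theory} {κ : Cardinal.{u}} {M : ZFSet.{u}}

theorem IsThetaStronglyUnfoldable.mono {θ θ' : Ordinal.{u}} (h : IsThetaStronglyUnfoldable T κ θ')
    (hle : θ ≤ θ') : IsThetaStronglyUnfoldable T κ θ := fun M hM => by
  obtain ⟨N, j, h1, h2, ⟨δ, hδ, hδ'⟩, h3⟩ := h M hM
  exact ⟨N, j, h1, h2, ⟨δ, hle.trans hδ, hδ'⟩, fun x hx => h3 (vonNeumann_subset_of_le hle hx)⟩

theorem MapsOrdinal.mem {N : ZFSet.{u}} {j : M ↪ₑ[setLang] N} {α β : Ordinal.{u}}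
    (h : MapsOrdinal j α β) : β.toZFSet ∈ N := by
  obtain ⟨h1, h2⟩ := h
  rw [← h2]
  exact Subtype.mem _

/-- If `κ` is `θ`-strongly unfoldable for some `θ`, then each `κ`-model has an embedding with
critical point `κ` into a `κ`-model. -/
theorem exists_embedding_isKappaModel (hT : T ⊆ ZFC) (hr : rangeAxiom.{u} ∈ T) {θ : Ordinal.{u}}
    (hu : IsThetaStronglyUnfoldable T κ θ) (hM : IsKappaModel T κ M) :
    ∃ (N : ZFSet.{u}) (j : M ↪ₑ[setLang] N), IsKappaModel T κ N ∧ IsCriticalPoint j κ.ord ∧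
      ∃ δ, κ.ord < δ ∧ MapsOrdinal j κ.ord δ := by
  have hκ := isInaccessible hT hr hu hM
  -- At θ = 0 the codes can be all of V_κ, which has size κ and contains its subsets of size less
  -- than κ; hence `N` is a κ-model.
  obtain ⟨N', e, J, D⟩ := exists_coreData hT hr (hu.mono bot_le) hM
  have hV := smallClosed_vonNeumann_ord hκ
  have hmax : max ⊥ κ.ord = κ.ord := max_eq_right bot_le
  have hVU := D.vonNeumann_subset_U
  rw [hmax] at hVU
  obtain ⟨N, j, h1, h2, ⟨δ, -, hδ, hδ'⟩, h3, h4, h5⟩ := D.exists_embedding hVU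
    (by rw [hmax]) fun x hx y hy => pair_mem_vonNeumann_ord hκ hx hy
  rw [hmax] at h3
  refine ⟨N, j, isKappaModel_of_smallClosed h1 hκ.aleph0_lt.le ?_
    (h1.mem_trans (toZFSet_mem_toZFSet_iff.2 hδ) hδ'.mem) ((j.theory_model_iff T).1 hM.models)
    (h5 _ hV), h2, δ, hδ, hδ'⟩
  exact le_antisymm (h4.trans_eq (card_vonNeumann_ord hκ))
    ((card_vonNeumann_ord hκ).symm.trans_le (card_mono h3))

/-- The size of V_θ is `preBeth θ`, which agrees with ℶ_θ from ω² on, and ω² < κ. -/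
theorem card_vonNeumann_eq_beth (hκ : κ.IsInaccessible) {θ : Ordinal.{u}} (h : κ.ord ≤ θ) :
    (V_ θ).card = ℶ_ θ := by
  rw [card_vonNeumann]
  refine preBeth_of_omega0_sq_le (le_trans (le_of_lt ?_) h)
  have hω : (ω : Ordinal.{u}).card < κ := by simpa using hκ.aleph0_lt
  rw [Cardinal.lt_ord, pow_two, Ordinal.card_mul]
  exact Cardinal.mul_lt_of_lt hκ.aleph0_lt.le hω hω

theorem exists_seqClosed_beth (hT : T ⊆ ZFC) (hr : rangeAxiom.{u} ∈ T) {θ : Ordinal.{u}}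
    (hu : IsThetaStronglyUnfoldable T κ (θ + 1)) (hM : IsKappaModel T κ M) :
    ∃ (N : ZFSet.{u}) (j : M ↪ₑ[setLang] N), IsStrongUnfoldabilityEmbedding κ (θ + 1) j ∧
      (∃ δ, θ < δ ∧ MapsOrdinal j κ.ord δ) ∧
      (∀ α : Ordinal.{u}, α.card ≤ ℶ_ θ → SeqClosed N α) ∧ (κ.ord ≤ θ → N.card = ℶ_ (θ + 1)) := by
  have hκ := isInaccessible hT hr hu hM
  -- Below κ a κ-model as target suffices, since ℶ_θ < κ and V_κ is included in it.
  rcases lt_or_ge θ κ.ord with h | h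
  · obtain ⟨N, j, hN, hj, δ, hδ, hδ'⟩ := exists_embedding_isKappaModel hT hr hu hM
    have h1 : θ + 1 ≤ κ.ord := Order.succ_le_of_lt h
    have hsc := hN.smallClosed hr
    refine ⟨N, j, ⟨hN.transitive, hj, ⟨δ, h1.trans hδ.le, hδ'⟩, fun x hx =>
      vonNeumann_ord_subset hκ hsc (vonNeumann_subset_of_le h1 hx)⟩, ⟨δ, h.trans hδ, hδ'⟩,
      fun α hα => hsc.seqClosed hκ.aleph0_lt.le (hα.trans_lt ?_), fun h' => absurd h h'.not_gt⟩
    conv_rhs => rw [← hκ.beth_ord]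
    exact beth_strictMono h
  · obtain ⟨N', e, J, D⟩ := exists_coreData hT hr hu hM
    obtain ⟨N, j, h1, h2, ⟨δ, hδ, hδ'⟩, h3, h4, h5⟩ := D.exists_embedding_add_one h
    rw [card_vonNeumann_eq_beth hκ h] at h4 h5
    refine ⟨N, j, ⟨h1, h2, ⟨δ, hδ, hδ'⟩, h3⟩, ⟨δ, (lt_add_one θ).trans_le hδ, hδ'⟩,
      fun α hα => h5.seqClosed ((aleph0_le_beth θ).trans (Order.le_succ _))
        (Order.lt_succ_iff.2 hα), fun _ => le_antisymm ?_ ?_⟩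
    · rwa [beth_add_one]
    · rw [← card_vonNeumann_eq_beth hκ (θ := θ + 1) (h.trans (Order.le_succ θ))]
      exact card_mono h3

/-- For θ > κ the hull with codes in V_θ gives only θ ≤ j(κ). So it is applied to a κ-model `N₀`
that is the target of some j₀ : M → N₀: then j(j₀(κ)) > j(κ) ≥ θ because j₀(κ) > κ. -/
theorem exists_seqClosed_cof (hT : T ⊆ ZFC) (hr : rangeAxiom.{u} ∈ T) {θ : Ordinal.{u}}
    (hθ : Order.IsSuccLimit θ) (hu : IsThetaStronglyUnfoldable T κ θ) (hM : IsKappaModel T κ M) :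
    ∃ (N : ZFSet.{u}) (j : M ↪ₑ[setLang] N), IsStrongUnfoldabilityEmbedding κ θ j ∧
      (∃ δ, θ < δ ∧ MapsOrdinal j κ.ord δ) ∧ (∀ α < θ.cof.ord, SeqClosed N α) ∧
      (κ.ord ≤ θ → N.card = ℶ_ θ) := by
  have hκ := isInaccessible hT hr hu hM
  obtain ⟨N₀, j₀, hN₀, hj₀, δ₀, hδ₀, hδ₀'⟩ := exists_embedding_isKappaModel hT hr hu hM
  rcases le_or_gt θ κ.ord with h | h
  · have hsc := hN₀.smallClosed hr
    refine ⟨N₀, j₀, ⟨hN₀.transitive, hj₀, ⟨δ₀, h.trans hδ₀.le, hδ₀'⟩, fun x hx =>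
      vonNeumann_ord_subset hκ hsc (vonNeumann_subset_of_le h hx)⟩, ⟨δ₀, h.trans_lt hδ₀, hδ₀'⟩,
      fun α hα => hsc.seqClosed hκ.aleph0_lt.le ((Cardinal.lt_ord.1 hα).trans_le ?_), fun h' => ?_⟩
    · exact (Ordinal.cof_le_card θ).trans ((Ordinal.card_le_card h).trans_eq (Cardinal.card_ord κ))
    · rw [hN₀.card_eq, le_antisymm h h', hκ.beth_ord]
  · obtain ⟨N', e, J, D⟩ := exists_coreData hT hr hu hN₀
    have hmax : max θ κ.ord = θ := max_eq_left h.le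
    have hcof : ℵ₀ ≤ θ.cof := Ordinal.aleph0_le_cof_iff.2 (Ordinal.one_lt_cof_iff.2 hθ)
    have hV := smallClosed_vonNeumann θ
    have hVU := D.vonNeumann_subset_U
    rw [hmax] at hVU
    obtain ⟨N, j, h1, h2, ⟨δ, hδ, -, hδ'⟩, h3, h4, h5⟩ := D.exists_embedding hVU
      (by rw [hmax]) fun x hx y hy => hV.pair_mem hcof hx hy
    rw [hmax] at hδ h3
    obtain ⟨hκM, hjκ⟩ := hδ₀'
    have hδ₀N : δ₀.toZFSet ∈ N₀ := hjκ ▸ Subtype.mem _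
    have hcomp : ∀ {α β γ : Ordinal.{u}}, MapsOrdinal j₀ α β → MapsOrdinal j β γ →
        MapsOrdinal (j.comp j₀) α γ := by
      rintro α β γ ⟨h, h'⟩ ⟨k, k'⟩
      refine ⟨h, ?_⟩
      rw [← k']
      exact congrArg (fun z => (j z : ZFSet.{u})) (Subtype.ext h')
    obtain ⟨γ, hγ⟩ : ∃ γ : Ordinal.{u}, MapsOrdinal j δ₀ γ := by
      have := (isElem_ev (transClass_coe hN₀.transitive) (transClass_coe h1)
        (toClassEmb j)).isOrdinal hδ₀N (isOrdinal_toZFSet δ₀)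
      exact ⟨_, (mapsOrdinal_iff _ _ _).2 ⟨hδ₀N, this.toZFSet_rank_eq.symm⟩⟩
    have hδγ : δ < γ := by
      obtain ⟨k, k'⟩ := hδ'
      obtain ⟨l, l'⟩ := hγ
      rw [← toZFSet_mem_toZFSet_iff, ← k', ← l', emb_mem_iff_set]
      exact toZFSet_mem_toZFSet_iff.2 hδ₀
    have hκγ := hcomp ⟨hκM, hjκ⟩ hγ
    refine ⟨N, j.comp j₀, ⟨h1, ⟨hκM, fun h' => ?_, fun α hα => hcomp (hj₀.2.2 α hα)
      (h2.2.2 α hα)⟩, ⟨γ, hδ.trans hδγ.le, hκγ⟩, h3⟩, ⟨γ, hδ.trans_lt hδγ, hκγ⟩,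
      fun α hα => (h5 _ hV).seqClosed hcof (Cardinal.lt_ord.1 hα), fun _ => ?_⟩
    · obtain ⟨_, k⟩ := h'
      obtain ⟨_, l⟩ := hκγ
      exact (h.trans_le (hδ.trans hδγ.le)).ne (toZFSet_injective (k.symm.trans l))
    · rw [← card_vonNeumann_eq_beth hκ h.le]
      exact le_antisymm h4 (card_mono h3)

/-- Each element of V_θ is also a subset of it, so it has size at most |η|; ∈-induction applies. -/
theorem vonNeumann_subset_of_seqClosed (hM : M.IsTransitive) (hr : M ⊨ rangeAxiom.{u})
    {η θ : Ordinal.{u}} (hη : η.toZFSet ∈ M) (hc : SeqClosed M η) (h : (V_ θ).card ≤ η.card) :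
    V_ θ ⊆ M := by
  intro x
  induction x using ZFSet.inductionOn with
  | h x ih =>
    intro hx
    have ht := isTransitive_vonNeumann θ
    exact mem_of_seqClosed hM hr hη hc (fun y hy => ih y hy (ht.mem_trans hy hx))
      ((card_mono (ht.subset_of_mem hx)).trans h)

end Unfoldable

/-! ### The theorem. -/

theorem mainTheorem5 :
    ∃ T₀ : Unfoldable.setLang.Theory, T₀.Finite ∧ T₀ ⊆ Unfoldable.ZFC ∧
    ∀ T : Unfoldable.setLang.Theory, T.Finite → T₀ ⊆ T → T ⊆ Unfoldable.ZFC →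
    ∀ κ : Cardinal.{u},
      [ Unfoldable.IsStronglyUnfoldable T κ,
        ∀ M : ZFSet.{u}, Unfoldable.IsKappaModel T κ M → ∀ θ : Ordinal.{u},
          ∃ (N : ZFSet.{u}) (j : M ↪ₑ[Unfoldable.setLang] N),
            N.IsTransitive ∧ Unfoldable.IsCriticalPoint j κ.ord ∧
            (∃ δ, θ < δ ∧ Unfoldable.MapsOrdinal j κ.ord δ) ∧
            ZFSet.vonNeumann θ ⊆ N,
        ∀ M : ZFSet.{u}, Unfoldable.IsKappaModel T κ M → ∀ θ : Ordinal.{u},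
          ∃ (N : ZFSet.{u}) (j : M ↪ₑ[Unfoldable.setLang] N),
            N.IsTransitive ∧ Unfoldable.IsCriticalPoint j κ.ord ∧
            (∃ δ, θ < δ ∧ Unfoldable.MapsOrdinal j κ.ord δ) ∧
            Unfoldable.SeqClosed N θ ].TFAE ∧
      (∀ θ : Ordinal.{u}, Unfoldable.IsThetaStronglyUnfoldable T κ (θ + 1) →
        ∀ M : ZFSet.{u}, Unfoldable.IsKappaModel T κ M →
          ∃ (N : ZFSet.{u}) (j : M ↪ₑ[Unfoldable.setLang] N),
            Unfoldable.IsStrongUnfoldabilityEmbedding κ (θ + 1) j ∧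
            (∃ δ, θ < δ ∧ Unfoldable.MapsOrdinal j κ.ord δ) ∧
            Unfoldable.SeqClosed N (ℶ_ θ).ord ∧
            (κ.ord ≤ θ → N.card = ℶ_ (θ + 1))) ∧
      (∀ θ : Ordinal.{u}, Order.IsSuccLimit θ → Unfoldable.IsThetaStronglyUnfoldable T κ θ →
        ∀ M : ZFSet.{u}, Unfoldable.IsKappaModel T κ M →
          ∃ (N : ZFSet.{u}) (j : M ↪ₑ[Unfoldable.setLang] N),
            Unfoldable.IsStrongUnfoldabilityEmbedding κ θ j ∧
            (∃ δ, θ < δ ∧ Unfoldable.MapsOrdinal j κ.ord δ) ∧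
            (∀ α < θ.cof.ord, Unfoldable.SeqClosed N α) ∧
            (κ.ord ≤ θ → N.card = ℶ_ θ)) := by
  refine ⟨{Unfoldable.rangeAxiom.{u}}, Set.finite_singleton _,
    Set.singleton_subset_iff.2 (Unfoldable.IsZFCAxiom.replacement _), fun T _ hr hT κ => ?_⟩
  rw [Set.singleton_subset_iff] at hr
  refine ⟨?_, fun θ hu M hM => ?_, fun θ hθ hu M hM =>
    Unfoldable.exists_seqClosed_cof hT hr hθ hu hM⟩
  · tfae_have 1 → 2 := fun h M hM θ => by
      obtain ⟨N, j, h1, h2, ⟨δ, hδ, hδ'⟩, h3⟩ := h (θ + 1) M hM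
      exact ⟨N, j, h1, h2, ⟨δ, (lt_add_one θ).trans_le hδ, hδ'⟩,
        fun x hx => h3 (ZFSet.vonNeumann_subset_of_le (Order.le_succ θ) hx)⟩
    tfae_have 2 → 1 := fun h θ M hM => by
      obtain ⟨N, j, h1, h2, ⟨δ, hδ, hδ'⟩, h3⟩ := h M hM θ
      exact ⟨N, j, h1, h2, ⟨δ, hδ.le, hδ'⟩, h3⟩
    tfae_have 1 → 3 := fun h M hM θ => by
      obtain ⟨N, j, h1, ⟨δ, hδ, hδ'⟩, h2, -⟩ :=
        Unfoldable.exists_seqClosed_beth hT hr (h (θ + 1)) hM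
      exact ⟨N, j, h1.transitive, h1.critical, ⟨δ, hδ, hδ'⟩, h2 θ (Ordinal.card_le_beth θ)⟩
    tfae_have 3 → 1 := fun h θ M hM => by
      -- The length must be at least |V_θ| to capture V_θ, and at least θ to get j(κ) ≥ θ. Being
      -- less than j(κ), it is an element of `N`.
      obtain ⟨N, j, h1, h2, ⟨δ, hδ, hδ'⟩, h3⟩ := h M hM (max θ (ZFSet.vonNeumann θ).card.ord)
      have hN : N ⊨ T := (j.theory_model_iff T).1 hM.models
      refine ⟨N, j, h1, h2, ⟨δ, (le_max_left _ _).trans hδ.le, hδ'⟩,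
        Unfoldable.vonNeumann_subset_of_seqClosed h1 (hN.realize_of_mem _ hr)
          (h1.mem_trans (Ordinal.toZFSet_mem_toZFSet_iff.2 hδ) hδ'.mem) h3 ?_⟩
      exact (Cardinal.card_ord _).symm.trans_le (Ordinal.card_le_card (le_max_right _ _))
    tfae_finish
  · obtain ⟨N, j, h1, h2, h3, h4⟩ := Unfoldable.exists_seqClosed_beth hT hr hu hM
    exact ⟨N, j, h1, h2, h3 _ (Cardinal.card_ord _).le, h4⟩
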